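/- Let $d,q\ge 1$ and let $\Omega=\{1,\dots,q\}^{\mathbb Z^d}$ carry the product topology and its Borel $\sigma$-algebra; $\Delta\Subset\mathbb Z^d$ means that $\Delta$ is finite, and $\xi_\Delta\eta_{\Delta^c}$ is the configuration equal to $\xi$ on $\Delta$ and to $\eta$ off $\Delta$. Let $$Lf(\eta)=\sum_{\Delta\Subset\mathbb Z^d}\sum_{\xi_\Delta}c_\Delta(\eta,\xi_\Delta)\,[f(\xi_\Delta\eta_{\Delta^c})-f(\eta)]$$ with rates $c_\Delta(\eta,\xi_\Delta)\ge 0$ that are continuous in $\eta$, and put $c_\Delta(\eta)=\sum_{\xi_\Delta}c_\Delta(\eta,\xi_\Delta)$, $c_\Delta=\sup_\eta c_\Delta(\eta)$. Assume that $L$ is well-defined, i.e. $\sup_x\sum_{\Delta\ni x}c_\Delta<\infty$ and the closure of $L$ on local functions is the generator of a (Feller) Markov semigroup $(P^L_t)_{t\ge0}$ on $C(\Omega)$; write $P_t^L\nu$ for the law at time $t$ when the initial law is $\nu$. Assume moreover that 1. the rates are translation invariant; 2. there are finitely many types of transitions: for some finite $\Gamma\ni 0$, $c_\Delta=0$ whenever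 $0\in\Delta\not\subset\Gamma$; 3. the rates are uniformly continuous: $\lim_{\Lambda\uparrow\mathbb Z^d}\sup_{\Delta\ni0}\sup_{\eta,\xi,\sigma}|c_\Delta(\eta_\Lambda\xi_{\Lambda^c},\sigma_\Delta)-c_\Delta(\eta,\sigma_\Delta)|=0$; 4. $L$ has a minimal transition rate: if $c_\Delta>0$ then $\inf\{c_\Delta(\eta,\sigma_\Delta): c_\Delta(\eta,\sigma_\Delta)>0\}>0$; 5. $L$ cannot enter trap states: $c_\Delta(\eta,\sigma_\Delta)>0$ implies $c_\Delta(\sigma_\Delta\eta_{\Delta^c})>0$. Let $\gamma=(\gamma_\Lambda)_{\Lambda\Subset\mathbb Z^d}$ be a specification (a consistent family of proper probability kernels) that is translation invariant, non-null ($\inf_\eta\gamma_0(\eta_0|\eta_{0^c})>0$) and quasilocal ($\lim_{\Delta\uparrow\mathbb Z^d}\sup_{\eta,\xi}|\gamma_\Lambda(\eta_\Lambda|\eta_{\Delta\setminus\Lambda}\xi_{\Delta^c})-\gamma_\Lambda(\eta_\Lambda|\eta_{\Lambda^c})|=0$ for every $\Lambda\Subset\mathbb Z^d$), and let $\mathcal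 G(\gamma)$ be the set of its Gibbs measures, i.e. of the probability measures $\mu$ with $\mu\gamma_\Lambda=\mu$ for all $\Lambda\Subset\mathbb Z^d$. Let $\mu\in\mathcal G(\gamma)$ be translation invariant, time-stationary ($P^L_t\mu=\mu$ for all $t\ge0$) and asymptotically decoupled: with $\Lambda_n=[-n,n]^d$ there are $r:\mathbb N\to\mathbb N$ and $c:\mathbb N\to[0,\infty)$ with $r(n)/n\to0$ and $c(n)/|\Lambda_n|\to0$ such that $e^{-c(n)}\mu(A)\mu(B)\le\mu(A\cap B)\le e^{c(n)}\mu(A)\mu(B)$ for all $i\in\mathbb Z^d$, $n\in\mathbb N$, all events $A$ that depend only on $\Lambda_n+i$ and all events $B$ that depend only on $(\Lambda_{n+r(n)}+i)^c$. For a translation-invariant probability measure $\nu$ let $$g_L(\nu|\mu)=\lim_{n\to\infty}\frac1{|\Lambda_n|}\,\frac{d}{dt}\Big|_{t=0}h_{\Lambda_n}(P^L_t\nu|\mu),\qquad h_\Lambda(\nu|\mu)=\sum_{\omega_\Lambda}\nu(\omega_\Lambda)\log\frac{\nu(\omega_\Lambda)}{\mu(\omega_\Lambda)},$$ whenever the (right)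 derivatives and the limit exist ($h_\Lambda(\nu|\mu)=\infty$ if $\nu\not\ll\mu$ on $\Lambda$). Assume the zero entropy loss condition: every translation-invariant probability measure $\nu$ for which $g_L(\nu|\mu)$ exists and equals $0$ belongs to $\mathcal G(\gamma)$. Call a probability measure $\nu$ non-null if there is $\delta>0$ such that for every $a\in\{1,\dots,q\}$ the conditional probability, under $\nu$, of $\{\eta_0=a\}$ given $\eta_{0^c}$ is $\nu$-almost surely at least $\delta$. Then the following attractor property holds. If $\nu$ is a translation-invariant probability measure and $t_n\to\infty$ are times such that every $P^L_{t_n}\nu$ is non-null and $P^L_{t_n}\nu$ converges weakly to a non-null probability measure $\nu_*$, then $\nu_*\in\mathcal G(\gamma)$. -/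

import Mathlib

open MeasureTheory ProbabilityTheory Filter Topology
open scoped NNReal

noncomputable section

namespace SpinSystem

/-- Sites of the lattice `ℤ^d`. -/
abbrev Site (d : ℕ) : Type := Fin d → ℤ

/-- Configurations: one of `q` symbols at every site, with the product topology and the product
(that is, Borel) σ-algebra. -/
abbrev Config (d q : ℕ) : Type := Site d → Fin q

variable {d q : ℕ}

/-- The translate `Λ + i`. -/
def shiftSet (i : Site d) (Λ : Finset (Site d)) : Finset (Site d) :=
  Λ.map (addRightEmbedding i)

/-- The translate of a configuration, `(shift i η)(x + i) = η(x)`. -/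
def shift (i : Site d) (η : Config d q) : Config d q := fun x => η (x - i)

/-- The restriction `η_Λ`. -/
def restr (Λ : Finset (Site d)) (η : Config d q) : Λ → Fin q := fun x => η x

/-- The configuration `ξ_Λ η_{Λᶜ}`, equal to `ξ` on `Λ` and to `η` off `Λ`. -/
def splice {Λ : Finset (Site d)} (ξ : Λ → Fin q) (η : Config d q) : Config d q :=
  fun x => if h : x ∈ Λ then ξ ⟨x, h⟩ else η x

/-- The cylinder event of all configurations that equal `ξ` on `Λ`. -/
def cyl {Λ : Finset (Site d)} (ξ : Λ → Fin q) : Set (Config d q) := {σ | restr Λ σ = ξ}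

/-- The centred cube `[-n, n]^d`. -/
def box (d n : ℕ) : Finset (Site d) := Fintype.piFinset fun _ => Finset.Icc (-(n : ℤ)) n

/-! ### Random fields -/

/-- Invariance of a probability measure under all lattice translations. -/
def TranslationInvariant (ν : ProbabilityMeasure (Config d q)) : Prop :=
  ∀ i : Site d, (ν : Measure (Config d q)).map (shift i) = ν

/-- Non-nullness: the conditional probability, given the configuration off the origin, of each
symbol at the origin is almost surely bounded below by a fixed positive constant. -/
def NonNull (ν : ProbabilityMeasure (Config d q)) : Prop :=
  ∃ δ : ℝ, 0 < δ ∧ ∀ a : Fin q, ∀ᵐ η ∂(ν : Measure (Config d q)),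
    δ ≤ ((ν : Measure (Config d q))⟦{σ : Config d q | σ 0 = a} |
      cylinderEvents (X := fun _ : Site d => Fin q) {0}ᶜ⟧) η

/-- Asymptotic decoupling, with gap function `r` and decoupling constants `c`. -/
def AsymptoticallyDecoupled (μ : ProbabilityMeasure (Config d q)) : Prop :=
  ∃ (r : ℕ → ℕ) (c : ℕ → ℝ), (∀ n, 0 ≤ c n) ∧
    Tendsto (fun n => (r n : ℝ) / n) atTop (𝓝 0) ∧
    Tendsto (fun n => c n / (box d n).card) atTop (𝓝 0) ∧
    ∀ (i : Site d) (n : ℕ) (A B : Set (Config d q)),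
      MeasurableSet[cylinderEvents (X := fun _ : Site d => Fin q)
        (shiftSet i (box d n) : Set (Site d))] A →
      MeasurableSet[cylinderEvents (X := fun _ : Site d => Fin q)
        (shiftSet i (box d (n + r n)) : Set (Site d))ᶜ] B →
      Real.exp (-c n) * ((μ : Measure (Config d q)).real A * (μ : Measure (Config d q)).real B) ≤
        (μ : Measure (Config d q)).real (A ∩ B) ∧
      (μ : Measure (Config d q)).real (A ∩ B) ≤
        Real.exp (c n) * ((μ : Measure (Config d q)).real A * (μ : Measure (Config d q)).real B)

open Classical in
/-- Local relative entropy `h_Λ(ν|μ)`: the sum of `ν(ω_Λ) log (ν(ω_Λ) / μ(ω_Λ))` over the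
configurations in `Λ` if `ν ≪ μ` in the volume `Λ`, and `+∞` otherwise. -/
def localRelEntropy (Λ : Finset (Site d)) (ν μ : ProbabilityMeasure (Config d q)) : EReal :=
  if ∀ ω : Λ → Fin q, (μ : Measure (Config d q)) (cyl ω) = 0 →
      (ν : Measure (Config d q)) (cyl ω) = 0 then
    ((∑ ω : Λ → Fin q, (ν : Measure (Config d q)).real (cyl ω) *
      Real.log ((ν : Measure (Config d q)).real (cyl ω) /
        (μ : Measure (Config d q)).real (cyl ω)) : ℝ) : EReal)
  else ⊤

/-! ### Specifications and Gibbs measures -/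

/-- A specification: a consistent family of proper probability kernels, the one with index `Λ`
depending on the configuration off `Λ` only. -/
structure Specification (d q : ℕ) where
  kernel : (Λ : Finset (Site d)) →
    Kernel[cylinderEvents (X := fun _ : Site d => Fin q) (Λ : Set (Site d))ᶜ, MeasurableSpace.pi]
      (Config d q) (Config d q)
  isMarkov : ∀ Λ η, IsProbabilityMeasure (kernel Λ η)
  isProper : ∀ Λ, (kernel Λ).IsProper
  consistent : ∀ Δ Λ : Finset (Site d), Δ ⊆ Λ → ∀ (η : Config d q) (A : Set (Config d q)),
    MeasurableSet A → ∫⁻ σ, kernel Δ σ A ∂(kernel Λ η) = kernel Λ η A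

namespace Specification

/-- `γ_Λ(η_Λ | η_{Λᶜ})`. -/
def prob (γ : Specification d q) (Λ : Finset (Site d)) (η : Config d q) : ℝ :=
  (γ.kernel Λ η).real (cyl (restr Λ η))

def TranslationInvariant (γ : Specification d q) : Prop :=
  ∀ (Λ : Finset (Site d)) (i : Site d) (η : Config d q),
    γ.prob (shiftSet i Λ) (shift i η) = γ.prob Λ η

def NonNull (γ : Specification d q) : Prop :=
  ∃ δ : ℝ, 0 < δ ∧ ∀ η : Config d q, δ ≤ γ.prob {0} η

/-- Quasilocality; `γ_Λ(η_Λ | η_{Δ \ Λ} ξ_{Δᶜ})` is formed for the finite sets `Δ` that contain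
`Λ`, along which the limit is taken. -/
def Quasilocal (γ : Specification d q) : Prop :=
  ∀ (Λ : Finset (Site d)) (ε : ℝ), 0 < ε → ∀ᶠ Δ : Finset (Site d) in atTop,
    Λ ⊆ Δ ∧ ∀ η ξ : Config d q, |γ.prob Λ (splice (restr Δ η) ξ) - γ.prob Λ η| < ε

/-- The DLR equations: `μ ∈ G(γ)`. -/
def IsGibbs (γ : Specification d q) (μ : ProbabilityMeasure (Config d q)) : Prop :=
  ∀ (Λ : Finset (Site d)) (A : Set (Config d q)), MeasurableSet A →
    ∫⁻ η, γ.kernel Λ η A ∂(μ : Measure (Config d q)) = (μ : Measure (Config d q)) A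

end Specification

/-! ### Markov semigroups -/

/-- A Feller Markov semigroup on the configuration space, given by its transition kernels. -/
structure FellerSemigroup (d q : ℕ) where
  kernel : ℝ≥0 → Kernel (Config d q) (Config d q)
  isMarkov : ∀ t, IsMarkovKernel (kernel t)
  feller : ∀ (t : ℝ≥0) (f : C(Config d q, ℝ)), Continuous fun η => ∫ σ, f σ ∂(kernel t η)
  zero : kernel 0 = Kernel.id
  add : ∀ s t, kernel (s + t) = kernel t ∘ₖ kernel s
  continuous : ∀ f : C(Config d q, ℝ),
    Tendsto (fun t => (⟨fun η => ∫ σ, f σ ∂(kernel t η), feller t f⟩ : C(Config d q, ℝ)))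
      (𝓝 0) (𝓝 f)

namespace FellerSemigroup

/-- The action `P_t f` on continuous functions. -/
def act (P : FellerSemigroup d q) (t : ℝ≥0) (f : C(Config d q, ℝ)) : C(Config d q, ℝ) :=
  ⟨fun η => ∫ σ, f σ ∂(P.kernel t η), P.feller t f⟩

/-- The graph of the generator: pairs `(f, g)` such that `(P_t f - f) / t → g` uniformly
as `t ↓ 0`. -/
def generatorGraph (P : FellerSemigroup d q) : Set (C(Config d q, ℝ) × C(Config d q, ℝ)) :=
  {p | Tendsto (fun t : ℝ≥0 => (t : ℝ)⁻¹ • (P.act t p.1 - p.1)) (𝓝[>] 0) (𝓝 p.2)}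

/-- The law `P_t ν` at time `t` of the process started from `ν`. -/
def evolve (P : FellerSemigroup d q) (t : ℝ≥0) (ν : ProbabilityMeasure (Config d q)) :
    ProbabilityMeasure (Config d q) :=
  ⟨(ν : Measure (Config d q)).bind (P.kernel t), by
    have := P.isMarkov t
    infer_instance⟩

end FellerSemigroup

/-! ### Interacting particle systems -/

/-- Jump rates of an interacting particle system: `rate Δ η ξ` is the rate `c_Δ(η, ξ_Δ)` at which
the configuration `η` is replaced by `ξ_Δ η_{Δᶜ}`. -/
structure IPS (d q : ℕ) where
  rate : (Δ : Finset (Site d)) → Config d q → (Δ → Fin q) → ℝ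
  rate_nonneg : ∀ Δ η ξ, 0 ≤ rate Δ η ξ
  rate_continuous : ∀ Δ ξ, Continuous fun η => rate Δ η ξ

namespace IPS

/-- `c_Δ(η) = ∑_{ξ_Δ} c_Δ(η, ξ_Δ)`. -/
def totalRate (L : IPS d q) (Δ : Finset (Site d)) (η : Config d q) : ℝ :=
  ∑ ξ : Δ → Fin q, L.rate Δ η ξ

/-- `c_Δ = sup_η c_Δ(η)`; the supremum is over a continuous function on a compact space. -/
def supRate (L : IPS d q) (Δ : Finset (Site d)) : ℝ := ⨆ η : Config d q, L.totalRate Δ η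

/-- The graph of the formal generator
`L f(η) = ∑_Δ ∑_{ξ_Δ} c_Δ(η, ξ_Δ) [f(ξ_Δ η_{Δᶜ}) - f(η)]` on local functions `f`. -/
def preGeneratorGraph (L : IPS d q) : Set (C(Config d q, ℝ) × C(Config d q, ℝ)) :=
  {p | (∃ Λ : Finset (Site d), DependsOn (p.1 : Config d q → ℝ) (Λ : Set (Site d))) ∧
    ∀ η : Config d q, HasSum
      (fun Δ : Finset (Site d) =>
        ∑ ξ : Δ → Fin q, L.rate Δ η ξ * (p.1 (splice ξ η) - p.1 η)) (p.2 η)}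

/-- `P` is the Markov semigroup of `L`: its generator is the closure of `L` on local functions. -/
def IsSemigroupOf (L : IPS d q) (P : FellerSemigroup d q) : Prop :=
  P.generatorGraph = closure L.preGeneratorGraph

/-- The system is well-defined: the single-site jump intensities are uniformly bounded, and the
closure of the formal generator is the generator of a Markov semigroup. -/
def WellDefined (L : IPS d q) : Prop :=
  (∃ K : ℝ, ∀ x : Site d,
    Summable (fun Δ : {Δ : Finset (Site d) // x ∈ Δ} => L.supRate Δ) ∧
    ∑' Δ : {Δ : Finset (Site d) // x ∈ Δ}, L.supRate Δ ≤ K) ∧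
  ∃ P : FellerSemigroup d q, L.IsSemigroupOf P

/-- The Markov semigroup `(P_t^L)` of a well-defined system. -/
def semigroup (L : IPS d q) (hL : L.WellDefined) : FellerSemigroup d q := hL.2.choose

theorem semigroup_spec (L : IPS d q) (hL : L.WellDefined) :
    L.IsSemigroupOf (L.semigroup hL) := hL.2.choose_spec

/-- `c_{Δ+i}` at the translated configurations equals `c_Δ`. -/
def TranslationInvariant (L : IPS d q) : Prop :=
  ∀ (i : Site d) (Δ : Finset (Site d)) (η ζ : Config d q),
    L.rate (shiftSet i Δ) (shift i η) (restr (shiftSet i Δ) (shift i ζ)) =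
      L.rate Δ η (restr Δ ζ)

/-- Finitely many types of transitions. -/
def FinitelyManyTypes (L : IPS d q) : Prop :=
  ∃ Γ : Finset (Site d), 0 ∈ Γ ∧ ∀ Δ : Finset (Site d), 0 ∈ Δ → ¬ Δ ⊆ Γ → L.supRate Δ = 0

/-- `sup_{Δ ∋ 0} sup_{η, ξ, σ} |c_Δ(η_Λ ξ_{Λᶜ}, σ_Δ) - c_Δ(η, σ_Δ)| → 0` as `Λ ↑ ℤ^d`. -/
def UniformlyContinuousRates (L : IPS d q) : Prop :=
  ∀ ε : ℝ, 0 < ε → ∀ᶠ Λ : Finset (Site d) in atTop,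
    ∀ Δ : Finset (Site d), 0 ∈ Δ → ∀ (η ξ : Config d q) (σ : Δ → Fin q),
      |L.rate Δ (splice (restr Λ η) ξ) σ - L.rate Δ η σ| < ε

/-- `L` cannot enter trap states. -/
def NoTrapStates (L : IPS d q) : Prop :=
  ∀ (Δ : Finset (Site d)) (η : Config d q) (σ : Δ → Fin q),
    0 < L.rate Δ η σ → 0 < L.totalRate Δ (splice σ η)

/-- `L` has a minimal transition rate: for each `Δ`, the positive rates `c_Δ(η, σ_Δ)` are bounded
away from zero. -/
def MinimalTransitionRate (L : IPS d q) : Prop :=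
  ∀ Δ : Finset (Site d), 0 < L.supRate Δ →
    ∃ m : ℝ, 0 < m ∧ ∀ (η : Config d q) (σ : Δ → Fin q), 0 < L.rate Δ η σ → m ≤ L.rate Δ η σ

/-- `μ` is time-stationary for `L`. -/
def Stationary (L : IPS d q) (hL : L.WellDefined) (μ : ProbabilityMeasure (Config d q)) : Prop :=
  ∀ t : ℝ≥0, (L.semigroup hL).evolve t μ = μ

/-- The relative entropy loss density `g_L(ν|μ)` exists and equals `g`: in each cube `[-n, n]^d` the
local relative entropy of `P_t ν` is finite for small `t ≥ 0` and has a (right) derivative `D n` in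
`t` at `0`, and `D n` divided by the volume tends to `g`. -/
def HasEntropyLossDensity (L : IPS d q) (hL : L.WellDefined)
    (ν μ : ProbabilityMeasure (Config d q)) (g : ℝ) : Prop :=
  ∃ D : ℕ → ℝ,
    (∀ n : ℕ,
      (∀ᶠ t : ℝ≥0 in 𝓝 0,
        localRelEntropy (box d n) ((L.semigroup hL).evolve t ν) μ ≠ ⊤) ∧
      HasDerivWithinAt
        (fun t : ℝ => (localRelEntropy (box d n)
          ((L.semigroup hL).evolve t.toNNReal ν) μ).toReal) (D n) (Set.Ici 0) 0) ∧
    Tendsto (fun n => D n / (box d n).card) atTop (𝓝 g)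

/-- The zero entropy loss condition with the Gibbs measure `μ ∈ G(γ)`. -/
structure ZeroEntropyLossCondition (L : IPS d q) (hL : L.WellDefined) (γ : Specification d q)
    (μ : ProbabilityMeasure (Config d q)) : Prop where
  spec_translationInvariant : γ.TranslationInvariant
  spec_nonNull : γ.NonNull
  spec_quasilocal : γ.Quasilocal
  gibbs : γ.IsGibbs μ
  translationInvariant : SpinSystem.TranslationInvariant μ
  asymptoticallyDecoupled : AsymptoticallyDecoupled μ
  stationary : L.Stationary hL μ
  gibbs_of_zero_loss : ∀ ν : ProbabilityMeasure (Config d q),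
    SpinSystem.TranslationInvariant ν → L.HasEntropyLossDensity hL ν μ 0 → γ.IsGibbs ν

end IPS

end SpinSystem

end

open SpinSystem

/-!
A limit point `ν*` of the trajectory is translation invariant, and by the zero entropy loss
condition it suffices that its relative entropy loss density with respect to `μ` exists and
vanishes.

For translation-invariant `ν` the derivative of the relative entropy in a cube `Λ` is a sum over the
sites `x` of the contributions of the jumps at the origin, seen from the volume `V = Λ - x`. The
equilibrium average of the generator applied to `dν/dμ` vanishes and may be subtracted, which turns
each contribution into an *entropy balance* (`IPS.IsSemigroupOf.integral_localGen_eq`). A jump from a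
pattern of probability `a` to one of probability `b`, with equilibrium probability ratio `κ`, has
balance `-c ψ(a, κ b)` up to small errors, where `ψ(a, b) = a log (a / b) - a + b ≥ 0`, as soon as
`V` is so large that the rate `c` and the ratio `κ` are almost determined inside `V`; this is where
uniform continuity of the rates and quasilocality enter (`exists_jumpApprox`). With the approximate
`c` and `κ` held fixed, the resulting `dissipation` is monotone in `V` by the log-sum inequality
(`dissipation_mono`) and, for fixed `V`, continuous in the cylinder probabilities
(`tendsto_dissipation`). The few sites near the boundary of the cube contribute a bounded amount
each. These bounds hold from above for all `ν` with full support, and from below if `ν` is non-null.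

Hence no translation-invariant measure gains entropy per site in the limit of large cubes. If large
cubes lost entropy under `ν*`, then some fixed volume `V` would see a positive dissipation
(`eventually_le_sum_entropyBalance`). By continuity so would all measures of the trajectory in time
windows of a fixed length after the late times `t_n` (`eventually_lt_dissipation`), and by
monotonicity all large cubes would lose a fixed amount of entropy per site in each of these windows
(`eventually_sum_entropyBalance_le`). This is impossible, as the relative entropy per site stays
between `0` and a constant (`false_of_repeated_drop`). To differentiate the relative entropy where
cylinders may have probability zero, a small multiple of the stationary measure `μ` is mixed in and
then removed (`IPS.IsSemigroupOf.relEntropy_evolve_le`).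
-/

open MeasureTheory ProbabilityTheory Filter Topology
open scoped NNReal

namespace SpinSystem

variable {d q : ℕ}

/-! ### Local functions and cylinder events -/

theorem mem_cyl {Λ : Finset (Site d)} {ω : Λ → Fin q} {σ : Config d q} :
    σ ∈ cyl ω ↔ restr Λ σ = ω := Iff.rfl

theorem mem_cyl_restr {Λ : Finset (Site d)} {η σ : Config d q} :
    σ ∈ cyl (restr Λ η) ↔ ∀ x ∈ Λ, σ x = η x := by
  simp [mem_cyl, funext_iff, restr]

theorem restr_splice {Λ : Finset (Site d)} (ξ : Λ → Fin q) (η : Config d q) :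
    restr Λ (splice ξ η) = ξ := by
  funext x
  simp [restr, splice]

theorem continuous_restr (Λ : Finset (Site d)) :
    Continuous (restr Λ : Config d q → Λ → Fin q) := by
  unfold restr; fun_prop

theorem continuous_splice {Λ : Finset (Site d)} (ξ : Λ → Fin q) :
    Continuous (splice ξ : Config d q → Config d q) := by
  refine continuous_pi fun x => ?_
  by_cases h : x ∈ Λ
  · simpa [splice, h] using continuous_const
  · simpa [splice, h] using continuous_apply x

theorem continuous_shift (i : Site d) : Continuous (shift i : Config d q → Config d q) := by
  unfold shift; fun_prop

theorem measurable_shift (i : Site d) : Measurable (shift i : Config d q → Config d q) :=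
  (continuous_shift i).measurable

theorem isClopen_cyl {Λ : Finset (Site d)} (ω : Λ → Fin q) :
    IsClopen (cyl ω : Set (Config d q)) :=
  (isClopen_discrete {ω}).preimage (continuous_restr Λ)

theorem measurableSet_cyl {Λ : Finset (Site d)} (ω : Λ → Fin q) :
    MeasurableSet (cyl ω : Set (Config d q)) :=
  (isClopen_cyl ω).isOpen.measurableSet

theorem measurableSet_cyl_cylinderEvents {Λ : Finset (Site d)} (ω : Λ → Fin q) {S : Set (Site d)}
    (hS : (Λ : Set (Site d)) ⊆ S) :
    MeasurableSet[cylinderEvents (X := fun _ : Site d => Fin q) S] (cyl ω : Set (Config d q)) := by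
  have h : (cyl ω : Set (Config d q)) = ⋂ x : Λ, (fun σ : Config d q => σ x) ⁻¹' {ω x} := by
    ext σ; simp [mem_cyl, funext_iff, restr]
  rw [h]
  exact MeasurableSet.iInter fun x =>
    measurable_cylinderEvent_apply (X := fun _ : Site d => Fin q) (hS x.2) (measurableSet_singleton _)

/-- An event of the σ-algebra of the sites in `S` does not see the configuration off `S`. -/
theorem mem_iff_of_measurableSet_cylinderEvents {S : Set (Site d)} {A : Set (Config d q)}
    (hA : MeasurableSet[cylinderEvents (X := fun _ : Site d => Fin q) S] A)
    {η σ : Config d q} (h : ∀ x ∈ S, η x = σ x) : η ∈ A ↔ σ ∈ A := by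
  let m : MeasurableSpace (Config d q) :=
    { MeasurableSet' := fun A => η ∈ A ↔ σ ∈ A
      measurableSet_empty := Iff.rfl
      measurableSet_compl := fun A hA => not_congr hA
      measurableSet_iUnion := fun f hf => by simp only [Set.mem_iUnion]; exact exists_congr hf }
  have hle : cylinderEvents (X := fun _ : Site d => Fin q) S ≤ m := by
    refine iSup₂_le fun x hx => ?_
    rintro _ ⟨B, -, rfl⟩
    change η x ∈ B ↔ σ x ∈ B
    rw [h x hx]
  exact hle A hA

theorem eq_of_measurable_cylinderEvents {S : Set (Site d)} {β : Type*} [MeasurableSpace β]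
    [MeasurableSingletonClass β] {f : Config d q → β}
    (hf : Measurable[cylinderEvents (X := fun _ : Site d => Fin q) S] f)
    {η σ : Config d q} (h : ∀ x ∈ S, η x = σ x) : f η = f σ :=
  (mem_iff_of_measurableSet_cylinderEvents (hf (measurableSet_singleton (f σ))) h).2 rfl

/-- A function of the configuration in a finite volume, as a continuous function. -/
def localFun {Λ : Finset (Site d)} (v : (Λ → Fin q) → ℝ) : C(Config d q, ℝ) :=
  ⟨fun η => v (restr Λ η), continuous_of_discreteTopology.comp (continuous_restr Λ)⟩

@[simp] theorem localFun_apply {Λ : Finset (Site d)} (v : (Λ → Fin q) → ℝ) (η : Config d q) :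
    localFun v η = v (restr Λ η) := rfl

theorem dependsOn_localFun {Λ : Finset (Site d)} (v : (Λ → Fin q) → ℝ) :
    DependsOn (localFun v : Config d q → ℝ) (Λ : Set (Site d)) := by
  intro η σ h
  have : restr Λ η = restr Λ σ := funext fun x => h x x.2
  simp [this]

theorem integrable_continuousMap (ν : Measure (Config d q)) [IsFiniteMeasure ν]
    (f : C(Config d q, ℝ)) : Integrable f ν :=
  (BoundedContinuousFunction.mkOfCompact f).integrable ν

/-- Integration of a local function against a density, cylinder by cylinder. -/
theorem integral_mul_localFun (ν : Measure (Config d q)) [IsFiniteMeasure ν]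
    {c : Config d q → ℝ} (hc : Integrable c ν) {Λ : Finset (Site d)} (v : (Λ → Fin q) → ℝ) :
    ∫ η, c η * v (restr Λ η) ∂ν = ∑ ω : Λ → Fin q, v ω * ∫ η in cyl ω, c η ∂ν := by
  have h : ∀ η, c η * v (restr Λ η) =
      ∑ ω : Λ → Fin q, v ω * (cyl ω).indicator c η := by
    intro η
    rw [Finset.sum_eq_single (restr Λ η)]
    · rw [Set.indicator_of_mem (mem_cyl.2 rfl), mul_comm]
    · intro ω _ hω
      rw [Set.indicator_of_notMem (fun h => hω (mem_cyl.1 h).symm), mul_zero]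
    · simp
  simp_rw [h]
  rw [integral_finsetSum]
  · refine Finset.sum_congr rfl fun ω _ => ?_
    rw [integral_const_mul, integral_indicator (measurableSet_cyl ω)]
  · intro ω _
    exact (hc.indicator (measurableSet_cyl ω)).const_mul _

theorem integral_localFun (ν : Measure (Config d q)) [IsFiniteMeasure ν]
    {Λ : Finset (Site d)} (v : (Λ → Fin q) → ℝ) :
    ∫ η, v (restr Λ η) ∂ν = ∑ ω : Λ → Fin q, v ω * ν.real (cyl ω) := by
  have := integral_mul_localFun ν (integrable_const (1 : ℝ)) v
  simpa using this

theorem sum_measureReal_cyl (ν : Measure (Config d q)) [IsProbabilityMeasure ν]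
    (Λ : Finset (Site d)) : ∑ ω : Λ → Fin q, ν.real (cyl ω) = 1 := by
  have := integral_localFun ν (Λ := Λ) (fun _ => 1)
  simpa using this.symm

/-- Two probability measures that agree on all cylinders are equal. -/
theorem ext_of_cyl {μ ν : Measure (Config d q)} [IsProbabilityMeasure μ] [IsProbabilityMeasure ν]
    (h : ∀ (Λ : Finset (Site d)) (ω : Λ → Fin q), μ (cyl ω) = ν (cyl ω)) : μ = ν := by
  refine IsProjectiveLimit.unique (P := fun Λ => ν.map (Finset.restrict Λ)) (fun Λ => ?_)
    (fun Λ => rfl)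
  refine Measure.ext_of_singleton fun ω => ?_
  rw [Measure.map_apply (by fun_prop) (measurableSet_singleton _),
    Measure.map_apply (by fun_prop) (measurableSet_singleton _)]
  exact h Λ ω

/-- Weak convergence implies convergence of the probabilities of cylinders. -/
theorem tendsto_measureReal_cyl {ι : Type*} {l : Filter ι} {ν : ι → ProbabilityMeasure (Config d q)}
    {ρ : ProbabilityMeasure (Config d q)} (h : Tendsto ν l (𝓝 ρ)) {Λ : Finset (Site d)}
    (ω : Λ → Fin q) :
    Tendsto (fun i => (ν i : Measure (Config d q)).real (cyl ω)) l
      (𝓝 ((ρ : Measure (Config d q)).real (cyl ω))) := by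
  classical
  have h1 := ProbabilityMeasure.tendsto_iff_forall_integral_tendsto.1 h
    (BoundedContinuousFunction.mkOfCompact (localFun fun ω' : Λ → Fin q => if ω' = ω then 1 else 0))
  have h2 : ∀ ρ : ProbabilityMeasure (Config d q),
      ∫ η, localFun (fun ω' : Λ → Fin q => if ω' = ω then 1 else 0) η ∂(ρ : Measure (Config d q)) =
        (ρ : Measure (Config d q)).real (cyl ω) := fun ρ => by
    refine (integral_localFun (ρ : Measure (Config d q))
      (fun ω' : Λ → Fin q => if ω' = ω then 1 else 0)).trans ?_
    simp
  simp only [BoundedContinuousFunction.mkOfCompact_apply, h2] at h1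
  exact h1

/-! ### Translations -/

theorem shift_shift (i j : Site d) (η : Config d q) : shift i (shift j η) = shift (i + j) η := by
  funext x
  simp only [shift]
  congr 1
  abel

@[simp] theorem shift_zero (η : Config d q) : shift 0 η = η := by
  funext x; simp [shift]

theorem mem_shiftSet {i x : Site d} {Λ : Finset (Site d)} : x ∈ shiftSet i Λ ↔ x - i ∈ Λ := by
  simp only [shiftSet, Finset.mem_map, addRightEmbedding_apply]
  constructor
  · rintro ⟨y, hy, rfl⟩; simpa using hy
  · intro h; exact ⟨_, h, by simp⟩

theorem shiftSet_shiftSet (i j : Site d) (Λ : Finset (Site d)) :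
    shiftSet i (shiftSet j Λ) = shiftSet (i + j) Λ := by
  ext x
  simp only [mem_shiftSet]
  rw [show x - i - j = x - (i + j) by abel]

@[simp] theorem shiftSet_zero (Λ : Finset (Site d)) : shiftSet 0 Λ = Λ := by
  ext x; simp [mem_shiftSet]

theorem card_shiftSet (i : Site d) (Λ : Finset (Site d)) : (shiftSet i Λ).card = Λ.card :=
  Finset.card_map _

/-- A cylinder in `Λ` is translated back to a cylinder in `Λ - x`. -/
theorem shift_preimage_cyl (x : Site d) (Λ : Finset (Site d)) (η : Config d q) :
    shift x ⁻¹' cyl (restr Λ (shift x η)) = cyl (restr (shiftSet (-x) Λ) η) := by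
  ext σ
  simp only [Set.mem_preimage, mem_cyl_restr, mem_shiftSet, sub_neg_eq_add, shift]
  constructor
  · intro h y hy
    simpa using h _ hy
  · intro h y hy
    exact h _ (by simpa using hy)

theorem TranslationInvariant.measureReal_cyl_shift {ν : ProbabilityMeasure (Config d q)}
    (hν : TranslationInvariant ν) (x : Site d) (Λ : Finset (Site d)) (η : Config d q) :
    (ν : Measure (Config d q)).real (cyl (restr Λ (shift x η))) =
      (ν : Measure (Config d q)).real (cyl (restr (shiftSet (-x) Λ) η)) := by
  rw [← shift_preimage_cyl]
  conv_lhs => rw [← hν x]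
  rw [map_measureReal_apply (measurable_shift x) (measurableSet_cyl _)]

theorem TranslationInvariant.integral_shift {ν : ProbabilityMeasure (Config d q)}
    (hν : TranslationInvariant ν) (x : Site d) (f : C(Config d q, ℝ)) :
    ∫ η, f (shift x η) ∂(ν : Measure (Config d q)) = ∫ η, f η ∂(ν : Measure (Config d q)) := by
  conv_rhs => rw [← hν x]
  rw [integral_map (measurable_shift x).aemeasurable f.continuous.aestronglyMeasurable]

/-- Translation invariance is inherited by weak limits. -/
theorem TranslationInvariant.of_tendsto {ι : Type*} {l : Filter ι} [l.NeBot]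
    {ν : ι → ProbabilityMeasure (Config d q)} {ρ : ProbabilityMeasure (Config d q)}
    (hν : ∀ i, TranslationInvariant (ν i)) (h : Tendsto ν l (𝓝 ρ)) : TranslationInvariant ρ := by
  intro x
  have hp : IsProbabilityMeasure ((ρ : Measure (Config d q)).map (shift x)) :=
    Measure.isProbabilityMeasure_map (measurable_shift x).aemeasurable
  refine ext_of_cyl fun Λ ω => ?_
  rcases (cyl ω : Set (Config d q)).eq_empty_or_nonempty with he | ⟨η, hη⟩
  · simp [he]
  obtain rfl := mem_cyl.1 hη
  have hη' : η = shift x (shift (-x) η) := by rw [shift_shift]; simp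
  rw [Measure.map_apply (measurable_shift x) (measurableSet_cyl _), hη', shift_preimage_cyl,
    ← ENNReal.toReal_eq_toReal_iff' (measure_ne_top _ _) (measure_ne_top _ _)]
  refine tendsto_nhds_unique (tendsto_measureReal_cyl h _) ?_
  simp_rw [← (hν _).measureReal_cyl_shift]
  exact tendsto_measureReal_cyl h _

/-! ### Feller semigroups -/

namespace FellerSemigroup

variable (P : FellerSemigroup d q)

theorem act_apply (t : ℝ≥0) (f : C(Config d q, ℝ)) (η : Config d q) :
    P.act t f η = ∫ σ, f σ ∂(P.kernel t η) := rfl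

theorem act_zero (f : C(Config d q, ℝ)) : P.act 0 f = f := by
  ext η
  simp [act_apply, P.zero, Kernel.id_apply]

theorem act_add (s t : ℝ≥0) (f : C(Config d q, ℝ)) : P.act (s + t) f = P.act s (P.act t f) := by
  ext η
  have := P.isMarkov s
  have := P.isMarkov t
  simp only [act_apply, P.add]
  rw [Kernel.integral_comp (integrable_continuousMap _ f)]

theorem act_sub (t : ℝ≥0) (f g : C(Config d q, ℝ)) : P.act t (f - g) = P.act t f - P.act t g := by
  ext η
  have := P.isMarkov t
  simp only [act_apply, ContinuousMap.sub_apply]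
  exact integral_sub (integrable_continuousMap _ f) (integrable_continuousMap _ g)

theorem act_smul (t : ℝ≥0) (c : ℝ) (f : C(Config d q, ℝ)) : P.act t (c • f) = c • P.act t f := by
  ext η
  simp only [act_apply, ContinuousMap.smul_apply]
  exact integral_smul c f

theorem norm_act_le (t : ℝ≥0) (f : C(Config d q, ℝ)) : ‖P.act t f‖ ≤ ‖f‖ := by
  have := P.isMarkov t
  refine (ContinuousMap.norm_le _ (norm_nonneg _)).2 fun η => ?_
  rw [act_apply]
  refine (norm_integral_le_of_norm_le_const (C := ‖f‖)
    (Eventually.of_forall fun σ => f.norm_coe_le_norm σ)).trans ?_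
  simp

theorem tendsto_act_zero (f : C(Config d q, ℝ)) : Tendsto (fun t => P.act t f) (𝓝 0) (𝓝 f) :=
  P.continuous f

theorem norm_act_sub_act_le (s t : ℝ≥0) (f : C(Config d q, ℝ)) :
    ‖P.act t f - P.act s f‖ ≤ ‖P.act (nndist s t) f - f‖ := by
  wlog h : s ≤ t generalizing s t
  · rw [norm_sub_rev, nndist_comm]
    exact this t s (le_of_not_ge h)
  obtain ⟨r, rfl⟩ := exists_add_of_le h
  have hr : nndist s (s + r) = r := by
    rw [← NNReal.coe_inj, coe_nndist, NNReal.dist_eq]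
    push_cast
    rw [show (s : ℝ) - (s + r) = -r by ring, abs_neg]
    exact abs_of_nonneg r.2
  rw [hr, P.act_add, ← P.act_sub]
  exact P.norm_act_le _ _

theorem continuous_act : Continuous fun p : ℝ≥0 × C(Config d q, ℝ) => P.act p.1 p.2 := by
  rw [continuous_iff_continuousAt]
  rintro ⟨s, f⟩
  rw [ContinuousAt, tendsto_iff_norm_sub_tendsto_zero]
  have h1 : Tendsto (fun p : ℝ≥0 × C(Config d q, ℝ) =>
      ‖p.2 - f‖ + ‖P.act (nndist s p.1) f - f‖) (𝓝 (s, f)) (𝓝 (0 + 0)) := by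
    refine Tendsto.add ?_ ?_
    · have : Continuous fun p : ℝ≥0 × C(Config d q, ℝ) => ‖p.2 - f‖ := by fun_prop
      simpa using this.tendsto (s, f)
    · rw [← tendsto_iff_norm_sub_tendsto_zero]
      refine (P.tendsto_act_zero f).comp ?_
      have : Continuous fun p : ℝ≥0 × C(Config d q, ℝ) => nndist s p.1 := by fun_prop
      simpa using this.tendsto (s, f)
  rw [add_zero] at h1
  refine squeeze_zero (fun _ => norm_nonneg _) (fun p => ?_) h1
  calc ‖P.act p.1 p.2 - P.act s f‖
      = ‖P.act p.1 (p.2 - f) + (P.act p.1 f - P.act s f)‖ := by rw [act_sub]; congr 1; abel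
    _ ≤ _ := (norm_add_le _ _).trans
        (add_le_add (P.norm_act_le _ _) (P.norm_act_sub_act_le _ _ _))

/-- Orbits of the semigroup through the domain of the generator are right differentiable. -/
theorem hasDerivWithinAt_act {f g : C(Config d q, ℝ)} (h : (f, g) ∈ P.generatorGraph)
    {s : ℝ} (hs : 0 ≤ s) :
    HasDerivWithinAt (fun r : ℝ => P.act r.toNNReal f) (P.act s.toNNReal g) (Set.Ici s) s := by
  rw [hasDerivWithinAt_iff_tendsto_slope, Set.Ici_sdiff_left]
  have h1 : Tendsto (fun r : ℝ => (r - s).toNNReal) (𝓝[>] s) (𝓝[>] 0) := by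
    refine tendsto_nhdsWithin_iff.2 ⟨?_, ?_⟩
    · have : Continuous fun r : ℝ => (r - s).toNNReal := by fun_prop
      have h2 := this.tendsto s
      simp only [sub_self, Real.toNNReal_zero] at h2
      exact h2.mono_left nhdsWithin_le_nhds
    · filter_upwards [self_mem_nhdsWithin] with r hr
      exact Real.toNNReal_pos.2 (sub_pos.2 hr)
  have h2 : Continuous fun f => P.act s.toNNReal f :=
    P.continuous_act.comp (by fun_prop : Continuous fun f => (s.toNNReal, f))
  refine ((h2.tendsto g).comp (Tendsto.comp h h1)).congr' ?_
  filter_upwards [self_mem_nhdsWithin] with r hr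
  have hr : s < r := hr
  have hrs : r.toNNReal = s.toNNReal + (r - s).toNNReal := by
    rw [← Real.toNNReal_add hs (by linarith)]; congr 1; ring
  simp only [Function.comp_apply, slope, vsub_eq_sub]
  rw [Real.coe_toNNReal _ (by linarith), act_smul, act_sub, ← act_add, ← hrs]

theorem act_mem_generatorGraph {f g : C(Config d q, ℝ)} (h : (f, g) ∈ P.generatorGraph)
    (s : ℝ≥0) : (P.act s f, P.act s g) ∈ P.generatorGraph := by
  have h2 : Continuous fun f => P.act s f :=
    P.continuous_act.comp (by fun_prop : Continuous fun f => (s, f))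
  refine ((h2.tendsto g).comp h).congr fun t => ?_
  simp only [Function.comp_apply]
  rw [act_smul, act_sub, ← act_add, ← act_add, add_comm]

/-- If a bounded operator `U` on `C(Ω)` preserves the generator, it commutes with the semigroup on the domain
of the generator: `s ↦ P_{t-s} U P_s f` has vanishing right derivative. -/
theorem act_comm {U : C(Config d q, ℝ) →L[ℝ] C(Config d q, ℝ)}
    (hU : ∀ f g, (f, g) ∈ P.generatorGraph → (U f, U g) ∈ P.generatorGraph)
    {f g : C(Config d q, ℝ)} (h : (f, g) ∈ P.generatorGraph) (t : ℝ≥0) :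
    P.act t (U f) = U (P.act t f) := by
  let u : ℝ → C(Config d q, ℝ) := fun s => P.act (t - s).toNNReal (U (P.act s.toNNReal f))
  have hu : ContinuousOn u (Set.Icc 0 t) := by
    refine Continuous.continuousOn (P.continuous_act.comp (Continuous.prodMk (by fun_prop) ?_))
    refine U.continuous.comp (P.continuous_act.comp (Continuous.prodMk (by fun_prop) (by fun_prop)))
  have hd : ∀ s ∈ Set.Ico (0 : ℝ) t, HasDerivWithinAt u 0 (Set.Ici s) s := by
    intro s hs
    have hG := P.act_mem_generatorGraph h s.toNNReal
    have h1 := P.hasDerivWithinAt_act hG le_rfl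
    have h2 := P.hasDerivWithinAt_act (hU _ _ hG) le_rfl
    have h3 := (U.hasFDerivAt.comp_hasDerivWithinAt _ h1).sub h2
    simp only [Real.toNNReal_zero, act_zero, sub_self] at h3
    have h4 : HasDerivWithinAt (fun r : ℝ => r - s) 1 (Set.Ici s) s :=
      (hasDerivWithinAt_id s _).sub_const s
    have h5 := HasDerivWithinAt.scomp_of_eq (x := s) (h := fun r : ℝ => r - s) (t' := Set.Ici 0)
      h3 h4 (fun r hr => Set.mem_Ici.2 (sub_nonneg.2 hr)) (by simp)
    rw [hasDerivWithinAt_iff_isLittleO] at h5 ⊢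
    refine Asymptotics.IsBigO.trans_isLittleO (Asymptotics.IsBigO.of_bound 1 ?_) h5
    have : Set.Ici s ∩ Set.Iio (t : ℝ) ∈ 𝓝[≥] s :=
      inter_mem self_mem_nhdsWithin (mem_nhdsWithin_of_mem_nhds (Iio_mem_nhds hs.2))
    filter_upwards [this] with r hr
    have hsr : s ≤ r := hr.1
    have hrt : r < t := hr.2
    have e1 : r.toNNReal = (r - s).toNNReal + s.toNNReal := by
      rw [← Real.toNNReal_add (by linarith) hs.1]; congr 1; ring
    have e2 : ((t : ℝ) - s).toNNReal = (t - r).toNNReal + (r - s).toNNReal := by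
      rw [← Real.toNNReal_add (by linarith) (by linarith)]; congr 1; ring
    have e3 : u r - u s = P.act (t - r).toNNReal (U (P.act (r - s).toNNReal (P.act s.toNNReal f))
        - P.act (r - s).toNNReal (U (P.act s.toNNReal f))) := by
      simp only [u]
      rw [act_sub, ← act_add, ← act_add, ← e1, ← e2]
    simp only [smul_zero, sub_zero, one_mul]
    rw [e3]
    refine (P.norm_act_le _ _).trans (le_of_eq ?_)
    simp [act_zero]
  have := constant_of_has_deriv_right_zero hu hd t ⟨t.2, le_rfl⟩
  simpa [u, act_zero] using this.symm

/-! ### Evolution of measures -/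

theorem integral_evolve (t : ℝ≥0) (ν : ProbabilityMeasure (Config d q)) (f : C(Config d q, ℝ)) :
    ∫ η, f η ∂(P.evolve t ν : Measure (Config d q)) =
      ∫ η, P.act t f η ∂(ν : Measure (Config d q)) := by
  have := P.isMarkov t
  change ∫ η, f η ∂((ν : Measure (Config d q)).bind (P.kernel t)) = _
  rw [Measure.comp_eq_comp_const_apply, Kernel.integral_comp]
  · rfl
  · rw [← Measure.comp_eq_comp_const_apply]
    exact integrable_continuousMap _ f

theorem evolve_add (s t : ℝ≥0) (ν : ProbabilityMeasure (Config d q)) :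
    P.evolve (s + t) ν = P.evolve t (P.evolve s ν) := by
  refine Subtype.ext ?_
  change (ν : Measure (Config d q)).bind (P.kernel (s + t)) =
    ((ν : Measure (Config d q)).bind (P.kernel s)).bind (P.kernel t)
  rw [P.add, Measure.comp_assoc]

theorem evolve_zero (ν : ProbabilityMeasure (Config d q)) : P.evolve 0 ν = ν := by
  refine Subtype.ext ?_
  change (ν : Measure (Config d q)).bind (P.kernel 0) = ν
  rw [P.zero, Measure.id_comp]

end FellerSemigroup

/-- Integration against a probability measure, as a continuous linear functional. -/
noncomputable def integralCLM (ν : ProbabilityMeasure (Config d q)) : C(Config d q, ℝ) →L[ℝ] ℝ :=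
  LinearMap.mkContinuous
    { toFun := fun f => ∫ η, f η ∂(ν : Measure (Config d q))
      map_add' := fun f g =>
        integral_add (integrable_continuousMap _ f) (integrable_continuousMap _ g)
      map_smul' := fun c f => integral_smul c f } 1 fun f => by
    rw [one_mul]
    refine (norm_integral_le_of_norm_le_const (C := ‖f‖)
      (Eventually.of_forall fun σ => f.norm_coe_le_norm σ)).trans ?_
    simp

@[simp] theorem integralCLM_apply (ν : ProbabilityMeasure (Config d q)) (f : C(Config d q, ℝ)) :
    integralCLM ν f = ∫ η, f η ∂(ν : Measure (Config d q)) := rfl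

namespace FellerSemigroup

variable (P : FellerSemigroup d q)

theorem hasDerivWithinAt_integral_evolve {f g : C(Config d q, ℝ)} (h : (f, g) ∈ P.generatorGraph)
    (ν : ProbabilityMeasure (Config d q)) {s : ℝ} (hs : 0 ≤ s) :
    HasDerivWithinAt (fun r : ℝ => ∫ η, f η ∂(P.evolve r.toNNReal ν : Measure (Config d q)))
      (∫ η, g η ∂(P.evolve s.toNNReal ν : Measure (Config d q))) (Set.Ici s) s := by
  have := (integralCLM ν).hasFDerivAt.comp_hasDerivWithinAt s (P.hasDerivWithinAt_act h hs)
  simp_rw [integral_evolve]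
  exact this

theorem continuous_integral_evolve (f : C(Config d q, ℝ)) (ν : ProbabilityMeasure (Config d q)) :
    Continuous fun r : ℝ≥0 => ∫ η, f η ∂(P.evolve r ν : Measure (Config d q)) := by
  simp_rw [integral_evolve]
  exact (integralCLM ν).continuous.comp
    (P.continuous_act.comp (by fun_prop : Continuous fun r => (r, f)))

end FellerSemigroup

/-! ### The generator on local functions -/

/-- The contribution `∑_{ξ_Δ} c_Δ(·, ξ_Δ) [f(ξ_Δ ·_{Δᶜ}) - f]` of the jumps in `Δ` to the
generator. -/
noncomputable def IPS.jumpGen (L : IPS d q) (Δ : Finset (Site d)) (f : C(Config d q, ℝ)) :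
    C(Config d q, ℝ) :=
  ⟨fun η => ∑ ξ : Δ → Fin q, L.rate Δ η ξ * (f (splice ξ η) - f η),
    continuous_finsetSum _ fun ξ _ => (L.rate_continuous Δ ξ).mul
      ((f.continuous.comp (continuous_splice ξ)).sub f.continuous)⟩

theorem IPS.jumpGen_apply (L : IPS d q) (Δ : Finset (Site d)) (f : C(Config d q, ℝ))
    (η : Config d q) :
    L.jumpGen Δ f η = ∑ ξ : Δ → Fin q, L.rate Δ η ξ * (f (splice ξ η) - f η) := rfl

/-- Composition with a translation. -/
noncomputable def shiftCLM (i : Site d) : C(Config d q, ℝ) →L[ℝ] C(Config d q, ℝ) :=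
  LinearMap.mkContinuous
    { toFun := fun f => f.comp ⟨shift i, continuous_shift i⟩
      map_add' := fun _ _ => rfl
      map_smul' := fun _ _ => rfl } 1 fun f => by
    rw [one_mul]
    exact (ContinuousMap.norm_le _ (norm_nonneg _)).2 fun η => f.norm_coe_le_norm _

@[simp] theorem shiftCLM_apply (i : Site d) (f : C(Config d q, ℝ)) (η : Config d q) :
    shiftCLM i f η = f (shift i η) := rfl

/-- Translation of patterns. -/
def shiftPattern (i : Site d) (Δ : Finset (Site d)) :
    (Δ → Fin q) ≃ (shiftSet i Δ → Fin q) where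
  toFun ξ := fun y => ξ ⟨y - i, mem_shiftSet.1 y.2⟩
  invFun ξ := fun y => ξ ⟨y + i, mem_shiftSet.2 (by simp)⟩
  left_inv ξ := by funext y; simp
  right_inv ξ := by funext y; simp

theorem splice_shiftPattern (i : Site d) {Δ : Finset (Site d)} (ξ : Δ → Fin q) (η : Config d q) :
    splice (shiftPattern i Δ ξ) (shift i η) = shift i (splice ξ η) := by
  funext x
  simp only [splice, shift, mem_shiftSet, shiftPattern, Equiv.coe_fn_mk]

theorem IPS.TranslationInvariant.rate_shift {L : IPS d q} (hL : L.TranslationInvariant)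
    (i : Site d) (Δ : Finset (Site d)) (η : Config d q) (ξ : Δ → Fin q) :
    L.rate (shiftSet i Δ) (shift i η) (shiftPattern i Δ ξ) = L.rate Δ η ξ := by
  have h := hL i Δ η (splice ξ η)
  rwa [← splice_shiftPattern, restr_splice, restr_splice] at h

theorem IPS.TranslationInvariant.jumpGen_shift {L : IPS d q} (hL : L.TranslationInvariant)
    (i : Site d) (Δ : Finset (Site d)) (f : C(Config d q, ℝ)) (η : Config d q) :
    L.jumpGen (shiftSet i Δ) f (shift i η) = L.jumpGen Δ (shiftCLM i f) η := by
  rw [IPS.jumpGen_apply, IPS.jumpGen_apply, ← Equiv.sum_comp (shiftPattern i Δ)]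
  simp only [hL.rate_shift, splice_shiftPattern, shiftCLM_apply]

/-- Translation of finite sets of sites. -/
def shiftSetEquiv (i : Site d) : Finset (Site d) ≃ Finset (Site d) where
  toFun := shiftSet i
  invFun := shiftSet (-i)
  left_inv Δ := by simp [shiftSet_shiftSet]
  right_inv Δ := by simp [shiftSet_shiftSet]

theorem IPS.mem_preGeneratorGraph {L : IPS d q} {p : C(Config d q, ℝ) × C(Config d q, ℝ)} :
    p ∈ L.preGeneratorGraph ↔
      (∃ Λ : Finset (Site d), DependsOn (p.1 : Config d q → ℝ) (Λ : Set (Site d))) ∧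
        ∀ η, HasSum (fun Δ => L.jumpGen Δ p.1 η) (p.2 η) := Iff.rfl

theorem IPS.TranslationInvariant.shift_mem_preGeneratorGraph {L : IPS d q}
    (hL : L.TranslationInvariant) (i : Site d) {p : C(Config d q, ℝ) × C(Config d q, ℝ)}
    (hp : p ∈ L.preGeneratorGraph) : (shiftCLM i p.1, shiftCLM i p.2) ∈ L.preGeneratorGraph := by
  obtain ⟨⟨Λ, hΛ⟩, h⟩ := IPS.mem_preGeneratorGraph.1 hp
  refine IPS.mem_preGeneratorGraph.2 ⟨⟨shiftSet (-i) Λ, fun η σ hησ => hΛ fun y hy => ?_⟩, ?_⟩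
  · exact hησ _ (mem_shiftSet.2 (by simpa using hy))
  · intro η
    have h1 := (Equiv.hasSum_iff (shiftSetEquiv i)
      (f := fun Δ => L.jumpGen Δ p.1 (shift i η))).2 (h (shift i η))
    exact h1.congr_fun fun Δ => (hL.jumpGen_shift i Δ p.1 η).symm

theorem IPS.IsSemigroupOf.shift_mem_generatorGraph {L : IPS d q} {P : FellerSemigroup d q}
    (hP : L.IsSemigroupOf P) (hL : L.TranslationInvariant) (i : Site d) (f g : C(Config d q, ℝ))
    (h : (f, g) ∈ P.generatorGraph) : (shiftCLM i f, shiftCLM i g) ∈ P.generatorGraph := by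
  rw [hP] at h ⊢
  have hc : Continuous fun p : C(Config d q, ℝ) × C(Config d q, ℝ) =>
      (shiftCLM i p.1, shiftCLM i p.2) := by fun_prop
  exact map_mem_closure (f := fun p : C(Config d q, ℝ) × C(Config d q, ℝ) =>
    (shiftCLM i p.1, shiftCLM i p.2)) hc h fun p hp => hL.shift_mem_preGeneratorGraph i hp

theorem IPS.rate_eq_zero_of_supRate {L : IPS d q} {Δ : Finset (Site d)} (h : L.supRate Δ = 0)
    (η : Config d q) (ξ : Δ → Fin q) : L.rate Δ η ξ = 0 := by
  have hc : Continuous fun η => L.totalRate Δ η := by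
    unfold IPS.totalRate
    exact continuous_finsetSum _ fun ξ _ => L.rate_continuous Δ ξ
  have h1 : L.totalRate Δ η ≤ 0 := by
    rw [← h]
    exact le_ciSup (isCompact_range hc).bddAbove η
  exact le_antisymm ((Finset.single_le_sum (f := fun ξ => L.rate Δ η ξ)
    (fun ξ _ => L.rate_nonneg Δ η ξ) (Finset.mem_univ ξ)).trans h1) (L.rate_nonneg _ _ _)

/-- The finite sets `Δ` with `0 ∈ Δ ⊆ Γ`. -/
def originSets (Γ : Finset (Site d)) : Finset (Finset (Site d)) := Γ.powerset.filter (0 ∈ ·)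

theorem mem_originSets {Γ Δ : Finset (Site d)} : Δ ∈ originSets Γ ↔ Δ ⊆ Γ ∧ 0 ∈ Δ := by
  simp [originSets]

/-- The jumps in a nonempty `Δ` are spread evenly over the sites of `Δ`; this is the contribution
of the site `0`. -/
noncomputable def IPS.originGen (L : IPS d q) (Γ : Finset (Site d)) (f : C(Config d q, ℝ)) :
    C(Config d q, ℝ) :=
  ∑ Δ ∈ originSets Γ, (Δ.card : ℝ)⁻¹ • L.jumpGen Δ f

/-- The contribution of the sites in `S` to the generator. -/
noncomputable def IPS.localGen (L : IPS d q) (Γ S : Finset (Site d)) (f : C(Config d q, ℝ)) :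
    C(Config d q, ℝ) :=
  ∑ x ∈ S, shiftCLM (-x) (L.originGen Γ (shiftCLM x f))

theorem IPS.TranslationInvariant.localGen_apply {L : IPS d q} (hL : L.TranslationInvariant)
    (Γ S : Finset (Site d)) (f : C(Config d q, ℝ)) (η : Config d q) :
    L.localGen Γ S f η =
      ∑ x ∈ S, ∑ Δ ∈ originSets Γ, (Δ.card : ℝ)⁻¹ * L.jumpGen (shiftSet x Δ) f η := by
  simp only [IPS.localGen, IPS.originGen, ContinuousMap.coe_sum, Finset.sum_apply, shiftCLM_apply,
    ContinuousMap.smul_apply, smul_eq_mul, ← hL.jumpGen_shift, shift_shift, add_neg_cancel,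
    shift_zero]

theorem IPS.jumpGen_eq_zero_of_disjoint (L : IPS d q) {Δ Λ : Finset (Site d)}
    (h : Disjoint Δ Λ) {f : C(Config d q, ℝ)}
    (hf : DependsOn (f : Config d q → ℝ) (Λ : Set (Site d))) (η : Config d q) :
    L.jumpGen Δ f η = 0 := by
  refine Finset.sum_eq_zero fun ξ _ => ?_
  rw [hf (x := splice ξ η) (y := η), sub_self, mul_zero]
  intro y hy
  have : y ∉ Δ := fun hy' => Finset.disjoint_left.1 h hy' hy
  simp [splice, this]

theorem IPS.TranslationInvariant.jumpGen_eq_zero {L : IPS d q} (hL : L.TranslationInvariant)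
    {Γ : Finset (Site d)} (hΓ : ∀ Δ : Finset (Site d), 0 ∈ Δ → ¬ Δ ⊆ Γ → L.supRate Δ = 0)
    {Δ : Finset (Site d)} {x : Site d} (hx : x ∈ Δ) (h : ¬ shiftSet (-x) Δ ⊆ Γ)
    (f : C(Config d q, ℝ)) (η : Config d q) : L.jumpGen Δ f η = 0 := by
  have h1 := hL.jumpGen_shift x (shiftSet (-x) Δ) f (shift (-x) η)
  simp only [shiftSet_shiftSet, shift_shift, add_neg_cancel, shiftSet_zero, shift_zero] at h1
  rw [h1, IPS.jumpGen_apply]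
  refine Finset.sum_eq_zero fun ξ _ => ?_
  rw [IPS.rate_eq_zero_of_supRate (hΓ _ (mem_shiftSet.2 (by simpa using hx)) h), zero_mul]

/-- On local functions the generator is a finite sum over sites. -/
theorem IPS.TranslationInvariant.localGen_mem_preGeneratorGraph {L : IPS d q}
    (hL : L.TranslationInvariant) {Γ : Finset (Site d)}
    (hΓ : ∀ Δ : Finset (Site d), 0 ∈ Δ → ¬ Δ ⊆ Γ → L.supRate Δ = 0) {Λ S : Finset (Site d)}
    (hS : ∀ x, ∀ y ∈ Λ, y - x ∈ Γ → x ∈ S) {f : C(Config d q, ℝ)}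
    (hf : DependsOn (f : Config d q → ℝ) (Λ : Set (Site d))) :
    (f, L.localGen Γ S f) ∈ L.preGeneratorGraph := by
  classical
  refine IPS.mem_preGeneratorGraph.2 ⟨⟨Λ, hf⟩, fun η => ?_⟩
  simp only
  -- `Δ` contributes only if it meets `Λ` and all its translates to the origin lie in `Γ`
  have hmem : ∀ Δ, L.jumpGen Δ f η ≠ 0 →
      Δ ⊆ S ∧ Δ.Nonempty ∧ ∀ x ∈ Δ, shiftSet (-x) Δ ∈ originSets Γ := by
    intro Δ hΔ
    have h1 : ∀ x ∈ Δ, shiftSet (-x) Δ ⊆ Γ := by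
      intro x hx
      by_contra h
      exact hΔ (hL.jumpGen_eq_zero hΓ hx h f η)
    obtain ⟨y, hyΔ, hyΛ⟩ := Finset.not_disjoint_iff.1
      fun h => hΔ (L.jumpGen_eq_zero_of_disjoint h hf η)
    refine ⟨fun x hx => hS x y hyΛ (h1 x hx (mem_shiftSet.2 (by simpa using hyΔ))), ⟨y, hyΔ⟩,
      fun x hx => mem_originSets.2 ⟨h1 x hx, mem_shiftSet.2 (by simpa using hx)⟩⟩
  have hsum : L.localGen Γ S f η = ∑ Δ ∈ S.powerset, L.jumpGen Δ f η := by
    rw [hL.localGen_apply]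
    have h2 : ∀ Δ ∈ S.powerset, L.jumpGen Δ f η =
        ∑ x ∈ S, if x ∈ Δ then (Δ.card : ℝ)⁻¹ * L.jumpGen Δ f η else 0 := by
      intro Δ hΔ
      rw [← Finset.sum_filter, Finset.filter_mem_eq_inter,
        Finset.inter_eq_right.2 (Finset.mem_powerset.1 hΔ), Finset.sum_const, nsmul_eq_mul]
      by_cases h0 : L.jumpGen Δ f η = 0
      · simp [h0]
      · have : (Δ.card : ℝ) ≠ 0 := by
          exact_mod_cast (Finset.card_pos.2 (hmem Δ h0).2.1).ne'
        field_simp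
    conv_rhs => rw [Finset.sum_congr rfl h2, Finset.sum_comm]
    refine Finset.sum_congr rfl fun x hx => ?_
    rw [← Finset.sum_filter]
    have h3 : ∑ Δ ∈ originSets Γ, (Δ.card : ℝ)⁻¹ * L.jumpGen (shiftSet x Δ) f η =
        ∑ Δ ∈ (originSets Γ).map (shiftSetEquiv x).toEmbedding,
          (Δ.card : ℝ)⁻¹ * L.jumpGen Δ f η := by
      rw [Finset.sum_map]
      refine Finset.sum_congr rfl fun Δ _ => ?_
      simp [shiftSetEquiv, card_shiftSet]
    rw [h3]
    refine Finset.sum_congr_of_eq_on_inter ?_ ?_ fun _ _ _ => rfl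
    · intro Δ hΔ hΔ'
      by_contra h0
      have h0' : L.jumpGen Δ f η ≠ 0 := fun h => h0 (by rw [h, mul_zero])
      obtain ⟨Δ₀, hΔ₀, rfl⟩ := Finset.mem_map.1 hΔ
      refine hΔ' (Finset.mem_filter.2 ⟨Finset.mem_powerset.2 (hmem _ h0').1, ?_⟩)
      exact mem_shiftSet.2 (by simpa using (mem_originSets.1 hΔ₀).2)
    · intro Δ hΔ hΔ'
      by_contra h0
      have h0' : L.jumpGen Δ f η ≠ 0 := fun h => h0 (by rw [h, mul_zero])
      refine hΔ' (Finset.mem_map.2 ⟨shiftSet (-x) Δ,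
        (hmem Δ h0').2.2 x (Finset.mem_filter.1 hΔ).2, ?_⟩)
      simp [shiftSetEquiv, shiftSet_shiftSet]
  rw [hsum]
  refine hasSum_sum_of_ne_finset_zero fun Δ hΔ => ?_
  by_contra h0
  exact hΔ (Finset.mem_powerset.2 (hmem Δ h0).1)

theorem IPS.IsSemigroupOf.localGen_mem_generatorGraph {L : IPS d q} {P : FellerSemigroup d q}
    (hP : L.IsSemigroupOf P) (hL : L.TranslationInvariant) {Γ : Finset (Site d)}
    (hΓ : ∀ Δ : Finset (Site d), 0 ∈ Δ → ¬ Δ ⊆ Γ → L.supRate Δ = 0) {Λ S : Finset (Site d)}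
    (hS : ∀ x, ∀ y ∈ Λ, y - x ∈ Γ → x ∈ S) (v : (Λ → Fin q) → ℝ) :
    (localFun v, L.localGen Γ S (localFun v)) ∈ P.generatorGraph := by
  rw [hP]
  exact subset_closure (hL.localGen_mem_preGeneratorGraph hΓ hS (dependsOn_localFun v))

/-- Integration of the generator against a translation-invariant measure: each site contributes
like the origin, seen from the translated volume. -/
theorem TranslationInvariant.integral_localGen {ν : ProbabilityMeasure (Config d q)}
    (hν : TranslationInvariant ν) (L : IPS d q) (Γ S : Finset (Site d)) (f : C(Config d q, ℝ)) :
    ∫ η, L.localGen Γ S f η ∂(ν : Measure (Config d q)) =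
      ∑ x ∈ S, ∫ η, L.originGen Γ (shiftCLM x f) η ∂(ν : Measure (Config d q)) := by
  rw [← integralCLM_apply, IPS.localGen, map_sum]
  refine Finset.sum_congr rfl fun x _ => ?_
  exact hν.integral_shift (-x) _

/-- The dynamics preserves translation invariance. -/
theorem TranslationInvariant.evolve {L : IPS d q} {P : FellerSemigroup d q}
    (hP : L.IsSemigroupOf P) (hL : L.TranslationInvariant) (hfin : L.FinitelyManyTypes)
    {ν : ProbabilityMeasure (Config d q)} (hν : TranslationInvariant ν) (t : ℝ≥0) :
    TranslationInvariant (P.evolve t ν) := by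
  classical
  obtain ⟨Γ, -, hΓ⟩ := hfin
  intro i
  have hp : IsProbabilityMeasure ((P.evolve t ν : Measure (Config d q)).map (shift i)) :=
    Measure.isProbabilityMeasure_map (measurable_shift i).aemeasurable
  refine ext_of_cyl fun Λ ω => ?_
  let f : C(Config d q, ℝ) := localFun fun ω' : Λ → Fin q => if ω' = ω then 1 else 0
  have hf : ∀ (m : Measure (Config d q)) [IsProbabilityMeasure m],
      m.real (cyl ω) = ∫ η, f η ∂m := fun m _ => by
    refine Eq.symm ((integral_localFun m (fun ω' : Λ → Fin q => if ω' = ω then 1 else 0)).trans ?_)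
    simp
  let S : Finset (Site d) := Finset.image₂ (fun y z => y - z) Λ Γ
  have hG := hP.localGen_mem_generatorGraph hL hΓ (Λ := Λ) (S := S)
    (fun x y hy hyx => Finset.mem_image₂.2 ⟨y, hy, y - x, hyx, by simp⟩)
    (fun ω' : Λ → Fin q => if ω' = ω then 1 else 0)
  rw [← ENNReal.toReal_eq_toReal_iff' (measure_ne_top _ _) (measure_ne_top _ _)]
  change ((P.evolve t ν : Measure (Config d q)).map (shift i)).real (cyl ω) =
    (P.evolve t ν : Measure (Config d q)).real (cyl ω)
  rw [hf, hf, integral_map (measurable_shift i).aemeasurable f.continuous.aestronglyMeasurable]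
  have h1 := P.integral_evolve t ν (shiftCLM i f)
  simp only [shiftCLM_apply] at h1
  rw [h1, P.act_comm (U := shiftCLM i) (hP.shift_mem_generatorGraph hL i) hG, P.integral_evolve]
  exact hν.integral_shift i (P.act t f)

/-! ### Non-null measures -/

/-- Given any event off a site of `A`, each symbol appears at that site with conditional probability
at least `δ`. -/
def UniformlyNonNull (δ : ℝ) (m : Measure (Config d q)) (A : Finset (Site d)) : Prop :=
  ∀ x ∈ A, ∀ (a : Fin q) (B : Set (Config d q)),
    MeasurableSet[cylinderEvents (X := fun _ : Site d => Fin q) {x}ᶜ] B →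
      δ * m.real B ≤ m.real (B ∩ {σ | σ x = a})

theorem measurableSet_eval (x : Site d) (a : Fin q) {S : Set (Site d)} (hx : x ∈ S) :
    MeasurableSet[cylinderEvents (X := fun _ : Site d => Fin q) S] {σ : Config d q | σ x = a} :=
  measurable_cylinderEvent_apply (X := fun _ : Site d => Fin q) hx (measurableSet_singleton a)

/-- Iterating the one-site bound over the sites of `A`. -/
theorem UniformlyNonNull.pow_le {δ : ℝ} (hδ : 0 ≤ δ) {m : Measure (Config d q)}
    {A : Finset (Site d)} (h : UniformlyNonNull δ m A) (ω : Config d q) {B : Set (Config d q)}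
    (hB : MeasurableSet[cylinderEvents (X := fun _ : Site d => Fin q) (A : Set (Site d))ᶜ] B) :
    δ ^ A.card * m.real B ≤ m.real (B ∩ {σ | ∀ x ∈ A, σ x = ω x}) := by
  classical
  induction A using Finset.induction_on generalizing B with
  | empty => simp
  | insert x A hx ih =>
    have h1 : MeasurableSet[cylinderEvents (X := fun _ : Site d => Fin q) {x}ᶜ] B := by
      refine cylinderEvents_mono (Set.compl_subset_compl.2 ?_) B hB
      simp
    have h2 := h x (Finset.mem_insert_self x A) (ω x) B h1
    have h3 : MeasurableSet[cylinderEvents (X := fun _ : Site d => Fin q) (A : Set (Site d))ᶜ]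
        (B ∩ {σ | σ x = ω x}) := by
      refine MeasurableSet.inter (cylinderEvents_mono (Set.compl_subset_compl.2 ?_) B hB)
        (measurableSet_eval x (ω x) ?_)
      · simp
      · simpa using hx
    have h4 := ih (fun y hy => h y (Finset.mem_insert_of_mem hy)) h3
    have h5 : B ∩ {σ | ∀ y ∈ insert x A, σ y = ω y} =
        B ∩ {σ | σ x = ω x} ∩ {σ | ∀ y ∈ A, σ y = ω y} := by
      ext σ; simp [and_assoc]
    rw [h5, Finset.card_insert_of_notMem hx, pow_succ, mul_assoc]
    exact (mul_le_mul_of_nonneg_left h2 (pow_nonneg hδ _)).trans h4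

theorem UniformlyNonNull.pow_card_le {δ : ℝ} (hδ : 0 ≤ δ) {m : Measure (Config d q)}
    [IsProbabilityMeasure m] {V : Finset (Site d)} (h : UniformlyNonNull δ m V) (η : Config d q) :
    δ ^ V.card ≤ m.real (cyl (restr V η)) := by
  have h1 := h.pow_le hδ η (B := Set.univ) MeasurableSet.univ
  have h2 : Set.univ ∩ {σ : Config d q | ∀ x ∈ V, σ x = η x} = cyl (restr V η) := by
    ext σ; simp [mem_cyl_restr]
  rw [h2] at h1
  simpa using h1

theorem restr_sdiff_measurable (V Δ : Finset (Site d)) [DecidableEq (Site d)] (η : Config d q) :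
    MeasurableSet[cylinderEvents (X := fun _ : Site d => Fin q) (Δ : Set (Site d))ᶜ]
      (cyl (restr (V \ Δ) η) : Set (Config d q)) :=
  measurableSet_cyl_cylinderEvents _ fun x hx => by
    simpa using (Finset.mem_sdiff.1 (Finset.mem_coe.1 hx)).2

/-- Changing the pattern inside `Δ` changes the probability of a cylinder by a bounded factor. -/
theorem UniformlyNonNull.cyl_le {δ : ℝ} (hδ : 0 ≤ δ) (hδ1 : δ ≤ 1) {m : Measure (Config d q)}
    [IsFiniteMeasure m] {V Δ : Finset (Site d)} (h : UniformlyNonNull δ m V) {η σ : Config d q}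
    (hησ : ∀ x, x ∉ Δ → η x = σ x) :
    δ ^ Δ.card * m.real (cyl (restr V η)) ≤ m.real (cyl (restr V σ)) := by
  classical
  have h1 : UniformlyNonNull δ m (V ∩ Δ) := fun x hx => h x (Finset.mem_inter.1 hx).1
  have h2 := h1.pow_le hδ σ (B := cyl (restr (V \ (V ∩ Δ)) η)) (restr_sdiff_measurable _ _ _)
  have h3 : cyl (restr (V \ (V ∩ Δ)) η) ∩ {τ : Config d q | ∀ x ∈ V ∩ Δ, τ x = σ x} =
      cyl (restr V σ) := by
    ext τ
    simp only [Set.mem_inter_iff, mem_cyl_restr, Set.mem_ofPred_eq, Finset.mem_sdiff,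
      Finset.mem_inter, not_and]
    constructor
    · rintro ⟨h, h'⟩ x hx
      by_cases hxΔ : x ∈ Δ
      · exact h' x ⟨hx, hxΔ⟩
      · rw [← hησ x hxΔ]; exact h x ⟨hx, fun _ => hxΔ⟩
    · intro h
      exact ⟨fun x hx => by rw [hησ x (hx.2 hx.1)]; exact h x hx.1, fun x hx => h x hx.1⟩
  rw [h3] at h2
  refine le_trans ?_ h2
  refine mul_le_mul (pow_le_pow_of_le_one hδ hδ1 (Finset.card_le_card Finset.inter_subset_right))
    (measureReal_mono fun τ hτ => ?_) measureReal_nonneg (pow_nonneg hδ _)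
  rw [mem_cyl_restr] at hτ ⊢
  exact fun x hx => hτ x (Finset.mem_sdiff.1 hx).1

theorem NonNull.uniformlyNonNull {ν : ProbabilityMeasure (Config d q)} (hν : NonNull ν)
    (hTI : TranslationInvariant ν) :
    ∃ δ : ℝ, 0 < δ ∧ δ ≤ 1 ∧ ∀ A, UniformlyNonNull δ (ν : Measure (Config d q)) A := by
  obtain ⟨δ, hδ, h⟩ := hν
  have h0 : ∀ (a : Fin q) (B : Set (Config d q)),
      MeasurableSet[cylinderEvents (X := fun _ : Site d => Fin q) {0}ᶜ] B →
      δ * (ν : Measure (Config d q)).real B ≤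
        (ν : Measure (Config d q)).real (B ∩ {σ | σ 0 = a}) := by
    intro a B hB
    have hm : MeasurableSet {σ : Config d q | σ 0 = a} :=
      cylinderEvents_le_pi _ (measurableSet_eval (S := {0}) 0 a rfl)
    have hle : cylinderEvents (X := fun _ : Site d => Fin q) {0}ᶜ ≤ MeasurableSpace.pi :=
      cylinderEvents_le_pi
    have h1 := setIntegral_condExp (μ := (ν : Measure (Config d q))) hle
      (f := {σ : Config d q | σ 0 = a}.indicator fun _ => (1 : ℝ))
      ((integrable_const 1).indicator hm) hB
    rw [setIntegral_indicator hm] at h1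
    simp only [integral_const, MeasurableSet.univ, measureReal_restrict_apply, Set.univ_inter,
      smul_eq_mul, mul_one] at h1
    rw [← h1]
    have h2 : ∫ _ in B, δ ∂(ν : Measure (Config d q)) = δ * (ν : Measure (Config d q)).real B := by
      simp [mul_comm]
    rw [← h2]
    refine setIntegral_mono_ae (integrable_const _).integrableOn
      integrable_condExp.integrableOn (h a)
  refine ⟨min δ 1, lt_min hδ one_pos, min_le_right _ _, fun A x _ a B hB => ?_⟩
  have hBm : MeasurableSet B := cylinderEvents_le_pi _ hB
  have hm : MeasurableSet {σ : Config d q | σ x = a} :=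
    cylinderEvents_le_pi _ (measurableSet_eval (S := {x}) x a rfl)
  have h1 : MeasurableSet[cylinderEvents (X := fun _ : Site d => Fin q) {0}ᶜ] (shift x ⁻¹' B) := by
    have hs : @Measurable _ _ (cylinderEvents (X := fun _ : Site d => Fin q) {0}ᶜ)
        (cylinderEvents (X := fun _ : Site d => Fin q) {x}ᶜ) (shift x) := by
      refine (@measurable_cylinderEvents_iff _ _ (fun _ : Site d => Fin q)
        (cylinderEvents (X := fun _ : Site d => Fin q) {0}ᶜ) _ _ _).2 fun i hi => ?_
      exact measurable_cylinderEvent_apply (X := fun _ : Site d => Fin q)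
        (by simpa [sub_eq_zero] using hi)
    exact hs hB
  have h2 := h0 a _ h1
  have h3 : shift x ⁻¹' B ∩ {σ | σ 0 = a} = shift x ⁻¹' (B ∩ {σ | σ x = a}) := by
    ext σ; simp [shift]
  rw [h3, ← map_measureReal_apply (measurable_shift x) hBm,
    ← map_measureReal_apply (measurable_shift x) (hBm.inter hm), hTI x] at h2
  exact (mul_le_mul_of_nonneg_right (min_le_left _ _) measureReal_nonneg).trans h2

/-! ### Gibbs measures -/

namespace Specification

variable {γ : Specification d q}

/-- Integrating the bounds `a ≤ γ_Λ(A | ·) ≤ b` over an event `B` off `Λ`. -/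
theorem measureReal_inter_bounds {m : Measure (Config d q)} [IsFiniteMeasure m]
    {Λ : Finset (Site d)}
    (hm : ∀ A, MeasurableSet A → ∫⁻ σ, γ.kernel Λ σ A ∂m = m A)
    {A B : Set (Config d q)} (hA : MeasurableSet A)
    (hB : MeasurableSet[cylinderEvents (X := fun _ : Site d => Fin q) (Λ : Set (Site d))ᶜ] B)
    {a b : ℝ} (hab : ∀ σ ∈ B, a ≤ (γ.kernel Λ σ).real A ∧ (γ.kernel Λ σ).real A ≤ b) :
    a * m.real B ≤ m.real (A ∩ B) ∧ m.real (A ∩ B) ≤ b * m.real B := by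
  have hBm : MeasurableSet B := cylinderEvents_le_pi _ hB
  have := γ.isMarkov Λ
  have hmeas : Measurable fun σ => γ.kernel Λ σ A :=
    ((γ.kernel Λ).measurable_coe hA).mono cylinderEvents_le_pi le_rfl
  have h1 : m (A ∩ B) = ∫⁻ σ in B, γ.kernel Λ σ A ∂m := by
    rw [← hm _ (hA.inter hBm), ← lintegral_indicator hBm]
    refine lintegral_congr fun σ => ?_
    rw [(γ.isProper Λ).inter_eq_indicator_mul cylinderEvents_le_pi hA hB]
    by_cases hσ : σ ∈ B <;> simp [hσ]
  have h2 : m.real (A ∩ B) = ∫ σ in B, (γ.kernel Λ σ).real A ∂m := by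
    rw [measureReal_def, h1]
    exact (integral_toReal hmeas.aemeasurable (ae_of_all _ fun σ => measure_lt_top _ _)).symm
  have hint : IntegrableOn (fun σ => (γ.kernel Λ σ).real A) B m := by
    refine Integrable.integrableOn (Integrable.of_bound (C := 1)
      hmeas.ennreal_toReal.aestronglyMeasurable (ae_of_all _ fun σ => ?_))
    rw [Real.norm_of_nonneg measureReal_nonneg]
    exact measureReal_le_one
  have h3 : ∀ c : ℝ, ∫ _ in B, c ∂m = c * m.real B := fun c => by simp [mul_comm]
  rw [h2, ← h3, ← h3]
  exact ⟨setIntegral_mono_on (integrable_const _).integrableOn hint hBm fun σ hσ => (hab σ hσ).1,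
    setIntegral_mono_on hint (integrable_const _).integrableOn hBm fun σ hσ => (hab σ hσ).2⟩

/-- `γ_Λ(· | σ)` depends on `σ` off `Λ` only. -/
theorem kernel_real_cyl (Λ : Finset (Site d)) (η σ : Config d q) :
    (γ.kernel Λ σ).real (cyl (restr Λ η)) = γ.prob Λ (splice (restr Λ η) σ) := by
  have h : γ.kernel Λ σ = γ.kernel Λ (splice (restr Λ η) σ) := by
    refine Measure.ext fun A hA => eq_of_measurable_cylinderEvents (S := (Λ : Set (Site d))ᶜ)
      ((γ.kernel Λ).measurable_coe hA) fun x hx => ?_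
    have : x ∉ Λ := by simpa using hx
    simp [splice, this]
  rw [prob, restr_splice, ← h]

theorem NonNull.prob_singleton (hγ : γ.NonNull) (hTI : γ.TranslationInvariant) :
    ∃ δ : ℝ, 0 < δ ∧ δ ≤ 1 ∧ ∀ (x : Site d) (η : Config d q), δ ≤ γ.prob {x} η := by
  obtain ⟨δ, hδ, h⟩ := hγ
  refine ⟨min δ 1, lt_min hδ one_pos, min_le_right _ _, fun x η => (min_le_left _ _).trans ?_⟩
  have h1 := hTI {0} x (shift (-x) η)
  rw [shift_shift, add_neg_cancel, shift_zero,
    show shiftSet x {0} = {x} by ext y; simp [mem_shiftSet, sub_eq_zero]] at h1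
  rw [h1]
  exact h _

theorem uniformlyNonNull {δ : ℝ} (hδ : ∀ (x : Site d) (η : Config d q), δ ≤ γ.prob {x} η)
    {m : Measure (Config d q)} [IsFiniteMeasure m] {V : Finset (Site d)}
    (hm : ∀ x ∈ V, ∀ A, MeasurableSet A → ∫⁻ σ, γ.kernel {x} σ A ∂m = m A) :
    UniformlyNonNull δ m V := by
  intro x hx a B hB
  rcases isEmpty_or_nonempty (Config d q) with hE | ⟨⟨η⟩⟩
  · simp [Set.eq_empty_of_isEmpty]
  classical
  have hA : ({σ : Config d q | σ x = a}) = cyl (restr {x} (Function.update η x a)) := by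
    ext σ; simp [mem_cyl_restr]
  rw [Set.inter_comm, hA]
  refine (measureReal_inter_bounds (hm x hx) (measurableSet_cyl _) (b := 1) ?_ fun σ _ => ⟨?_, ?_⟩).1
  · rwa [Finset.coe_singleton]
  · rw [kernel_real_cyl]; exact hδ _ _
  · have := γ.isMarkov {x}
    exact measureReal_le_one

theorem pow_card_le_prob {δ : ℝ} (hδ0 : 0 ≤ δ)
    (hδ : ∀ (x : Site d) (η : Config d q), δ ≤ γ.prob {x} η)
    (Λ : Finset (Site d)) (η : Config d q) : δ ^ Λ.card ≤ γ.prob Λ η := by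
  have := γ.isMarkov Λ η
  exact (uniformlyNonNull hδ (m := γ.kernel Λ η) fun x hx A hA =>
    γ.consistent {x} Λ (by simpa using hx) η A hA).pow_card_le hδ0 η

theorem prob_le_one (Λ : Finset (Site d)) (η : Config d q) : γ.prob Λ η ≤ 1 := by
  have := γ.isMarkov Λ η
  exact measureReal_le_one

/-- `|γ_Δ(η_Δ | η_{Δᶜ}) - γ_Δ(η_Δ | η_{W \ Δ} ζ_{Wᶜ})| < ε`. -/
def ApproxOn (γ : Specification d q) (W Δ : Finset (Site d)) (ε : ℝ) : Prop :=
  ∀ η ζ : Config d q, |γ.prob Δ (splice (restr W η) ζ) - γ.prob Δ η| < ε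

/-- For a Gibbs measure, the conditional probability of the pattern in `Δ` given the pattern in
`V \ Δ` is uniformly approximated by a function of the configuration in `W ⊆ V`. -/
theorem ApproxOn.abs_cyl_sub_le {V W Δ : Finset (Site d)} {ε : ℝ} (hW : γ.ApproxOn W Δ ε)
    (hΔW : Δ ⊆ W) (hWV : W ⊆ V) {μ : ProbabilityMeasure (Config d q)} (hμ : γ.IsGibbs μ)
    [DecidableEq (Site d)] (η ζ : Config d q) :
    |(μ : Measure (Config d q)).real (cyl (restr V η)) - γ.prob Δ (splice (restr W η) ζ) *
        (μ : Measure (Config d q)).real (cyl (restr (V \ Δ) η))| ≤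
      ε * (μ : Measure (Config d q)).real (cyl (restr (V \ Δ) η)) := by
  have h1 : (cyl (restr V η) : Set (Config d q)) =
      cyl (restr Δ η) ∩ cyl (restr (V \ Δ) η) := by
    ext τ
    simp only [Set.mem_inter_iff, mem_cyl_restr, Finset.mem_sdiff]
    refine ⟨fun h => ⟨fun x hx => h x (hWV (hΔW hx)), fun x hx => h x hx.1⟩, fun h x hx => ?_⟩
    by_cases hxΔ : x ∈ Δ
    · exact h.1 x hxΔ
    · exact h.2 x ⟨hx, hxΔ⟩
  have h2 : ∀ τ ∈ (cyl (restr (V \ Δ) η) : Set (Config d q)),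
      |(γ.kernel Δ τ).real (cyl (restr Δ η)) - γ.prob Δ (splice (restr W η) ζ)| < ε := by
    intro τ hτ
    rw [mem_cyl_restr] at hτ
    rw [kernel_real_cyl, abs_sub_comm]
    have h3 : restr W η = restr W (splice (restr Δ η) τ) := by
      funext x
      by_cases hx : (x : Site d) ∈ Δ
      · simp [restr, splice, hx]
      · simp [restr, splice, hx, hτ x (Finset.mem_sdiff.2 ⟨hWV x.2, hx⟩)]
    rw [h3]
    exact hW _ ζ
  obtain ⟨h3, h4⟩ := measureReal_inter_bounds (m := (μ : Measure (Config d q))) (hμ Δ)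
    (measurableSet_cyl (restr Δ η)) (restr_sdiff_measurable V Δ η)
    (a := γ.prob Δ (splice (restr W η) ζ) - ε) (b := γ.prob Δ (splice (restr W η) ζ) + ε)
    fun τ hτ => by
      have := abs_lt.1 (h2 τ hτ)
      constructor <;> linarith [this.1, this.2]
  rw [h1, abs_le]
  constructor <;> linarith

/-- For a Gibbs measure, the ratio of the probabilities of two cylinders that differ in `Δ` only is
uniformly approximated by a function of the configuration in `W`. -/
theorem ApproxOn.abs_ratio_sub_le {δ : ℝ} (hδ0 : 0 < δ)
    (hδ : ∀ (x : Site d) (η : Config d q), δ ≤ γ.prob {x} η)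
    {μ : ProbabilityMeasure (Config d q)} (hμ : γ.IsGibbs μ) {V W Δ : Finset (Site d)}
    {ε : ℝ} (hW : γ.ApproxOn W Δ ε) (hΔW : Δ ⊆ W) (hWV : W ⊆ V) (η σ ζ : Config d q)
    (hησ : ∀ x, x ∉ Δ → η x = σ x) :
    |(μ : Measure (Config d q)).real (cyl (restr V η)) /
        (μ : Measure (Config d q)).real (cyl (restr V σ)) -
      γ.prob Δ (splice (restr W η) ζ) / γ.prob Δ (splice (restr W σ) ζ)| ≤
      2 * ε / (δ ^ Δ.card) ^ 2 := by
  classical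
  have hδΔ : 0 < δ ^ Δ.card := pow_pos hδ0 _
  have hnn : ∀ A, UniformlyNonNull δ (μ : Measure (Config d q)) A := fun A =>
    uniformlyNonNull hδ fun x _ => hμ {x}
  have hz : restr (V \ Δ) σ = restr (V \ Δ) η :=
    funext fun x => (hησ x (Finset.mem_sdiff.1 x.2).2).symm
  have e1 := hW.abs_cyl_sub_le hΔW hWV hμ η ζ
  have e2 := hW.abs_cyl_sub_le hΔW hWV hμ σ ζ
  rw [hz] at e2
  have hz0 : 0 < (μ : Measure (Config d q)).real (cyl (restr (V \ Δ) η)) :=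
    (pow_pos hδ0 _).trans_le ((hnn _).pow_card_le hδ0.le η)
  have hm : δ ^ Δ.card * (μ : Measure (Config d q)).real (cyl (restr (V \ Δ) η)) ≤
      (μ : Measure (Config d q)).real (cyl (restr V σ)) := by
    have h := (hnn Δ).pow_le hδ0.le σ (restr_sdiff_measurable V Δ η)
    refine h.trans (measureReal_mono fun τ hτ => ?_)
    simp only [Set.mem_inter_iff, mem_cyl_restr, Finset.mem_sdiff, Set.mem_ofPred_eq] at hτ ⊢
    intro x hx
    by_cases hxΔ : x ∈ Δ
    · exact hτ.2 x hxΔ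
    · rw [hτ.1 x ⟨hx, hxΔ⟩, hησ x hxΔ]
  have hp := γ.pow_card_le_prob hδ0.le hδ Δ (splice (restr W η) ζ)
  have hp' := γ.pow_card_le_prob hδ0.le hδ Δ (splice (restr W σ) ζ)
  have hp1 := γ.prob_le_one Δ (splice (restr W η) ζ)
  have hp1' := γ.prob_le_one Δ (splice (restr W σ) ζ)
  generalize γ.prob Δ (splice (restr W η) ζ) = p at *
  generalize γ.prob Δ (splice (restr W σ) ζ) = p' at *
  generalize (μ : Measure (Config d q)).real (cyl (restr V η)) = m at *
  generalize (μ : Measure (Config d q)).real (cyl (restr V σ)) = m' at *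
  generalize (μ : Measure (Config d q)).real (cyl (restr (V \ Δ) η)) = z at *
  generalize δ ^ Δ.card = θ at *
  have hm'0 : 0 < m' := (mul_pos hδΔ hz0).trans_le hm
  have hp'0 : 0 < p' := hδΔ.trans_le hp'
  have hp0 : 0 < p := hδΔ.trans_le hp
  have e3 : |m * p' - m' * p| ≤ 2 * ε * z := by
    have : m * p' - m' * p = (m - p * z) * p' - (m' - p' * z) * p := by ring
    rw [this]
    refine (abs_sub _ _).trans ?_
    rw [abs_mul, abs_mul, abs_of_pos hp0, abs_of_pos hp'0]
    have h1 : |m - p * z| * p' ≤ |m - p * z| := mul_le_of_le_one_right (abs_nonneg _) hp1'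
    have h2 : |m' - p' * z| * p ≤ |m' - p' * z| := mul_le_of_le_one_right (abs_nonneg _) hp1
    linarith
  rw [div_sub_div _ _ hm'0.ne' hp'0.ne', abs_div, abs_of_pos (mul_pos hm'0 hp'0),
    div_le_div_iff₀ (mul_pos hm'0 hp'0) (pow_pos hδΔ 2)]
  have hε : 0 ≤ ε := by
    have := (abs_nonneg _).trans e1
    exact nonneg_of_mul_nonneg_left this hz0
  have h5 : z * θ ^ 2 ≤ m' * p' := by
    calc z * θ ^ 2 = (θ * z) * θ := by ring
      _ ≤ m' * p' := mul_le_mul hm hp' hδΔ.le hm'0.le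
  calc |m * p' - m' * p| * θ ^ 2 ≤ 2 * ε * z * θ ^ 2 :=
        mul_le_mul_of_nonneg_right e3 (by positivity)
    _ = 2 * ε * (z * θ ^ 2) := by ring
    _ ≤ 2 * ε * (m' * p') := mul_le_mul_of_nonneg_left h5 (by positivity)

end Specification

/-! ### A divergence of two numbers -/

/-- The divergence `a log (a / b) - a + b` of two positive numbers. -/
noncomputable def psi (a b : ℝ) : ℝ := a * Real.log (a / b) - a + b

/-- `psi` lies above its tangent planes. -/
theorem le_psi {a b : ℝ} (ha : 0 < a) (hb : 0 < b) (A B : ℝ) (hA : 0 < A) (hB : 0 < B) :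
    a * Real.log (A / B) - b * (A / B) + b ≤ psi a b := by
  have h1 := Real.log_le_sub_one_of_pos (div_pos (mul_pos hA hb) (mul_pos hB ha))
  have h2 : Real.log (A / B) - Real.log (a / b) = Real.log (A * b / (B * a)) := by
    rw [← Real.log_div (by positivity) (by positivity)]
    congr 1
    field_simp
  have h3 : a * (A * b / (B * a) - 1) = b * (A / B) - a := by
    field_simp
  have h4 := mul_le_mul_of_nonneg_left (h2.trans_le h1) ha.le
  rw [h3] at h4
  unfold psi
  linarith

theorem psi_nonneg {a b : ℝ} (ha : 0 < a) (hb : 0 < b) : 0 ≤ psi a b := by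
  have := le_psi ha hb 1 1 one_pos one_pos
  simpa using this

/-- The log-sum inequality. -/
theorem psi_sum_le {ι : Type*} (s : Finset ι) {a b : ι → ℝ} (ha : ∀ i ∈ s, 0 < a i)
    (hb : ∀ i ∈ s, 0 < b i) : psi (∑ i ∈ s, a i) (∑ i ∈ s, b i) ≤ ∑ i ∈ s, psi (a i) (b i) := by
  rcases s.eq_empty_or_nonempty with rfl | hs
  · simp [psi]
  have hA : 0 < ∑ i ∈ s, a i := Finset.sum_pos ha hs
  have hB : 0 < ∑ i ∈ s, b i := Finset.sum_pos hb hs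
  refine le_trans (le_of_eq ?_)
    (Finset.sum_le_sum fun i hi => le_psi (ha i hi) (hb i hi) _ _ hA hB)
  rw [Finset.sum_add_distrib, Finset.sum_sub_distrib, ← Finset.sum_mul, ← Finset.sum_mul]
  unfold psi
  field_simp

theorem psi_le {a b : ℝ} (ha : 0 < a) (hb : 0 < b) : psi a b ≤ a * (a / b) + b := by
  have h1 := Real.log_le_sub_one_of_pos (div_pos ha hb)
  have h2 := mul_le_mul_of_nonneg_left h1 ha.le
  unfold psi
  linarith

theorem mul_log_eq {a b κ : ℝ} : a * Real.log (κ * b / a) = -psi a (κ * b) + (κ * b - a) := by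
  have : Real.log (κ * b / a) = -Real.log (a / (κ * b)) := by
    rw [← Real.log_inv, inv_div]
  rw [this, psi]
  ring

/-- Lipschitz dependence of `psi a (κ * b)` on `κ`. -/
theorem psi_sub_le {a b κ κ' C ε : ℝ} (ha : 0 < a) (hb : 0 < b) (hκ : 0 < κ) (hκ' : 0 < κ')
    (hC : 1 / C ≤ κ) (hC0 : 0 < C) (h : |κ - κ'| ≤ ε) :
    psi a (κ * b) - psi a (κ' * b) ≤ ε * (C * a + b) := by
  have h1 : Real.log (a / (κ * b)) - Real.log (a / (κ' * b)) = Real.log (κ' / κ) := by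
    rw [← Real.log_div (by positivity) (by positivity)]
    congr 1
    field_simp
  have h2 : Real.log (κ' / κ) ≤ ε * C := by
    refine (Real.log_le_sub_one_of_pos (div_pos hκ' hκ)).trans ?_
    have h3 : κ' / κ - 1 = (κ' - κ) / κ := by field_simp
    rw [h3, div_le_iff₀ hκ]
    have h4 : 1 ≤ C * κ := by rw [div_le_iff₀ hC0] at hC; linarith
    have h5 : κ' - κ ≤ ε := by rw [abs_sub_comm] at h; exact (le_abs_self _).trans h
    have h6 : 0 ≤ ε := (abs_nonneg _).trans h
    nlinarith
  have h3 : (κ - κ') * b ≤ ε * b := mul_le_mul_of_nonneg_right ((le_abs_self _).trans h) hb.le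
  have h4 : a * (Real.log (a / (κ * b)) - Real.log (a / (κ' * b))) ≤ a * (ε * C) :=
    mul_le_mul_of_nonneg_left (h1.trans_le h2) ha.le
  unfold psi
  linarith

/-- The contribution of one jump to the entropy balance: `a` and `b` are the probabilities of the
initial and the final pattern, `κ` is the ratio of their equilibrium probabilities, and `c₁`, `c₂`
are the rates averaged over the evolving measure and over the equilibrium measure. -/
noncomputable def balance (c₁ c₂ a b κ : ℝ) : ℝ := c₁ * (a * Real.log (κ * b / a)) - c₂ * (κ * b - a)

theorem balance_eq (c₁ c₂ a b κ : ℝ) :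
    balance c₁ c₂ a b κ = -(c₁ * psi a (κ * b)) + (c₁ - c₂) * (κ * b - a) := by
  rw [balance, mul_log_eq]; ring

section
variable {a b κ C c₁ c₂ K : ℝ}

theorem abs_mul_sub_le {s t : ℝ} (ha : 0 < a) (hb : 0 < b) (hκ : 0 < κ) (hκC : κ ≤ C)
    (hs : |s| ≤ t) : |s * (κ * b - a)| ≤ t * (C * b + a) := by
  have h1 : |κ * b - a| ≤ C * b + a := by
    refine (abs_sub _ _).trans ?_
    rw [abs_of_pos (mul_pos hκ hb), abs_of_pos ha]
    have := mul_le_mul_of_nonneg_right hκC hb.le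
    linarith
  rw [abs_mul]
  exact mul_le_mul hs h1 (abs_nonneg _) ((abs_nonneg _).trans hs)

/-- The balance is bounded from above even if `a / b` is very large or very small. -/
theorem balance_le (ha : 0 < a) (hb : 0 < b) (hκ : 0 < κ) (hκC : κ ≤ C) (hC : 1 ≤ C)
    (h1 : 0 ≤ c₁) (h1K : c₁ ≤ K) (h2 : 0 ≤ c₂) (h2K : c₂ ≤ K) :
    balance c₁ c₂ a b κ ≤ K * C * (a + b) := by
  rw [balance_eq]
  have e1 := mul_nonneg h1 (psi_nonneg ha (mul_pos hκ hb))
  have e2 := (abs_le.1 (abs_mul_sub_le ha hb hκ hκC (s := c₁ - c₂) (t := K)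
    (abs_le.2 ⟨by linarith, by linarith⟩))).2
  have e3 : K * a ≤ K * (C * a) :=
    mul_le_mul_of_nonneg_left (le_mul_of_one_le_left ha.le hC) (h1.trans h1K)
  linarith

theorem psi_mul_le {C' : ℝ} (ha : 0 < a) (hb : 0 < b) (hκ : 0 < κ) (hκC : κ ≤ C)
    (hC0 : 0 < C) (hCκ : 1 / C ≤ κ) (hab : a ≤ C' * b) :
    psi a (κ * b) ≤ C * C' * a + C * b := by
  refine (psi_le ha (mul_pos hκ hb)).trans (add_le_add ?_ (mul_le_mul_of_nonneg_right hκC hb.le))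
  rw [mul_comm]
  refine mul_le_mul_of_nonneg_right ?_ ha.le
  rw [div_le_iff₀ (mul_pos hκ hb)]
  have h4 : 1 ≤ C * κ := by rw [div_le_iff₀ hC0] at hCκ; linarith
  have h5 : 0 < C' * b := ha.trans_le hab
  nlinarith

/-- A lower bound on the balance requires `a` to be at most a multiple of `b`. -/
theorem le_balance {C' : ℝ} (ha : 0 < a) (hb : 0 < b) (hκ : 0 < κ) (hκC : κ ≤ C) (hC : 1 ≤ C)
    (hCκ : 1 / C ≤ κ) (hC' : 1 ≤ C') (hab : a ≤ C' * b)
    (h1 : 0 ≤ c₁) (h1K : c₁ ≤ K) (h2 : 0 ≤ c₂) (h2K : c₂ ≤ K) :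
    -(3 * K * (C * C') * (a + b)) ≤ balance c₁ c₂ a b κ := by
  rw [balance_eq]
  have hK : 0 ≤ K := h1.trans h1K
  have e1 : c₁ * psi a (κ * b) ≤ K * (C * C' * a + C * b) :=
    mul_le_mul h1K (psi_mul_le ha hb hκ hκC (by linarith) hCκ hab)
      (psi_nonneg ha (mul_pos hκ hb)) hK
  have e2 := (abs_le.1 (abs_mul_sub_le ha hb hκ hκC (s := c₁ - c₂) (t := K)
    (abs_le.2 ⟨by linarith, by linarith⟩))).1
  have e3 : C ≤ C * C' := le_mul_of_one_le_right (by linarith) hC'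
  have e4 : 1 ≤ C * C' := hC.trans e3
  have e5 : K * (C * b) ≤ K * (C * C' * b) :=
    mul_le_mul_of_nonneg_left (mul_le_mul_of_nonneg_right e3 hb.le) hK
  have e6 : K * a ≤ K * (C * C' * a) :=
    mul_le_mul_of_nonneg_left (le_mul_of_one_le_left ha.le e4) hK
  have e7 : 0 ≤ K * (C * C' * b) := by positivity
  have e8 : 0 ≤ K * (C * C' * a) := by positivity
  linarith

/-- If both averaged rates are close to `c` and the equilibrium ratio is close to `κ'`, the balance is
at most `-c * psi a (κ' * b)` up to a small error. -/
theorem balance_le_neg_psi {κ' c ε : ℝ} (ha : 0 < a) (hb : 0 < b) (hκ : 0 < κ) (hκC : κ ≤ C)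
    (hC : 1 ≤ C) (hκ' : 0 < κ') (hCκ' : 1 / C ≤ κ') (hκκ : |κ - κ'| ≤ ε) (hc : 0 ≤ c) (hcK : c ≤ K)
    (h1 : c ≤ c₁) (h1' : c₁ ≤ c + ε) (h2 : c ≤ c₂) (h2' : c₂ ≤ c + ε) :
    balance c₁ c₂ a b κ ≤ -(c * psi a (κ' * b)) + ε * ((K + 1) * C * (a + b)) := by
  rw [balance_eq]
  have hε : 0 ≤ ε := (abs_nonneg _).trans hκκ
  have e1 : c * psi a (κ * b) ≤ c₁ * psi a (κ * b) :=
    mul_le_mul_of_nonneg_right h1 (psi_nonneg ha (mul_pos hκ hb))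
  have e2 := (abs_le.1 (abs_mul_sub_le ha hb hκ hκC (s := c₁ - c₂) (t := ε)
    (abs_le.2 ⟨by linarith, by linarith⟩))).2
  have e3 := psi_sub_le (ε := ε) ha hb hκ' hκ hCκ' (by linarith) (by rwa [abs_sub_comm] at hκκ)
  have e4 : c * (psi a (κ' * b) - psi a (κ * b)) ≤ K * (ε * (C * a + b)) :=
    (mul_le_mul_of_nonneg_left e3 hc).trans (mul_le_mul_of_nonneg_right hcK (by positivity))
  have e5 : ε * K * b ≤ ε * K * (C * b) :=
    mul_le_mul_of_nonneg_left (le_mul_of_one_le_left hb.le hC) (mul_nonneg hε (hc.trans hcK))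
  have e6 : ε * a ≤ ε * (C * a) :=
    mul_le_mul_of_nonneg_left (le_mul_of_one_le_left ha.le hC) hε
  linarith

/-- The estimate `balance_le_neg_psi` is sharp up to a small error if `a` is at most a multiple of `b`. -/
theorem neg_psi_le_balance {C' κ' c ε : ℝ} (ha : 0 < a) (hb : 0 < b) (hκ : 0 < κ) (hκC : κ ≤ C)
    (hC : 1 ≤ C) (hCκ : 1 / C ≤ κ) (hκ' : 0 < κ') (hC' : 1 ≤ C') (hab : a ≤ C' * b)
    (hκκ : |κ - κ'| ≤ ε) (hc : 0 ≤ c) (hcK : c ≤ K)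
    (h1 : c ≤ c₁) (h1' : c₁ ≤ c + ε) (h2 : c ≤ c₂) (h2' : c₂ ≤ c + ε) :
    -(c * psi a (κ' * b)) - ε * ((K + 3) * (C * C') * (a + b)) ≤ balance c₁ c₂ a b κ := by
  rw [balance_eq]
  have hε : 0 ≤ ε := (abs_nonneg _).trans hκκ
  have hK : 0 ≤ K := hc.trans hcK
  have e1 : c₁ * psi a (κ * b) ≤ (c + ε) * psi a (κ * b) :=
    mul_le_mul_of_nonneg_right h1' (psi_nonneg ha (mul_pos hκ hb))
  have e2 := (abs_le.1 (abs_mul_sub_le ha hb hκ hκC (s := c₁ - c₂) (t := ε)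
    (abs_le.2 ⟨by linarith, by linarith⟩))).1
  have e3 := psi_sub_le ha hb hκ hκ' hCκ (by linarith) hκκ
  have e4 : c * (psi a (κ * b) - psi a (κ' * b)) ≤ K * (ε * (C * a + b)) :=
    (mul_le_mul_of_nonneg_left e3 hc).trans (mul_le_mul_of_nonneg_right hcK (by positivity))
  have e0 := mul_le_mul_of_nonneg_left (psi_mul_le ha hb hκ hκC (by linarith) hCκ hab) hε
  have e3 : C ≤ C * C' := le_mul_of_one_le_right (by linarith) hC'
  have e5 : 1 ≤ C * C' := hC.trans e3
  have e6 : ε * b * C ≤ ε * b * (C * C') := mul_le_mul_of_nonneg_left e3 (by positivity)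
  have e7 : ε * a ≤ ε * a * (C * C') := le_mul_of_one_le_right (by positivity) e5
  have e8 : ε * K * a * C ≤ ε * K * a * (C * C') := mul_le_mul_of_nonneg_left e3 (by positivity)
  have e9 : ε * K * b ≤ ε * K * b * (C * C') := le_mul_of_one_le_right (by positivity) e5
  have e10 : 0 ≤ ε * a * (C * C') := by positivity
  have e11 : 0 ≤ ε * b * (C * C') := by positivity
  linarith

end

/-! ### Jumps of patterns -/

/-- The pattern obtained from `ω` by putting `ξ` on `Δ`. -/
def jump {Δ V : Finset (Site d)} (ξ : Δ → Fin q) (ω : V → Fin q) : V → Fin q :=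
  fun x => if h : (x : Site d) ∈ Δ then ξ ⟨x, h⟩ else ω x

theorem restr_splice_eq_jump {Δ : Finset (Site d)} (V : Finset (Site d)) (ξ : Δ → Fin q)
    (η : Config d q) : restr V (splice ξ η) = jump ξ (restr V η) := rfl

/-- A pattern is reached by the jump from at most `q ^ |Δ|` patterns. -/
theorem sum_jump_le {Δ V : Finset (Site d)} (ξ : Δ → Fin q) (ζ : Config d q)
    {f : (V → Fin q) → ℝ} (hf : ∀ ω, 0 ≤ f ω) :
    ∑ ω, f (jump ξ ω) ≤ Fintype.card (Δ → Fin q) * ∑ ω, f ω := by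
  classical
  rw [← Finset.sum_fiberwise Finset.univ (jump ξ), Finset.mul_sum]
  refine Finset.sum_le_sum fun ω _ => ?_
  rw [Finset.sum_congr rfl fun τ hτ => by rw [(Finset.mem_filter.1 hτ).2], Finset.sum_const,
    nsmul_eq_mul]
  refine mul_le_mul_of_nonneg_right ?_ (hf ω)
  -- a pattern with a given image under the jump is determined by its restriction to `Δ`
  have h := Finset.card_le_card_of_injOn (s := Finset.univ.filter fun τ : V → Fin q =>
    jump ξ τ = ω) (t := (Finset.univ : Finset (Δ → Fin q))) (fun τ => restr Δ (splice τ ζ))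
    (fun _ _ => Finset.mem_univ _) ?_
  · rw [Finset.card_univ] at h
    exact_mod_cast h
  · intro τ hτ τ' hτ' h
    have h1 : jump ξ τ = jump ξ τ' := by simp at hτ hτ'; rw [hτ, hτ']
    funext x
    by_cases hx : (x : Site d) ∈ Δ
    · have := congrFun h ⟨x, hx⟩
      simpa [restr, splice] using this
    · have := congrFun h1 x
      simpa [jump, hx] using this

theorem sum_fiber_cyl (ν : Measure (Config d q)) [IsFiniteMeasure ν] {V V' : Finset (Site d)}
    (h : V ⊆ V') (ω : V → Fin q) :
    ∑ ω' : V' → Fin q with Finset.restrict₂ (π := fun _ => Fin q) h ω' = ω, ν.real (cyl ω') =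
      ν.real (cyl ω) := by
  classical
  have h1 := integral_localFun ν (fun τ : V → Fin q => if τ = ω then (1 : ℝ) else 0)
  have h2 := integral_localFun ν (fun τ : V' → Fin q =>
    if Finset.restrict₂ (π := fun _ => Fin q) h τ = ω then (1 : ℝ) else 0)
  have h3 := h2.symm.trans h1
  simpa [Finset.sum_filter] using h3

/-- The probabilities of the patterns after the jump are consistent in the volume, as long as the
volume contains the jump. -/
theorem sum_fiber_cyl_jump (ν : Measure (Config d q)) [IsFiniteMeasure ν]
    {Δ V V' : Finset (Site d)} (hΔ : Δ ⊆ V) (h : V ⊆ V') (ξ : Δ → Fin q) (ω : V → Fin q) :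
    ∑ ω' : V' → Fin q with Finset.restrict₂ (π := fun _ => Fin q) h ω' = ω,
      ν.real (cyl (jump ξ ω')) = ν.real (cyl (jump ξ ω)) := by
  classical
  rw [← sum_fiber_cyl ν h]
  refine Finset.sum_bij' (fun τ _ => jump ξ τ)
    (fun τ _ => jump (Finset.restrict₂ (π := fun _ => Fin q) hΔ ω) τ) ?_ ?_ ?_ ?_ ?_
  · intro τ hτ
    simp only [Finset.mem_filter, Finset.mem_univ, true_and] at hτ ⊢
    rw [← hτ]; rfl
  · intro τ hτ
    simp only [Finset.mem_filter, Finset.mem_univ, true_and] at hτ ⊢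
    funext x
    have := congrFun hτ x
    by_cases hx : (x : Site d) ∈ Δ
    · simp [jump, hx]
    · simpa [jump, hx] using this
  · intro τ hτ
    simp only [Finset.mem_filter, Finset.mem_univ, true_and] at hτ
    funext x
    by_cases hx : (x : Site d) ∈ Δ
    · simp [jump, hx, ← hτ]
    · simp [jump, hx]
  · intro τ hτ
    simp only [Finset.mem_filter, Finset.mem_univ, true_and] at hτ
    funext x
    by_cases hx : (x : Site d) ∈ Δ
    · have := congrFun hτ ⟨x, hΔ hx⟩
      simpa [jump, hx] using this.symm
    · simp [jump, hx]
  · intro τ _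
    rfl

/-! ### The entropy balance in a finite volume -/

/-- Every cylinder has positive probability. -/
def FullSupport (ν : ProbabilityMeasure (Config d q)) : Prop :=
  ∀ (V : Finset (Site d)) (ω : V → Fin q), 0 < (ν : Measure (Config d q)).real (cyl ω)

theorem FullSupport.of_uniformlyNonNull {ν : ProbabilityMeasure (Config d q)} {δ : ℝ} (hδ : 0 < δ)
    (h : ∀ A, UniformlyNonNull δ (ν : Measure (Config d q)) A) : FullSupport ν := by
  intro V ω
  obtain ⟨ζ⟩ : Nonempty (Config d q) := nonempty_of_isProbabilityMeasure (ν : Measure (Config d q))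
  rw [← restr_splice ω ζ]
  exact (pow_pos hδ _).trans_le ((h V).pow_card_le hδ.le _)

/-- The density of `ν` with respect to `μ` on the patterns in a finite volume. -/
noncomputable def density (ν μ : ProbabilityMeasure (Config d q)) {V : Finset (Site d)}
    (ω : V → Fin q) : ℝ :=
  (ν : Measure (Config d q)).real (cyl ω) / (μ : Measure (Config d q)).real (cyl ω)

/-- The rate of a jump, averaged over `ν` given the pattern in a finite volume. -/
noncomputable def IPS.avgRate (L : IPS d q) (ν : ProbabilityMeasure (Config d q))
    {Δ V : Finset (Site d)} (ξ : Δ → Fin q) (ω : V → Fin q) : ℝ :=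
  (∫ η in cyl ω, L.rate Δ η ξ ∂(ν : Measure (Config d q))) /
    (ν : Measure (Config d q)).real (cyl ω)

/-- The contribution of the origin to the derivative of the relative entropy in the volume `V`,
minus the contribution of the origin to the vanishing equilibrium average of the generator
applied to the density. -/
noncomputable def IPS.entropyBalance (L : IPS d q) (Γ : Finset (Site d))
    (μ ν : ProbabilityMeasure (Config d q)) (V : Finset (Site d)) : ℝ :=
  ∫ η, L.originGen Γ (localFun fun ω : V → Fin q => Real.log (density ν μ ω)) η
      ∂(ν : Measure (Config d q)) -
    ∫ η, L.originGen Γ (localFun fun ω : V → Fin q => density ν μ ω) η ∂(μ : Measure (Config d q))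

theorem IPS.integrable_rate (L : IPS d q) (ν : Measure (Config d q)) [IsFiniteMeasure ν]
    (Δ : Finset (Site d)) (ξ : Δ → Fin q) : Integrable (fun η => L.rate Δ η ξ) ν :=
  integrable_continuousMap ν ⟨_, L.rate_continuous Δ ξ⟩

theorem IPS.integral_originGen_localFun (L : IPS d q) (Γ : Finset (Site d))
    (ν : ProbabilityMeasure (Config d q)) {V : Finset (Site d)} (v : (V → Fin q) → ℝ) :
    ∫ η, L.originGen Γ (localFun v) η ∂(ν : Measure (Config d q)) =
      ∑ Δ ∈ originSets Γ, (Δ.card : ℝ)⁻¹ * ∑ ξ : Δ → Fin q, ∑ ω : V → Fin q,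
        (v (jump ξ ω) - v ω) * ∫ η in cyl ω, L.rate Δ η ξ ∂(ν : Measure (Config d q)) := by
  rw [← integralCLM_apply, IPS.originGen, map_sum]
  refine Finset.sum_congr rfl fun Δ _ => ?_
  rw [map_smul, smul_eq_mul, integralCLM_apply]
  congr 1
  simp only [IPS.jumpGen_apply, localFun_apply, restr_splice_eq_jump]
  rw [integral_finsetSum]
  · refine Finset.sum_congr rfl fun ξ _ => ?_
    exact integral_mul_localFun _ (L.integrable_rate _ Δ ξ) fun ω => v (jump ξ ω) - v ω
  · intro ξ _
    exact integrable_continuousMap _ ⟨fun η => L.rate Δ η ξ *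
      (v (jump ξ (restr V η)) - v (restr V η)), (L.rate_continuous Δ ξ).mul
        (localFun fun ω => v (jump ξ ω) - v ω).continuous⟩

theorem IPS.avgRate_bounds (L : IPS d q) {ν : ProbabilityMeasure (Config d q)}
    (hν : FullSupport ν) {Δ V : Finset (Site d)} (ξ : Δ → Fin q) (ω : V → Fin q) {l u : ℝ}
    (h : ∀ η ∈ (cyl ω : Set (Config d q)), l ≤ L.rate Δ η ξ ∧ L.rate Δ η ξ ≤ u) :
    l ≤ L.avgRate ν ξ ω ∧ L.avgRate ν ξ ω ≤ u := by
  have h3 : ∀ c : ℝ, ∫ _ in (cyl ω : Set (Config d q)), c ∂(ν : Measure (Config d q)) =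
      c * (ν : Measure (Config d q)).real (cyl ω) := fun c => by simp [mul_comm]
  rw [IPS.avgRate, le_div_iff₀ (hν V ω), div_le_iff₀ (hν V ω), ← h3, ← h3]
  have hint := (L.integrable_rate (ν : Measure (Config d q)) Δ ξ).integrableOn (s := cyl ω)
  exact ⟨setIntegral_mono_on (integrable_const _).integrableOn hint (measurableSet_cyl ω)
      fun η hη => (h η hη).1,
    setIntegral_mono_on hint (integrable_const _).integrableOn (measurableSet_cyl ω)
      fun η hη => (h η hη).2⟩

theorem IPS.entropyBalance_eq (L : IPS d q) (Γ : Finset (Site d))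
    {μ ν : ProbabilityMeasure (Config d q)} (hμ : FullSupport μ) (hν : FullSupport ν)
    (V : Finset (Site d)) :
    L.entropyBalance Γ μ ν V = ∑ Δ ∈ originSets Γ, (Δ.card : ℝ)⁻¹ * ∑ ξ : Δ → Fin q,
      ∑ ω : V → Fin q, balance (L.avgRate ν ξ ω) (L.avgRate μ ξ ω)
        ((ν : Measure (Config d q)).real (cyl ω)) ((ν : Measure (Config d q)).real (cyl (jump ξ ω)))
        ((μ : Measure (Config d q)).real (cyl ω) /
          (μ : Measure (Config d q)).real (cyl (jump ξ ω))) := by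
  rw [IPS.entropyBalance, L.integral_originGen_localFun, L.integral_originGen_localFun,
    ← Finset.sum_sub_distrib]
  refine Finset.sum_congr rfl fun Δ _ => ?_
  rw [← mul_sub, ← Finset.sum_sub_distrib]
  congr 1
  refine Finset.sum_congr rfl fun ξ _ => ?_
  rw [← Finset.sum_sub_distrib]
  refine Finset.sum_congr rfl fun ω _ => ?_
  have ha := hν V ω
  have hb := hν V (jump ξ ω)
  have hm := hμ V ω
  have hm' := hμ V (jump ξ ω)
  unfold balance density IPS.avgRate
  generalize (ν : Measure (Config d q)).real (cyl ω) = a at *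
  generalize (ν : Measure (Config d q)).real (cyl (jump ξ ω)) = b at *
  generalize (μ : Measure (Config d q)).real (cyl ω) = m at *
  generalize (μ : Measure (Config d q)).real (cyl (jump ξ ω)) = m' at *
  rw [← Real.log_div (by positivity) (by positivity),
    show b / m' / (a / m) = m / m' * b / a by field_simp]
  field_simp

/-- The number `∑_Δ |Δ|⁻¹ ∑_{ξ_Δ} (1 + q^|Δ|)`, over the `Δ` with `0 ∈ Δ ⊆ Γ`, that collects the
errors of all jumps at the origin. -/
noncomputable def jumpWeight (q : ℕ) (Γ : Finset (Site d)) : ℝ :=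
  ∑ Δ ∈ originSets Γ, (Δ.card : ℝ)⁻¹ * ∑ _ξ : Δ → Fin q, (1 + (Fintype.card (Δ → Fin q) : ℝ))

theorem jumpWeight_nonneg (q : ℕ) (Γ : Finset (Site d)) : 0 ≤ jumpWeight q Γ := by
  unfold jumpWeight; positivity

theorem sum_jumps_le (Γ : Finset (Site d)) (ν : ProbabilityMeasure (Config d q))
    (V : Finset (Site d)) {f g : (Δ : Finset (Site d)) → (Δ → Fin q) → (V → Fin q) → ℝ} {M : ℝ}
    (hM : 0 ≤ M) (h : ∀ Δ ∈ originSets Γ, ∀ ξ ω, f Δ ξ ω ≤ g Δ ξ ω +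
      M * ((ν : Measure (Config d q)).real (cyl ω) +
        (ν : Measure (Config d q)).real (cyl (jump ξ ω)))) :
    ∑ Δ ∈ originSets Γ, (Δ.card : ℝ)⁻¹ * ∑ ξ : Δ → Fin q, ∑ ω, f Δ ξ ω ≤
      ∑ Δ ∈ originSets Γ, (Δ.card : ℝ)⁻¹ * ∑ ξ : Δ → Fin q, ∑ ω, g Δ ξ ω + M * jumpWeight q Γ := by
  obtain ⟨ζ⟩ : Nonempty (Config d q) := nonempty_of_isProbabilityMeasure (ν : Measure (Config d q))
  rw [jumpWeight, Finset.mul_sum, ← Finset.sum_add_distrib]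
  refine Finset.sum_le_sum fun Δ hΔ => ?_
  rw [mul_left_comm, ← mul_add]
  refine mul_le_mul_of_nonneg_left ?_ (by positivity)
  rw [Finset.mul_sum, ← Finset.sum_add_distrib]
  refine Finset.sum_le_sum fun ξ _ => ?_
  refine (Finset.sum_le_sum fun ω _ => h Δ hΔ ξ ω).trans ?_
  rw [Finset.sum_add_distrib, ← Finset.mul_sum, Finset.sum_add_distrib]
  have h1 := sum_jump_le (V := V) ξ ζ (f := fun ω => (ν : Measure (Config d q)).real (cyl ω))
    fun ω => measureReal_nonneg
  rw [sum_measureReal_cyl, mul_one] at h1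
  rw [sum_measureReal_cyl]
  gcongr

/-! ### Local approximation of the jumps -/

/-- Approximations `c` and `κ`, depending on the configuration in `W` only, of the rate of a jump
from below and of the ratio of the equilibrium probabilities before and after the jump. -/
structure JumpApprox (L : IPS d q) (μ : ProbabilityMeasure (Config d q)) (W : Finset (Site d))
    (ε C : ℝ) (Δ : Finset (Site d)) (ξ : Δ → Fin q) (c κ : Config d q → ℝ) : Prop where
  c_congr : ∀ η σ : Config d q, (∀ x ∈ W, η x = σ x) → c η = c σ
  κ_congr : ∀ η σ : Config d q, (∀ x ∈ W, η x = σ x) → κ η = κ σ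
  c_nonneg : ∀ η, 0 ≤ c η
  c_le : ∀ η, c η ≤ L.rate Δ η ξ
  rate_le : ∀ η, L.rate Δ η ξ ≤ c η + ε
  κ_pos : ∀ η, 0 < κ η
  le_κ : ∀ η, 1 / C ≤ κ η
  ratio : ∀ V, W ⊆ V → ∀ η : Config d q, |(μ : Measure (Config d q)).real (cyl (restr V η)) /
    (μ : Measure (Config d q)).real (cyl (restr V (splice ξ η))) - κ η| ≤ ε

theorem splice_congr {Λ W : Finset (Site d)} (ζ : Config d q) {η σ : Config d q}
    (h : ∀ x ∈ W, η x = σ x) (hΛ : Λ ⊆ W) :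
    splice (restr Λ η) ζ = splice (restr Λ σ) ζ := by
  congr 1
  exact funext fun x => h x (hΛ x.2)

theorem splice_eq_of_notMem {Δ : Finset (Site d)} (ξ : Δ → Fin q) (η : Config d q) (x : Site d)
    (hx : x ∉ Δ) : η x = splice ξ η x := by
  simp [splice, hx]

/-- Uniform continuity of the rates and quasilocality of the specification provide local
approximations of all jumps at the origin. -/
theorem exists_jumpApprox {L : IPS d q} (hcont : L.UniformlyContinuousRates)
    {γ : Specification d q} (hγ : γ.Quasilocal) {δ : ℝ} (hδ0 : 0 < δ) (hδ1 : δ ≤ 1)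
    (hδ : ∀ (x : Site d) (η : Config d q), δ ≤ γ.prob {x} η)
    {μ : ProbabilityMeasure (Config d q)} (hμ : γ.IsGibbs μ) (Γ : Finset (Site d)) {ε : ℝ}
    (hε : 0 < ε) :
    ∃ (W : Finset (Site d)) (c κ : (Δ : Finset (Site d)) → (Δ → Fin q) → Config d q → ℝ),
      Γ ⊆ W ∧ ∀ Δ ∈ originSets Γ, ∀ ξ,
        JumpApprox L μ W ε (δ ^ Γ.card)⁻¹ Δ ξ (c Δ ξ) (κ Δ ξ) := by
  obtain ⟨ζ⟩ : Nonempty (Config d q) := nonempty_of_isProbabilityMeasure (μ : Measure (Config d q))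
  have hθ : 0 < δ ^ Γ.card := pow_pos hδ0 _
  have hθ1 : δ ^ Γ.card ≤ 1 := pow_le_one₀ hδ0.le hδ1
  obtain ⟨W, ⟨hW1, hW2⟩, hΓW⟩ := ((hcont (ε / 2) (half_pos hε)).and
    ((originSets Γ).eventually_all.2 fun Δ _ =>
      hγ Δ (ε * (δ ^ Γ.card) ^ 2 / 2) (by positivity))).and (eventually_ge_atTop Γ) |>.exists
  have hcard : ∀ Δ ∈ originSets Γ, δ ^ Γ.card ≤ δ ^ Δ.card := fun Δ hΔ =>
    pow_le_pow_of_le_one hδ0.le hδ1 (Finset.card_le_card (mem_originSets.1 hΔ).1)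
  refine ⟨W, fun Δ ξ η => max (L.rate Δ (splice (restr W η) ζ) ξ - ε / 2) 0,
    fun Δ ξ η => γ.prob Δ (splice (restr W η) ζ) / γ.prob Δ (splice (restr W (splice ξ η)) ζ),
    hΓW, fun Δ hΔ ξ => ?_⟩
  have hp : ∀ η, δ ^ Γ.card ≤ γ.prob Δ η := fun η =>
    (hcard Δ hΔ).trans (γ.pow_card_le_prob hδ0.le hδ Δ η)
  have hp0 : ∀ η, 0 < γ.prob Δ η := fun η => hθ.trans_le (hp η)
  have hr := fun η => abs_lt.1 (hW1 Δ (mem_originSets.1 hΔ).2 η ζ ξ)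
  constructor
  · intro η σ h
    simp only [splice_congr ζ h (Finset.Subset.refl W)]
  · intro η σ h
    have h' : ∀ x ∈ W, splice ξ η x = splice ξ σ x := by
      intro x hx
      by_cases hxΔ : x ∈ Δ <;> simp [splice, hxΔ, h x hx]
    simp only [splice_congr ζ h (Finset.Subset.refl W), splice_congr ζ h' (Finset.Subset.refl W)]
  · intro η; exact le_max_right _ _
  · intro η
    exact max_le (by linarith [(hr η).2]) (L.rate_nonneg _ _ _)
  · intro η
    have := le_max_left (L.rate Δ (splice (restr W η) ζ) ξ - ε / 2) 0
    linarith [(hr η).1]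
  · intro η; exact div_pos (hp0 _) (hp0 _)
  · intro η
    rw [one_div, inv_inv, le_div_iff₀ (hp0 _)]
    calc δ ^ Γ.card * γ.prob Δ (splice (restr W (splice ξ η)) ζ)
        ≤ δ ^ Γ.card := mul_le_of_le_one_right hθ.le (γ.prob_le_one _ _)
      _ ≤ _ := hp _
  · intro V hWV η
    refine (Specification.ApproxOn.abs_ratio_sub_le hδ0 hδ hμ (fun η ζ => (hW2 Δ hΔ).2 η ζ)
      (hW2 Δ hΔ).1 hWV η (splice ξ η) ζ (splice_eq_of_notMem ξ η)).trans ?_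
    have h2 : (δ ^ Γ.card) ^ 2 ≤ (δ ^ Δ.card) ^ 2 := pow_le_pow_left₀ hθ.le (hcard Δ hΔ) 2
    rw [div_le_iff₀ (by positivity)]
    calc 2 * (ε * (δ ^ Γ.card) ^ 2 / 2) = ε * (δ ^ Γ.card) ^ 2 := by ring
      _ ≤ _ := mul_le_mul_of_nonneg_left h2 hε.le

/-! ### The dissipation functional -/

/-- The entropy dissipated by the jumps at the origin, as seen in the volume `V`, with approximate
rates `c` and approximate equilibrium ratios `κ`. The configuration `ζ` only serves to extend
patterns to configurations. -/
noncomputable def dissipation (Γ : Finset (Site d)) (ζ : Config d q)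
    (c κ : (Δ : Finset (Site d)) → (Δ → Fin q) → Config d q → ℝ) (V : Finset (Site d))
    (ν : ProbabilityMeasure (Config d q)) : ℝ :=
  ∑ Δ ∈ originSets Γ, (Δ.card : ℝ)⁻¹ * ∑ ξ : Δ → Fin q, ∑ ω : V → Fin q,
    c Δ ξ (splice ω ζ) * psi ((ν : Measure (Config d q)).real (cyl ω))
      (κ Δ ξ (splice ω ζ) * (ν : Measure (Config d q)).real (cyl (jump ξ ω)))

section Bounds

variable {L : IPS d q} {μ : ProbabilityMeasure (Config d q)} {Γ W : Finset (Site d)}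
  {ε C : ℝ} {c κ : (Δ : Finset (Site d)) → (Δ → Fin q) → Config d q → ℝ} {ζ : Config d q}

theorem dissipation_nonneg
    (h : ∀ Δ ∈ originSets Γ, ∀ ξ, JumpApprox L μ W ε C Δ ξ (c Δ ξ) (κ Δ ξ)) (V : Finset (Site d))
    {ν : ProbabilityMeasure (Config d q)} (hν : FullSupport ν) :
    0 ≤ dissipation Γ ζ c κ V ν := by
  refine Finset.sum_nonneg fun Δ hΔ => mul_nonneg (by positivity)
    (Finset.sum_nonneg fun ξ _ => Finset.sum_nonneg fun ω _ => ?_)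
  exact mul_nonneg ((h Δ hΔ ξ).c_nonneg _)
    (psi_nonneg (hν V ω) (mul_pos ((h Δ hΔ ξ).κ_pos _) (hν V _)))

/-- By the log-sum inequality the dissipation seen in a volume grows with the volume. -/
theorem dissipation_mono
    (h : ∀ Δ ∈ originSets Γ, ∀ ξ, JumpApprox L μ W ε C Δ ξ (c Δ ξ) (κ Δ ξ)) (hΓW : Γ ⊆ W)
    {V V' : Finset (Site d)} (hWV : W ⊆ V) (hVV' : V ⊆ V')
    {ν : ProbabilityMeasure (Config d q)} (hν : FullSupport ν) :
    dissipation Γ ζ c κ V ν ≤ dissipation Γ ζ c κ V' ν := by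
  classical
  refine Finset.sum_le_sum fun Δ hΔ => mul_le_mul_of_nonneg_left
    (Finset.sum_le_sum fun ξ _ => ?_) (by positivity)
  have hΔV : Δ ⊆ V := (mem_originSets.1 hΔ).1.trans (hΓW.trans hWV)
  rw [← Finset.sum_fiberwise (Finset.univ : Finset (V' → Fin q))
    (Finset.restrict₂ (π := fun _ => Fin q) hVV')]
  refine Finset.sum_le_sum fun ω _ => ?_
  have hagree : ∀ ω' : V' → Fin q, Finset.restrict₂ (π := fun _ => Fin q) hVV' ω' = ω →
      ∀ x ∈ W, splice ω' ζ x = splice ω ζ x := by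
    intro ω' hω' x hx
    have := congrFun hω' ⟨x, hWV hx⟩
    simpa [splice, hWV hx, hVV' (hWV hx)] using this
  have hcongr : ∀ ω' ∈ Finset.univ.filter fun ω' : V' → Fin q =>
      Finset.restrict₂ (π := fun _ => Fin q) hVV' ω' = ω,
      c Δ ξ (splice ω' ζ) * psi ((ν : Measure (Config d q)).real (cyl ω'))
        (κ Δ ξ (splice ω' ζ) * (ν : Measure (Config d q)).real (cyl (jump ξ ω'))) =
      c Δ ξ (splice ω ζ) * psi ((ν : Measure (Config d q)).real (cyl ω'))
        (κ Δ ξ (splice ω ζ) * (ν : Measure (Config d q)).real (cyl (jump ξ ω'))) := by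
    intro ω' hω'
    have hx := hagree ω' (Finset.mem_filter.1 hω').2
    rw [(h Δ hΔ ξ).c_congr _ _ hx, (h Δ hΔ ξ).κ_congr _ _ hx]
  rw [Finset.sum_congr rfl hcongr, ← Finset.mul_sum]
  refine mul_le_mul_of_nonneg_left ?_ ((h Δ hΔ ξ).c_nonneg _)
  rw [← sum_fiber_cyl (ν : Measure (Config d q)) hVV',
    ← sum_fiber_cyl_jump (ν : Measure (Config d q)) hΔV hVV', Finset.mul_sum]
  exact psi_sum_le _ (fun ω' _ => hν _ _)
    fun ω' _ => mul_pos ((h Δ hΔ ξ).κ_pos _) (hν _ _)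

/-- In a fixed volume the dissipation is continuous in the probabilities of the cylinders. -/
theorem tendsto_dissipation
    (h : ∀ Δ ∈ originSets Γ, ∀ ξ, JumpApprox L μ W ε C Δ ξ (c Δ ξ) (κ Δ ξ)) (V : Finset (Site d))
    {ι : Type*} {l : Filter ι} {ν : ι → ProbabilityMeasure (Config d q)}
    {ρ : ProbabilityMeasure (Config d q)} (hρ : FullSupport ρ)
    (hν : ∀ ω : V → Fin q, Tendsto (fun i => (ν i : Measure (Config d q)).real (cyl ω)) l
      (𝓝 ((ρ : Measure (Config d q)).real (cyl ω)))) :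
    Tendsto (fun i => dissipation Γ ζ c κ V (ν i)) l (𝓝 (dissipation Γ ζ c κ V ρ)) := by
  refine tendsto_finsetSum _ fun Δ hΔ => Tendsto.const_mul _
    (tendsto_finsetSum _ fun ξ _ => tendsto_finsetSum _ fun ω _ => Tendsto.const_mul _ ?_)
  have hb := (hν (jump ξ ω)).const_mul (κ Δ ξ (splice ω ζ))
  have hb0 := mul_pos ((h Δ hΔ ξ).κ_pos (splice ω ζ)) (hρ V (jump ξ ω))
  unfold psi
  exact (((hν ω).mul (((hν ω).div hb hb0.ne').log (div_pos (hρ V ω) hb0).ne')).sub (hν ω)).add hb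

variable {δ K : ℝ}

/-- The ratio of the probabilities before and after a jump at the origin. -/
theorem ratio_bounds {Δ : Finset (Site d)} (hΔ : Δ ∈ originSets Γ) (hδ0 : 0 < δ) (hδ1 : δ ≤ 1)
    {ν : ProbabilityMeasure (Config d q)}
    (hnn : ∀ A, UniformlyNonNull δ (ν : Measure (Config d q)) A) (V : Finset (Site d))
    (ξ : Δ → Fin q) (ω : V → Fin q) :
    (ν : Measure (Config d q)).real (cyl ω) ≤
      (δ ^ Γ.card)⁻¹ * (ν : Measure (Config d q)).real (cyl (jump ξ ω)) ∧
    (ν : Measure (Config d q)).real (cyl (jump ξ ω)) ≤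
      (δ ^ Γ.card)⁻¹ * (ν : Measure (Config d q)).real (cyl ω) := by
  obtain ⟨ζ⟩ : Nonempty (Config d q) := nonempty_of_isProbabilityMeasure (ν : Measure (Config d q))
  have hθ : 0 < δ ^ Γ.card := pow_pos hδ0 _
  have hcard : δ ^ Γ.card ≤ δ ^ Δ.card :=
    pow_le_pow_of_le_one hδ0.le hδ1 (Finset.card_le_card (mem_originSets.1 hΔ).1)
  have hω : ω = restr V (splice ω ζ) := (restr_splice ω ζ).symm
  rw [← div_eq_inv_mul, ← div_eq_inv_mul, le_div_iff₀ hθ, le_div_iff₀ hθ, mul_comm,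
    mul_comm _ (δ ^ Γ.card), hω, ← restr_splice_eq_jump]
  exact ⟨(mul_le_mul_of_nonneg_right hcard measureReal_nonneg).trans
      ((hnn V).cyl_le hδ0.le hδ1 (splice_eq_of_notMem ξ _)),
    (mul_le_mul_of_nonneg_right hcard measureReal_nonneg).trans
      ((hnn V).cyl_le hδ0.le hδ1 fun x hx => (splice_eq_of_notMem ξ _ x hx).symm)⟩

theorem equilibrium_ratio_bounds {Δ : Finset (Site d)} (hΔ : Δ ∈ originSets Γ) (hδ0 : 0 < δ)
    (hδ1 : δ ≤ 1) (hnn : ∀ A, UniformlyNonNull δ (μ : Measure (Config d q)) A)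
    (V : Finset (Site d)) (ξ : Δ → Fin q) (ω : V → Fin q) :
    0 < (μ : Measure (Config d q)).real (cyl ω) /
        (μ : Measure (Config d q)).real (cyl (jump ξ ω)) ∧
    (μ : Measure (Config d q)).real (cyl ω) /
        (μ : Measure (Config d q)).real (cyl (jump ξ ω)) ≤ (δ ^ Γ.card)⁻¹ ∧
    1 / (δ ^ Γ.card)⁻¹ ≤ (μ : Measure (Config d q)).real (cyl ω) /
        (μ : Measure (Config d q)).real (cyl (jump ξ ω)) := by
  have hθ : 0 < δ ^ Γ.card := pow_pos hδ0 _
  have hμ := FullSupport.of_uniformlyNonNull hδ0 hnn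
  obtain ⟨h1, h2⟩ := ratio_bounds hΔ hδ0 hδ1 hnn V ξ ω
  refine ⟨div_pos (hμ V ω) (hμ V _), (div_le_iff₀ (hμ V _)).2 h1, ?_⟩
  rw [one_div, inv_inv, le_div_iff₀ (hμ V _)]
  rw [← div_eq_inv_mul, le_div_iff₀ hθ] at h2
  linarith

theorem one_le_inv_pow (hδ0 : 0 < δ) (hδ1 : δ ≤ 1) (n : ℕ) : 1 ≤ (δ ^ n)⁻¹ :=
  (one_le_inv₀ (pow_pos hδ0 _)).2 (pow_le_one₀ hδ0.le hδ1)

theorem IPS.avgRate_mem (L : IPS d q) {Δ : Finset (Site d)} (hΔ : Δ ∈ originSets Γ)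
    (hK : ∀ Δ ∈ originSets Γ, ∀ ξ η, L.rate Δ η ξ ≤ K) {ν : ProbabilityMeasure (Config d q)}
    (hν : FullSupport ν) {V : Finset (Site d)} (ξ : Δ → Fin q) (ω : V → Fin q) :
    0 ≤ L.avgRate ν ξ ω ∧ L.avgRate ν ξ ω ≤ K :=
  L.avgRate_bounds hν ξ ω fun η _ => ⟨L.rate_nonneg _ _ _, hK Δ hΔ ξ η⟩

theorem JumpApprox.avgRate_mem {Δ : Finset (Site d)} {ξ : Δ → Fin q} {c κ : Config d q → ℝ}
    (h : JumpApprox L μ W ε C Δ ξ c κ) {V : Finset (Site d)} (hWV : W ⊆ V)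
    {ν : ProbabilityMeasure (Config d q)} (hν : FullSupport ν) (ω : V → Fin q) :
    c (splice ω ζ) ≤ L.avgRate ν ξ ω ∧ L.avgRate ν ξ ω ≤ c (splice ω ζ) + ε := by
  refine L.avgRate_bounds hν ξ ω fun η hη => ?_
  have : c (splice ω ζ) = c η := h.c_congr _ _ fun x hx => by
    rw [← mem_cyl.1 hη]
    simp [splice, restr, hWV hx]
  rw [this]
  exact ⟨h.c_le η, h.rate_le η⟩

theorem JumpApprox.abs_ratio_sub_le {Δ : Finset (Site d)} {ξ : Δ → Fin q} {c κ : Config d q → ℝ}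
    (h : JumpApprox L μ W ε C Δ ξ c κ) {V : Finset (Site d)} (hWV : W ⊆ V) (ω : V → Fin q) :
    |(μ : Measure (Config d q)).real (cyl ω) / (μ : Measure (Config d q)).real (cyl (jump ξ ω)) -
      κ (splice ω ζ)| ≤ ε := by
  have := h.ratio V hWV (splice ω ζ)
  rwa [restr_splice_eq_jump V ξ, restr_splice] at this

/-- Upper bound on the entropy balance in an arbitrary volume. -/
theorem IPS.entropyBalance_le (hδ0 : 0 < δ) (hδ1 : δ ≤ 1)
    (hnn : ∀ A, UniformlyNonNull δ (μ : Measure (Config d q)) A)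
    (hK : ∀ Δ ∈ originSets Γ, ∀ ξ η, L.rate Δ η ξ ≤ K) (hK0 : 0 ≤ K)
    {ν : ProbabilityMeasure (Config d q)} (hν : FullSupport ν) (V : Finset (Site d)) :
    L.entropyBalance Γ μ ν V ≤ K * (δ ^ Γ.card)⁻¹ * jumpWeight q Γ := by
  have hμ := FullSupport.of_uniformlyNonNull hδ0 hnn
  rw [L.entropyBalance_eq Γ hμ hν]
  refine (sum_jumps_le Γ ν V (g := fun _ _ _ => 0) (M := K * (δ ^ Γ.card)⁻¹) (by positivity)
    fun Δ hΔ ξ ω => ?_).trans_eq (by simp)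
  obtain ⟨h1, h2⟩ := L.avgRate_mem hΔ hK hν ξ ω
  obtain ⟨h3, h4⟩ := L.avgRate_mem hΔ hK hμ ξ ω
  obtain ⟨h5, h6, -⟩ := equilibrium_ratio_bounds hΔ hδ0 hδ1 hnn V ξ ω
  rw [zero_add]
  exact balance_le (hν V ω) (hν V _) h5 h6 (one_le_inv_pow hδ0 hδ1 _) h1 h2 h3 h4

/-- Lower bound on the entropy balance of a non-null measure in an arbitrary volume. -/
theorem IPS.le_entropyBalance (hδ0 : 0 < δ) (hδ1 : δ ≤ 1)
    (hnn : ∀ A, UniformlyNonNull δ (μ : Measure (Config d q)) A)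
    (hK : ∀ Δ ∈ originSets Γ, ∀ ξ η, L.rate Δ η ξ ≤ K) (hK0 : 0 ≤ K)
    {ρ : ProbabilityMeasure (Config d q)} {δ' : ℝ} (hδ0' : 0 < δ') (hδ1' : δ' ≤ 1)
    (hρ : ∀ A, UniformlyNonNull δ' (ρ : Measure (Config d q)) A) (V : Finset (Site d)) :
    -(3 * K * ((δ ^ Γ.card)⁻¹ * (δ' ^ Γ.card)⁻¹) * jumpWeight q Γ) ≤
      L.entropyBalance Γ μ ρ V := by
  have hμ := FullSupport.of_uniformlyNonNull hδ0 hnn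
  have hν := FullSupport.of_uniformlyNonNull hδ0' hρ
  rw [L.entropyBalance_eq Γ hμ hν, neg_le_iff_add_nonneg]
  refine (le_of_eq (by simp)).trans (sum_jumps_le Γ ρ V (f := fun _ _ _ => 0)
    (M := 3 * K * ((δ ^ Γ.card)⁻¹ * (δ' ^ Γ.card)⁻¹)) (by positivity) fun Δ hΔ ξ ω => ?_)
  obtain ⟨h1, h2⟩ := L.avgRate_mem hΔ hK hν ξ ω
  obtain ⟨h3, h4⟩ := L.avgRate_mem hΔ hK hμ ξ ω
  obtain ⟨h5, h6, h7⟩ := equilibrium_ratio_bounds hΔ hδ0 hδ1 hnn V ξ ω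
  have := le_balance (hν V ω) (hν V (jump ξ ω)) h5 h6 (one_le_inv_pow hδ0 hδ1 _) h7
    (one_le_inv_pow hδ0' hδ1' Γ.card) (ratio_bounds hΔ hδ0' hδ1' hρ V ξ ω).1 h1 h2 h3 h4
  linarith

/-- In volumes that contain `W`, the entropy balance is bounded by the dissipation. -/
theorem IPS.entropyBalance_le_neg_dissipation (hδ0 : 0 < δ) (hδ1 : δ ≤ 1)
    (hnn : ∀ A, UniformlyNonNull δ (μ : Measure (Config d q)) A)
    (hK : ∀ Δ ∈ originSets Γ, ∀ ξ η, L.rate Δ η ξ ≤ K) (hK0 : 0 ≤ K) (hε : 0 ≤ ε)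
    (h : ∀ Δ ∈ originSets Γ, ∀ ξ, JumpApprox L μ W ε (δ ^ Γ.card)⁻¹ Δ ξ (c Δ ξ) (κ Δ ξ))
    {ν : ProbabilityMeasure (Config d q)} (hν : FullSupport ν) {V : Finset (Site d)}
    (hWV : W ⊆ V) :
    L.entropyBalance Γ μ ν V ≤ -dissipation Γ ζ c κ V ν +
      ε * ((K + 1) * (δ ^ Γ.card)⁻¹) * jumpWeight q Γ := by
  have hμ := FullSupport.of_uniformlyNonNull hδ0 hnn
  rw [L.entropyBalance_eq Γ hμ hν]
  refine (sum_jumps_le Γ ν V (g := fun Δ ξ ω => -(c Δ ξ (splice ω ζ) *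
    psi ((ν : Measure (Config d q)).real (cyl ω))
      (κ Δ ξ (splice ω ζ) * (ν : Measure (Config d q)).real (cyl (jump ξ ω)))))
    (M := ε * ((K + 1) * (δ ^ Γ.card)⁻¹)) (by positivity)
    fun Δ hΔ ξ ω => ?_).trans_eq (by simp [dissipation])
  obtain ⟨h1, h2⟩ := (h Δ hΔ ξ).avgRate_mem (ζ := ζ) hWV hν ω
  obtain ⟨h3, h4⟩ := (h Δ hΔ ξ).avgRate_mem (ζ := ζ) hWV hμ ω
  obtain ⟨h5, h6, -⟩ := equilibrium_ratio_bounds hΔ hδ0 hδ1 hnn V ξ ω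
  have := balance_le_neg_psi (hν V ω) (hν V (jump ξ ω)) h5 h6 (one_le_inv_pow hδ0 hδ1 _)
    ((h Δ hΔ ξ).κ_pos _) ((h Δ hΔ ξ).le_κ _) ((h Δ hΔ ξ).abs_ratio_sub_le (ζ := ζ) hWV ω)
    ((h Δ hΔ ξ).c_nonneg _) (((h Δ hΔ ξ).c_le _).trans (hK Δ hΔ ξ _)) h1 h2 h3 h4
  linarith

/-- For a non-null measure, the bound of the entropy balance by the dissipation is sharp up to a
small error. -/
theorem IPS.neg_dissipation_le_entropyBalance (hδ0 : 0 < δ) (hδ1 : δ ≤ 1)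
    (hnn : ∀ A, UniformlyNonNull δ (μ : Measure (Config d q)) A)
    (hK : ∀ Δ ∈ originSets Γ, ∀ ξ η, L.rate Δ η ξ ≤ K) (hK0 : 0 ≤ K) (hε : 0 ≤ ε)
    (h : ∀ Δ ∈ originSets Γ, ∀ ξ, JumpApprox L μ W ε (δ ^ Γ.card)⁻¹ Δ ξ (c Δ ξ) (κ Δ ξ))
    {ρ : ProbabilityMeasure (Config d q)} {δ' : ℝ} (hδ0' : 0 < δ') (hδ1' : δ' ≤ 1)
    (hρ : ∀ A, UniformlyNonNull δ' (ρ : Measure (Config d q)) A) {V : Finset (Site d)}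
    (hWV : W ⊆ V) :
    -dissipation Γ ζ c κ V ρ ≤ L.entropyBalance Γ μ ρ V +
      ε * ((K + 3) * ((δ ^ Γ.card)⁻¹ * (δ' ^ Γ.card)⁻¹)) * jumpWeight q Γ := by
  have hμ := FullSupport.of_uniformlyNonNull hδ0 hnn
  have hν := FullSupport.of_uniformlyNonNull hδ0' hρ
  rw [L.entropyBalance_eq Γ hμ hν]
  refine (le_of_eq (by simp [dissipation])).trans (sum_jumps_le Γ ρ V
    (f := fun Δ ξ ω => -(c Δ ξ (splice ω ζ) *
    psi ((ρ : Measure (Config d q)).real (cyl ω))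
      (κ Δ ξ (splice ω ζ) * (ρ : Measure (Config d q)).real (cyl (jump ξ ω)))))
    (M := ε * ((K + 3) * ((δ ^ Γ.card)⁻¹ * (δ' ^ Γ.card)⁻¹))) (by positivity)
    fun Δ hΔ ξ ω => ?_)
  obtain ⟨h1, h2⟩ := (h Δ hΔ ξ).avgRate_mem (ζ := ζ) hWV hν ω
  obtain ⟨h3, h4⟩ := (h Δ hΔ ξ).avgRate_mem (ζ := ζ) hWV hμ ω
  obtain ⟨h5, h6, h7⟩ := equilibrium_ratio_bounds hΔ hδ0 hδ1 hnn V ξ ω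
  have := neg_psi_le_balance (hν V ω) (hν V (jump ξ ω)) h5 h6 (one_le_inv_pow hδ0 hδ1 _) h7
    ((h Δ hΔ ξ).κ_pos _) (one_le_inv_pow hδ0' hδ1' Γ.card)
    (ratio_bounds hΔ hδ0' hδ1' hρ V ξ ω).1 ((h Δ hΔ ξ).abs_ratio_sub_le (ζ := ζ) hWV ω)
    ((h Δ hΔ ξ).c_nonneg _) (((h Δ hΔ ξ).c_le _).trans (hK Δ hΔ ξ _)) h1 h2 h3 h4
  linarith

end Bounds

theorem IPS.exists_rate_le (L : IPS d q) (Γ : Finset (Site d)) :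
    ∃ K : ℝ, 0 ≤ K ∧ ∀ Δ ∈ originSets Γ, ∀ ξ η, L.rate Δ η ξ ≤ K := by
  have h : ∀ (Δ : Finset (Site d)) (ξ : Δ → Fin q), ∃ K : ℝ, 0 ≤ K ∧ ∀ η, L.rate Δ η ξ ≤ K := by
    intro Δ ξ
    obtain ⟨K, hK⟩ := (isCompact_range (L.rate_continuous Δ ξ)).bddAbove
    exact ⟨max K 0, le_max_right _ _, fun η => (hK ⟨η, rfl⟩).trans (le_max_left _ _)⟩
  choose K hK0 hK using h
  refine ⟨∑ Δ ∈ originSets Γ, ∑ ξ, K Δ ξ,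
    Finset.sum_nonneg fun Δ _ => Finset.sum_nonneg fun ξ _ => hK0 Δ ξ, fun Δ hΔ ξ η => ?_⟩
  calc L.rate Δ η ξ ≤ K Δ ξ := hK Δ ξ η
    _ ≤ ∑ ξ, K Δ ξ :=
      Finset.single_le_sum (f := fun ξ => K Δ ξ) (fun ξ _ => hK0 Δ ξ) (Finset.mem_univ ξ)
    _ ≤ _ := Finset.single_le_sum (f := fun Δ => ∑ ξ, K Δ ξ)
      (fun Δ _ => Finset.sum_nonneg fun ξ _ => hK0 Δ ξ) hΔ

/-! ### Relative entropy along the evolution -/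

/-- The relative entropy in a finite volume as a real number; it is the correct value if every
cylinder has positive `μ`-probability. -/
noncomputable def relEntropy (Λ : Finset (Site d)) (ν μ : ProbabilityMeasure (Config d q)) : ℝ :=
  ∑ ω : Λ → Fin q, (ν : Measure (Config d q)).real (cyl ω) * Real.log (density ν μ ω)

theorem FullSupport.localRelEntropy_eq {μ : ProbabilityMeasure (Config d q)} (hμ : FullSupport μ)
    (Λ : Finset (Site d)) (ν : ProbabilityMeasure (Config d q)) :
    localRelEntropy Λ ν μ = (relEntropy Λ ν μ : EReal) := by
  rw [localRelEntropy, if_pos]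
  · rfl
  · intro ω h
    have := hμ Λ ω
    rw [measureReal_def, h] at this
    simp at this

theorem mul_log_div {m : ℝ} (hm : 0 < m) (x : ℝ) :
    x * Real.log (x / m) = x * Real.log x - Real.log m * x := by
  rcases eq_or_ne x 0 with rfl | hx
  · simp
  · rw [Real.log_div hx hm.ne']; ring

theorem FullSupport.tendsto_relEntropy {μ : ProbabilityMeasure (Config d q)} (hμ : FullSupport μ)
    (Λ : Finset (Site d)) {ι : Type*} {l : Filter ι} {ν : ι → ProbabilityMeasure (Config d q)}
    {ρ : ProbabilityMeasure (Config d q)}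
    (h : ∀ ω : Λ → Fin q, Tendsto (fun i => (ν i : Measure (Config d q)).real (cyl ω)) l
      (𝓝 ((ρ : Measure (Config d q)).real (cyl ω)))) :
    Tendsto (fun i => relEntropy Λ (ν i) μ) l (𝓝 (relEntropy Λ ρ μ)) := by
  refine tendsto_finsetSum _ fun ω _ => ?_
  simp only [density, mul_log_div (hμ Λ ω)]
  exact ((Real.continuous_mul_log.tendsto _).comp (h ω)).sub ((h ω).const_mul _)

theorem FullSupport.relEntropy_nonneg {μ : ProbabilityMeasure (Config d q)} (hμ : FullSupport μ)
    (Λ : Finset (Site d)) (ν : ProbabilityMeasure (Config d q)) : 0 ≤ relEntropy Λ ν μ := by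
  have h : ∀ ω : Λ → Fin q, (ν : Measure (Config d q)).real (cyl ω) -
      (μ : Measure (Config d q)).real (cyl ω) ≤
      (ν : Measure (Config d q)).real (cyl ω) * Real.log (density ν μ ω) := by
    intro ω
    have hm := hμ Λ ω
    rcases (measureReal_nonneg (μ := (ν : Measure (Config d q))) (s := cyl ω)).eq_or_lt with h | h
    · rw [← h]; linarith
    · have := psi_nonneg h hm
      unfold psi at this
      unfold density
      linarith
  have h2 := Finset.sum_le_sum fun ω (_ : ω ∈ (Finset.univ : Finset (Λ → Fin q))) => h ω
  rw [Finset.sum_sub_distrib, sum_measureReal_cyl, sum_measureReal_cyl, sub_self] at h2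
  exact h2

/-- The relative entropy per site is bounded, as `μ` gives probability at least `δ ^ |Λ|` to each
cylinder. -/
theorem relEntropy_le {μ : ProbabilityMeasure (Config d q)} {δ : ℝ} (hδ0 : 0 < δ)
    (hnn : ∀ A, UniformlyNonNull δ (μ : Measure (Config d q)) A) (Λ : Finset (Site d))
    (ν : ProbabilityMeasure (Config d q)) : relEntropy Λ ν μ ≤ -Real.log δ * Λ.card := by
  obtain ⟨ζ⟩ : Nonempty (Config d q) := nonempty_of_isProbabilityMeasure (μ : Measure (Config d q))
  have h : ∀ ω : Λ → Fin q, (ν : Measure (Config d q)).real (cyl ω) * Real.log (density ν μ ω) ≤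
      (ν : Measure (Config d q)).real (cyl ω) * (-Real.log δ * Λ.card) := by
    intro ω
    have hm : δ ^ Λ.card ≤ (μ : Measure (Config d q)).real (cyl ω) := by
      rw [← restr_splice ω ζ]
      exact (hnn Λ).pow_card_le hδ0.le _
    have hm0 := (pow_pos hδ0 Λ.card).trans_le hm
    rcases (measureReal_nonneg (μ := (ν : Measure (Config d q))) (s := cyl ω)).eq_or_lt with h | h
    · rw [← h]; simp
    · refine mul_le_mul_of_nonneg_left ?_ h.le
      rw [density, Real.log_div h.ne' hm0.ne']
      have h1 : Real.log ((ν : Measure (Config d q)).real (cyl ω)) ≤ 0 :=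
        Real.log_nonpos h.le measureReal_le_one
      have h2 := Real.log_le_log (pow_pos hδ0 Λ.card) hm
      rw [Real.log_pow] at h2
      linarith
  refine (Finset.sum_le_sum fun ω _ => h ω).trans_eq ?_
  rw [← Finset.sum_mul, sum_measureReal_cyl, one_mul]

/-- The derivative of the relative entropy along the evolution. -/
theorem IPS.IsSemigroupOf.hasDerivWithinAt_relEntropy {L : IPS d q} {P : FellerSemigroup d q}
    (hP : L.IsSemigroupOf P) (hL : L.TranslationInvariant) {Γ : Finset (Site d)}
    (hΓ : ∀ Δ : Finset (Site d), 0 ∈ Δ → ¬ Δ ⊆ Γ → L.supRate Δ = 0) {Λ S : Finset (Site d)}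
    (hS : ∀ x, ∀ y ∈ Λ, y - x ∈ Γ → x ∈ S) {μ : ProbabilityMeasure (Config d q)}
    (hμ : FullSupport μ) (ν : ProbabilityMeasure (Config d q)) {s : ℝ} (hs : 0 ≤ s)
    (hν : FullSupport (P.evolve s.toNNReal ν)) :
    HasDerivWithinAt (fun r : ℝ => relEntropy Λ (P.evolve r.toNNReal ν) μ)
      (∫ η, L.localGen Γ S (localFun fun ω : Λ → Fin q =>
        Real.log (density (P.evolve s.toNNReal ν) μ ω)) η
          ∂(P.evolve s.toNNReal ν : Measure (Config d q))) (Set.Ici s) s := by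
  classical
  have hG := hP.localGen_mem_generatorGraph hL hΓ hS
  have hcyl : ∀ ω : Λ → Fin q, ∃ p' : ℝ, HasDerivWithinAt
      (fun r : ℝ => (P.evolve r.toNNReal ν : Measure (Config d q)).real (cyl ω)) p'
      (Set.Ici s) s := by
    intro ω
    refine ⟨_, (P.hasDerivWithinAt_integral_evolve
      (hG fun ω' => if ω' = ω then 1 else 0) ν hs).congr_of_mem (fun r _ => ?_) Set.self_mem_Ici⟩
    refine Eq.symm ((integral_localFun _ (fun ω' : Λ → Fin q => if ω' = ω then 1 else 0)).trans ?_)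
    simp
  choose p' hp' using hcyl
  set v : (Λ → Fin q) → ℝ := fun ω => Real.log (density (P.evolve s.toNNReal ν) μ ω) with hv
  have h1 : HasDerivWithinAt (fun r : ℝ => relEntropy Λ (P.evolve r.toNNReal ν) μ)
      (∑ ω, (v ω + 1) * p' ω) (Set.Ici s) s := by
    unfold relEntropy
    refine HasDerivWithinAt.fun_sum fun ω _ => ?_
    have hp0 := hν Λ ω
    have h2 := (hp' ω).mul (((hp' ω).div_const
      ((μ : Measure (Config d q)).real (cyl ω))).log (div_pos hp0 (hμ Λ ω)).ne')
    refine h2.congr_deriv ?_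
    have hm := hμ Λ ω
    simp only [hv, density]
    field_simp
  have h2 : HasDerivWithinAt (fun r : ℝ => ∑ ω, (v ω + 1) *
      (P.evolve r.toNNReal ν : Measure (Config d q)).real (cyl ω)) (∑ ω, (v ω + 1) * p' ω)
      (Set.Ici s) s := HasDerivWithinAt.fun_sum fun ω _ => (hp' ω).const_mul _
  -- constants do not contribute, as the total mass is conserved
  have h3 : HasDerivWithinAt (fun r : ℝ => ∑ ω, (v ω + 1) *
      (P.evolve r.toNNReal ν : Measure (Config d q)).real (cyl ω))
      (∫ η, L.localGen Γ S (localFun v) η ∂(P.evolve s.toNNReal ν : Measure (Config d q)))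
      (Set.Ici s) s := by
    refine ((P.hasDerivWithinAt_integral_evolve (hG v) ν hs).add_const 1).congr_of_mem
      (fun r _ => ?_) Set.self_mem_Ici
    have h4 := integral_localFun (P.evolve r.toNNReal ν : Measure (Config d q)) v
    simp only [localFun_apply]
    simp only [add_mul, one_mul, Finset.sum_add_distrib]
    rw [h4, sum_measureReal_cyl]
  rw [← (uniqueDiffWithinAt_Ici s).eq_deriv _ h2 h3]
  exact h1

theorem TranslationInvariant.shiftCLM_density {μ ν : ProbabilityMeasure (Config d q)}
    (hμ : TranslationInvariant μ) (hν : TranslationInvariant ν) (x : Site d) (Λ : Finset (Site d))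
    (φ : ℝ → ℝ) :
    shiftCLM x (localFun fun ω : Λ → Fin q => φ (density ν μ ω)) =
      localFun fun ω : shiftSet (-x) Λ → Fin q => φ (density ν μ ω) := by
  ext η
  simp only [shiftCLM_apply, localFun_apply, density, hμ.measureReal_cyl_shift,
    hν.measureReal_cyl_shift]

/-- The derivative of the relative entropy is the sum over the sites of the entropy balances of the
origin in the translated volumes. -/
theorem IPS.IsSemigroupOf.integral_localGen_eq {L : IPS d q} {P : FellerSemigroup d q}
    (hP : L.IsSemigroupOf P) (hL : L.TranslationInvariant) {Γ : Finset (Site d)}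
    (hΓ : ∀ Δ : Finset (Site d), 0 ∈ Δ → ¬ Δ ⊆ Γ → L.supRate Δ = 0) {Λ S : Finset (Site d)}
    (hS : ∀ x, ∀ y ∈ Λ, y - x ∈ Γ → x ∈ S) {μ ν : ProbabilityMeasure (Config d q)}
    (hμ : SpinSystem.TranslationInvariant μ) (hstat : ∀ t, P.evolve t μ = μ) (hν : SpinSystem.TranslationInvariant ν) :
    ∫ η, L.localGen Γ S (localFun fun ω : Λ → Fin q => Real.log (density ν μ ω)) η
        ∂(ν : Measure (Config d q)) =
      ∑ x ∈ S, L.entropyBalance Γ μ ν (shiftSet (-x) Λ) := by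
  have h0 : ∫ η, L.localGen Γ S (localFun fun ω : Λ → Fin q => density ν μ ω) η
      ∂(μ : Measure (Config d q)) = 0 := by
    have h1 := P.hasDerivWithinAt_integral_evolve
      (hP.localGen_mem_generatorGraph hL hΓ hS fun ω : Λ → Fin q => density ν μ ω) μ le_rfl
    simp only [hstat] at h1
    exact (uniqueDiffWithinAt_Ici 0).eq_deriv _ h1 (hasDerivWithinAt_const _ _ _)
  rw [← sub_zero (∫ η, L.localGen Γ S _ η ∂(ν : Measure (Config d q))), ← h0,
    hν.integral_localGen, hμ.integral_localGen, ← Finset.sum_sub_distrib]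
  refine Finset.sum_congr rfl fun x _ => ?_
  rw [hμ.shiftCLM_density hν x Λ Real.log, hμ.shiftCLM_density hν x Λ fun y => y]
  rfl

/-! ### Mixtures -/

/-- The mixture `(ν + θ μ) / (1 + θ)`. -/
noncomputable def mixture (θ : ℝ≥0) (ν μ : ProbabilityMeasure (Config d q)) :
    ProbabilityMeasure (Config d q) :=
  ⟨(1 + θ)⁻¹ • ((ν : Measure (Config d q)) + θ • (μ : Measure (Config d q))), ⟨by
    have h : (1 + θ) ≠ 0 := by positivity
    simp only [Measure.smul_apply, Measure.add_apply, measure_univ, ENNReal.smul_def, smul_eq_mul,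
      mul_one]
    rw [← ENNReal.coe_one, ← ENNReal.coe_add, ← ENNReal.coe_mul, inv_mul_cancel₀ h]⟩⟩

theorem mixture_real (θ : ℝ≥0) (ν μ : ProbabilityMeasure (Config d q)) (A : Set (Config d q)) :
    (mixture θ ν μ : Measure (Config d q)).real A = (1 + (θ : ℝ))⁻¹ *
      ((ν : Measure (Config d q)).real A + θ * (μ : Measure (Config d q)).real A) := by
  change ((1 + θ)⁻¹ • ((ν : Measure (Config d q)) + θ • (μ : Measure (Config d q)))).real A = _
  rw [measureReal_nnreal_smul_apply, measureReal_add_apply, measureReal_nnreal_smul_apply]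
  push_cast
  rfl

theorem FullSupport.mixture {θ : ℝ≥0} (hθ : 0 < θ) (ν : ProbabilityMeasure (Config d q))
    {μ : ProbabilityMeasure (Config d q)} (hμ : FullSupport μ) : FullSupport (mixture θ ν μ) := by
  intro V ω
  rw [mixture_real]
  have := hμ V ω
  have hθ' : (0 : ℝ) < θ := hθ
  have := measureReal_nonneg (μ := (ν : Measure (Config d q))) (s := cyl ω)
  positivity

theorem TranslationInvariant.mixture (θ : ℝ≥0) {μ ν : ProbabilityMeasure (Config d q)}
    (hν : TranslationInvariant ν) (hμ : TranslationInvariant μ) :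
    TranslationInvariant (mixture θ ν μ) := by
  intro x
  change ((1 + θ)⁻¹ • ((ν : Measure (Config d q)) + θ • (μ : Measure (Config d q)))).map (shift x) =
    (1 + θ)⁻¹ • ((ν : Measure (Config d q)) + θ • (μ : Measure (Config d q)))
  rw [Measure.map_smul, Measure.map_add _ _ (measurable_shift x), Measure.map_smul, hν x, hμ x]

theorem FellerSemigroup.evolve_mixture (P : FellerSemigroup d q) (t θ : ℝ≥0)
    (ν μ : ProbabilityMeasure (Config d q)) :
    P.evolve t (mixture θ ν μ) = mixture θ (P.evolve t ν) (P.evolve t μ) := by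
  refine Subtype.ext ?_
  change ((1 + θ)⁻¹ • ((ν : Measure (Config d q)) + θ • (μ : Measure (Config d q)))).bind
    (P.kernel t) = (1 + θ)⁻¹ • ((ν : Measure (Config d q)).bind (P.kernel t) +
      θ • (μ : Measure (Config d q)).bind (P.kernel t))
  ext A hA
  have hk : ∀ m : Measure (Config d q), AEMeasurable (P.kernel t) m := fun m =>
    (P.kernel t).measurable.aemeasurable
  simp only [Measure.bind_apply hA (hk _), Measure.smul_apply, Measure.add_apply,
    lintegral_add_measure, lintegral_smul_measure]

theorem tendsto_mixture (ν μ : ProbabilityMeasure (Config d q)) (A : Set (Config d q)) :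
    Tendsto (fun θ => (mixture θ ν μ : Measure (Config d q)).real A) (𝓝 0)
      (𝓝 ((ν : Measure (Config d q)).real A)) := by
  simp only [mixture_real]
  have h : Continuous fun θ : ℝ≥0 => (1 + (θ : ℝ))⁻¹ *
      ((ν : Measure (Config d q)).real A + θ * (μ : Measure (Config d q)).real A) := by
    refine Continuous.mul (Continuous.inv₀ (by fun_prop) fun θ => by positivity) (by fun_prop)
  simpa using h.tendsto 0

/-- A bound on the derivative of the relative entropy, for all small admixtures of the equilibrium
measure, bounds its increment. The admixture makes the relative entropy differentiable. -/
theorem IPS.IsSemigroupOf.relEntropy_evolve_le {L : IPS d q} {P : FellerSemigroup d q}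
    (hP : L.IsSemigroupOf P) (hL : L.TranslationInvariant) {Γ : Finset (Site d)}
    (hΓ : ∀ Δ : Finset (Site d), 0 ∈ Δ → ¬ Δ ⊆ Γ → L.supRate Δ = 0) {Λ S : Finset (Site d)}
    (hS : ∀ x, ∀ y ∈ Λ, y - x ∈ Γ → x ∈ S) {μ ν : ProbabilityMeasure (Config d q)}
    (hμ : SpinSystem.TranslationInvariant μ) (hμ0 : FullSupport μ) (hstat : ∀ t, P.evolve t μ = μ)
    (hν : ∀ t, SpinSystem.TranslationInvariant (P.evolve t ν)) {s : ℝ≥0} {B : ℝ}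
    (hB : ∀ᶠ θ : ℝ≥0 in 𝓝[>] 0, ∀ r ≤ s,
      ∑ x ∈ S, L.entropyBalance Γ μ (mixture θ (P.evolve r ν) μ) (shiftSet (-x) Λ) ≤ B) :
    relEntropy Λ (P.evolve s ν) μ ≤ relEntropy Λ ν μ + B * s := by
  have h1 : ∀ᶠ θ : ℝ≥0 in 𝓝[>] 0, relEntropy Λ (mixture θ (P.evolve s ν) μ) μ ≤
      relEntropy Λ (mixture θ ν μ) μ + B * s := by
    filter_upwards [hB, self_mem_nhdsWithin] with θ hθ hθ0
    have hθ0 : 0 < θ := hθ0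
    have hmix : ∀ t, P.evolve t (mixture θ ν μ) = mixture θ (P.evolve t ν) μ := fun t => by
      rw [P.evolve_mixture, hstat]
    have hcont : Continuous fun r : ℝ => relEntropy Λ (P.evolve r.toNNReal (mixture θ ν μ)) μ := by
      rw [continuous_iff_continuousAt]
      intro r
      refine hμ0.tendsto_relEntropy Λ fun ω => ?_
      classical
      have h2 := P.continuous_integral_evolve
        (localFun fun ω' : Λ → Fin q => if ω' = ω then 1 else 0) (mixture θ ν μ)
      have h3 : ∀ t, ∫ η, localFun (fun ω' : Λ → Fin q => if ω' = ω then 1 else 0) η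
          ∂(P.evolve t (mixture θ ν μ) : Measure (Config d q)) =
          (P.evolve t (mixture θ ν μ) : Measure (Config d q)).real (cyl ω) := fun t => by
        refine ((integral_localFun _ (fun ω' : Λ → Fin q => if ω' = ω then 1 else 0)).trans ?_)
        simp
      simp only [h3] at h2
      exact (h2.comp continuous_real_toNNReal).tendsto r
    have h4 := image_le_of_deriv_right_le_deriv_boundary (a := 0) (b := s)
      (B := fun r : ℝ => relEntropy Λ (mixture θ ν μ) μ + B * r) (B' := fun _ => B)
      hcont.continuousOn
      (fun r hr => hP.hasDerivWithinAt_relEntropy hL hΓ hS hμ0 (mixture θ ν μ) hr.1 (by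
        rw [hmix]; exact hμ0.mixture hθ0 _)) ?_ (by fun_prop) ?_ ?_ (x := s) ⟨s.2, le_rfl⟩
    · simpa [hmix] using h4
    · simp [P.evolve_zero]
    · intro r _
      simpa using (((hasDerivAt_id r).const_mul B).const_add
        (relEntropy Λ (mixture θ ν μ) μ)).hasDerivWithinAt
    · intro r hr
      rw [hmix, hP.integral_localGen_eq hL hΓ hS hμ hstat ((hν _).mixture θ hμ)]
      exact hθ _ (Real.toNNReal_le_iff_le_coe.2 hr.2.le)
  have ht : ∀ m : ProbabilityMeasure (Config d q), Tendsto
      (fun θ => relEntropy Λ (mixture θ m μ) μ) (𝓝[>] 0) (𝓝 (relEntropy Λ m μ)) := fun m =>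
    hμ0.tendsto_relEntropy Λ fun ω => (tendsto_mixture m μ _).mono_left nhdsWithin_le_nhds
  exact le_of_tendsto_of_tendsto (ht _) ((ht _).add_const _) h1

/-! ### Boxes -/

theorem mem_box {n : ℕ} {x : Site d} : x ∈ box d n ↔ ∀ i, |x i| ≤ n := by
  simp [box, Fintype.mem_piFinset, abs_le]

theorem card_box (d n : ℕ) : (box d n).card = (2 * n + 1) ^ d := by
  rw [box, Fintype.card_piFinset]
  simp only [Int.card_Icc, Finset.prod_const, Finset.card_univ, Fintype.card_fin]
  congr 1
  omega

theorem box_mono {m n : ℕ} (h : m ≤ n) : box d m ⊆ box d n := fun x hx =>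
  mem_box.2 fun i => (mem_box.1 hx i).trans (by exact_mod_cast h)

theorem exists_subset_box (Λ : Finset (Site d)) : ∃ n, Λ ⊆ box d n := by
  refine ⟨∑ x ∈ Λ, ∑ i, (x i).natAbs, fun x hx => mem_box.2 fun i => ?_⟩
  rw [Int.abs_eq_natAbs, Nat.cast_le]
  exact (Finset.single_le_sum (f := fun i => (x i).natAbs) (fun _ _ => Nat.zero_le _)
    (Finset.mem_univ i)).trans (Finset.single_le_sum (f := fun x : Site d => ∑ i, (x i).natAbs)
      (fun _ _ => Nat.zero_le _) hx)

theorem mem_box_of_sub_mem {n g : ℕ} {x y : Site d} (hy : y ∈ box d n) (h : y - x ∈ box d g) :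
    x ∈ box d (n + g) := mem_box.2 fun i => by
  have h1 := mem_box.1 hy i
  have h2 := mem_box.1 h i
  rw [Pi.sub_apply] at h2
  have h3 : x i = y i - (y i - x i) := by ring
  rw [h3]
  push_cast
  exact (abs_sub _ _).trans (add_le_add h1 h2)

theorem subset_shiftSet_box {n R : ℕ} (hn : R ≤ n) {V : Finset (Site d)} (hV : V ⊆ box d R)
    {x : Site d} (hx : x ∈ box d (n - R)) : V ⊆ shiftSet (-x) (box d n) := fun v hv =>
  mem_shiftSet.2 <| mem_box.2 fun i => by
    have h1 := mem_box.1 (hV hv) i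
    have h2 := mem_box.1 hx i
    rw [Nat.cast_sub hn] at h2
    rw [sub_neg_eq_add, Pi.add_apply]
    exact (abs_add_le _ _).trans (by linarith)

theorem tendsto_card_box_ratio (d : ℕ) {a : ℕ → ℕ} {k : ℕ}
    (ha : ∀ᶠ n in atTop, a n ≤ n + k ∧ n ≤ a n + k) :
    Tendsto (fun n => ((box d (a n)).card : ℝ) / (box d n).card) atTop (𝓝 1) := by
  have h1 : Tendsto (fun n : ℕ => (2 * (a n : ℝ) + 1) / (2 * n + 1)) atTop (𝓝 1) := by
    have h2 : Tendsto (fun n : ℕ => (2 * k : ℝ) / (2 * (n : ℝ) + 1)) atTop (𝓝 0) := by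
      refine Tendsto.const_div_atTop ?_ _
      exact tendsto_atTop_add_const_right _ _
        (tendsto_natCast_atTop_atTop.const_mul_atTop two_pos)
    rw [tendsto_iff_norm_sub_tendsto_zero]
    refine squeeze_zero' (Eventually.of_forall fun _ => norm_nonneg _) ?_ h2
    filter_upwards [ha] with n hn
    have hn1 : (a n : ℝ) ≤ n + k := by exact_mod_cast hn.1
    have hn2 : (n : ℝ) ≤ a n + k := by exact_mod_cast hn.2
    have hp : (0 : ℝ) < 2 * n + 1 := by positivity
    rw [Real.norm_eq_abs, div_sub_one hp.ne', abs_div, abs_of_pos hp]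
    refine div_le_div_of_nonneg_right (abs_le.2 ⟨by linarith, by linarith⟩) hp.le
  have h3 := h1.pow d
  rw [one_pow] at h3
  refine h3.congr fun n => ?_
  rw [card_box, card_box, div_pow]
  push_cast
  rfl

/-- A sum over a cube is governed by the bulk: terms near the boundary only have to be bounded. -/
theorem eventually_sum_box_le (R g : ℕ) (b : ℝ) {C ε : ℝ} (hε : 0 < ε) :
    ∀ᶠ n in atTop, ∀ f : Site d → ℝ, (∀ x ∈ box d (n - R), f x ≤ b) → (∀ x, f x ≤ C) →
      ∑ x ∈ box d (n + g), f x ≤ (b + ε) * (box d n).card := by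
  have h1 := tendsto_card_box_ratio d (a := fun n => n - R) (k := R)
    (Eventually.of_forall fun n => by omega)
  have h2 := tendsto_card_box_ratio d (a := fun n => n + g) (k := g)
    (Eventually.of_forall fun n => by omega)
  have h3 := (h1.const_mul b).add ((h2.sub h1).const_mul C)
  rw [sub_self, mul_zero, add_zero, mul_one] at h3
  filter_upwards [h3.eventually_lt_const (lt_add_of_pos_right b hε)] with n hn f hf hC
  have hpos : (0 : ℝ) < (box d n).card := by rw [card_box]; positivity
  have hsub : box d (n - R) ⊆ box d (n + g) := box_mono (by omega)
  classical
  calc ∑ x ∈ box d (n + g), f x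
      = ∑ x ∈ box d (n + g) \ box d (n - R), f x + ∑ x ∈ box d (n - R), f x :=
        (Finset.sum_sdiff hsub).symm
    _ ≤ (box d (n + g) \ box d (n - R)).card • C + (box d (n - R)).card • b :=
        add_le_add (Finset.sum_le_card_nsmul _ _ _ fun x _ => hC x)
          (Finset.sum_le_card_nsmul _ _ _ hf)
    _ = (b * (((box d (n - R)).card : ℝ) / (box d n).card) +
        C * (((box d (n + g)).card : ℝ) / (box d n).card -
          ((box d (n - R)).card : ℝ) / (box d n).card)) * (box d n).card := by
        rw [Finset.card_sdiff_of_subset hsub, nsmul_eq_mul, nsmul_eq_mul,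
          Nat.cast_sub (Finset.card_le_card hsub)]
        field_simp
        ring
    _ ≤ _ := mul_le_mul_of_nonneg_right hn.le hpos.le

/-! ### Zero entropy loss of limit points -/

section Loss

variable {L : IPS d q} {μ : ProbabilityMeasure (Config d q)} {Γ W V : Finset (Site d)}
  {ε δ K : ℝ} {c κ : (Δ : Finset (Site d)) → (Δ → Fin q) → Config d q → ℝ} {ζ : Config d q}

/-- If a fixed volume `V` dissipates entropy at rate `η`, then large cubes lose entropy at a rate of
about `η` per site. -/
theorem eventually_sum_entropyBalance_le (hδ0 : 0 < δ) (hδ1 : δ ≤ 1)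
    (hnn : ∀ A, UniformlyNonNull δ (μ : Measure (Config d q)) A)
    (hK : ∀ Δ ∈ originSets Γ, ∀ ξ η, L.rate Δ η ξ ≤ K) (hK0 : 0 ≤ K) (hε : 0 ≤ ε)
    (h : ∀ Δ ∈ originSets Γ, ∀ ξ, JumpApprox L μ W ε (δ ^ Γ.card)⁻¹ Δ ξ (c Δ ξ) (κ Δ ξ))
    (hΓW : Γ ⊆ W) (hWV : W ⊆ V) (g : ℕ) (η : ℝ) {ε' : ℝ} (hε' : 0 < ε') :
    ∀ᶠ n in atTop, ∀ ν : ProbabilityMeasure (Config d q), FullSupport ν →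
      η ≤ dissipation Γ ζ c κ V ν →
      ∑ x ∈ box d (n + g), L.entropyBalance Γ μ ν (shiftSet (-x) (box d n)) ≤
        (-η + ε * ((K + 1) * (δ ^ Γ.card)⁻¹) * jumpWeight q Γ + ε') * (box d n).card := by
  obtain ⟨R, hR⟩ := exists_subset_box V
  filter_upwards [eventually_sum_box_le R g
    (-η + ε * ((K + 1) * (δ ^ Γ.card)⁻¹) * jumpWeight q Γ)
    (C := K * (δ ^ Γ.card)⁻¹ * jumpWeight q Γ) hε', eventually_ge_atTop R] with n hn hnR ν hν hη
  refine hn _ (fun x hx => ?_) fun x => L.entropyBalance_le hδ0 hδ1 hnn hK hK0 hν _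
  have hVx : V ⊆ shiftSet (-x) (box d n) := subset_shiftSet_box hnR hR hx
  have h1 := L.entropyBalance_le_neg_dissipation (ζ := ζ) hδ0 hδ1 hnn hK hK0 hε h hν
    (hWV.trans hVx)
  have h2 := dissipation_mono (ζ := ζ) h hΓW hWV hVx hν
  linarith

/-- If large cubes lose entropy, then some volume dissipates entropy. -/
theorem eventually_le_sum_entropyBalance (hδ0 : 0 < δ) (hδ1 : δ ≤ 1)
    (hnn : ∀ A, UniformlyNonNull δ (μ : Measure (Config d q)) A)
    (hK : ∀ Δ ∈ originSets Γ, ∀ ξ η, L.rate Δ η ξ ≤ K) (hK0 : 0 ≤ K) (hε : 0 ≤ ε)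
    (h : ∀ Δ ∈ originSets Γ, ∀ ξ, JumpApprox L μ W ε (δ ^ Γ.card)⁻¹ Δ ξ (c Δ ξ) (κ Δ ξ))
    {ρ : ProbabilityMeasure (Config d q)} {δ' : ℝ} (hδ0' : 0 < δ') (hδ1' : δ' ≤ 1)
    (hρ : ∀ A, UniformlyNonNull δ' (ρ : Measure (Config d q)) A) (g : ℕ) {η : ℝ}
    (hdiss : ∀ V, W ⊆ V → dissipation Γ ζ c κ V ρ ≤ η) {ε' : ℝ} (hε' : 0 < ε') :
    ∀ᶠ n in atTop,
      -(η + ε * ((K + 3) * ((δ ^ Γ.card)⁻¹ * (δ' ^ Γ.card)⁻¹)) * jumpWeight q Γ + ε') *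
          (box d n).card ≤
        ∑ x ∈ box d (n + g), L.entropyBalance Γ μ ρ (shiftSet (-x) (box d n)) := by
  obtain ⟨R, hR⟩ := exists_subset_box W
  filter_upwards [eventually_sum_box_le R g
    (η + ε * ((K + 3) * ((δ ^ Γ.card)⁻¹ * (δ' ^ Γ.card)⁻¹)) * jumpWeight q Γ)
    (C := 3 * K * ((δ ^ Γ.card)⁻¹ * (δ' ^ Γ.card)⁻¹) * jumpWeight q Γ) hε',
    eventually_ge_atTop R] with n hn hnR
  have h1 := hn (fun x => -L.entropyBalance Γ μ ρ (shiftSet (-x) (box d n))) (fun x hx => ?_)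
    fun x => ?_
  · rw [Finset.sum_neg_distrib] at h1
    linarith
  · have hWx : W ⊆ shiftSet (-x) (box d n) := subset_shiftSet_box hnR hR hx
    have h1 := L.neg_dissipation_le_entropyBalance (ζ := ζ) hδ0 hδ1 hnn hK hK0 hε h hδ0' hδ1' hρ hWx
    have h2 := hdiss _ hWx
    linarith
  · have := L.le_entropyBalance hδ0 hδ1 hnn hK hK0 hδ0' hδ1' hρ (shiftSet (-x) (box d n))
    linarith

end Loss

/-- Entropy densities are bounded and asymptotically nonincreasing, so they cannot drop by a fixed
amount near infinitely many late times. -/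
theorem false_of_repeated_drop {H : ℕ → ℝ≥0 → ℝ} {vol : ℕ → ℝ} {C : ℝ} {t : ℕ → ℝ≥0}
    (ht : Tendsto t atTop atTop) (hvol : ∀ n, 0 < vol n) (h0 : ∀ n s, 0 ≤ H n s)
    (hC : ∀ n s, H n s ≤ C * vol n)
    (hmono : ∀ ε : ℝ, 0 < ε → ∀ᶠ n in atTop, ∀ r s : ℝ≥0, H n (r + s) ≤ H n r + ε * vol n * s)
    {s₀ : ℝ≥0} {η : ℝ} (hη : 0 < η)
    (hdrop : ∀ᶠ k in atTop, ∀ᶠ n in atTop, H n (t k + s₀) ≤ H n (t k) - η * vol n) : False := by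
  have key : ∀ J : ℕ, ∃ T : ℝ≥0, ∀ ε : ℝ, 0 < ε → ∀ᶠ n in atTop,
      H n T ≤ (C - J * η + ε) * vol n := by
    intro J
    induction J with
    | zero =>
      refine ⟨0, fun ε hε => Eventually.of_forall fun n => (hC n 0).trans ?_⟩
      have := mul_pos hε (hvol n)
      push_cast
      linarith
    | succ J ih =>
      obtain ⟨T, hT⟩ := ih
      obtain ⟨k, hk, hkT⟩ := (hdrop.and (ht.eventually_ge_atTop T)).exists
      refine ⟨t k + s₀, fun ε hε => ?_⟩
      obtain ⟨r, hr⟩ := exists_add_of_le hkT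
      have hr0 : (0 : ℝ) < r + 1 := by positivity
      filter_upwards [hk, hT (ε / 2) (half_pos hε), hmono (ε / 2 / (r + 1)) (by positivity)]
        with n h1 h2 h3
      have h4 := h3 T r
      rw [← hr] at h4
      have h5 : ε / 2 / ((r : ℝ) + 1) * vol n * r ≤ ε / 2 * vol n := by
        have : ε / 2 / ((r : ℝ) + 1) * r ≤ ε / 2 := by
          rw [div_mul_eq_mul_div, div_le_iff₀ hr0]
          nlinarith
        calc _ = ε / 2 / ((r : ℝ) + 1) * r * vol n := by ring
          _ ≤ _ := mul_le_mul_of_nonneg_right this (hvol n).le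
      push_cast
      linarith
  obtain ⟨J, hJ⟩ := exists_nat_gt ((C + 1) / η)
  rw [div_lt_iff₀ hη] at hJ
  obtain ⟨T, hT⟩ := key J
  obtain ⟨n, hn⟩ := (hT 1 one_pos).exists
  have h1 := (h0 n T).trans hn
  have h2 := mul_pos_of_neg_of_neg (sub_neg.2 hJ) (neg_neg_of_pos (hvol n))
  linarith

/-- Dissipation persists: if the limit point dissipates entropy in `V`, then so does the
trajectory, with a small admixture of `μ`, for a while after all late times of the sequence. -/
theorem eventually_lt_dissipation {L : IPS d q} (P : FellerSemigroup d q)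
    {μ ρ ν : ProbabilityMeasure (Config d q)} {Γ W : Finset (Site d)} {ε C : ℝ}
    {c κ : (Δ : Finset (Site d)) → (Δ → Fin q) → Config d q → ℝ} {ζ : Config d q}
    (h : ∀ Δ ∈ originSets Γ, ∀ ξ, JumpApprox L μ W ε C Δ ξ (c Δ ξ) (κ Δ ξ)) (hρ : FullSupport ρ)
    {t : ℕ → ℝ≥0} (hconv : Tendsto (fun n => P.evolve (t n) ν) atTop (𝓝 ρ)) {V : Finset (Site d)}
    {η : ℝ} (hη : η < dissipation Γ ζ c κ V ρ) :
    ∃ s₀ : ℝ≥0, 0 < s₀ ∧ ∀ᶠ k in atTop, ∀ᶠ θ : ℝ≥0 in 𝓝[>] 0, ∀ r ≤ s₀,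
      η < dissipation Γ ζ c κ V (mixture θ (P.evolve (t k + r) ν) μ) := by
  classical
  have hcyl : ∀ ω : V → Fin q, Tendsto (fun p : (ℕ × ℝ≥0) × ℝ≥0 =>
      (mixture p.1.2 (P.evolve (t p.1.1 + p.2) ν) μ : Measure (Config d q)).real (cyl ω))
      ((atTop ×ˢ 𝓝 0) ×ˢ 𝓝 0) (𝓝 ((ρ : Measure (Config d q)).real (cyl ω))) := by
    intro ω
    let f : C(Config d q, ℝ) := localFun fun ω' : V → Fin q => if ω' = ω then 1 else 0
    have hf : ∀ m : ProbabilityMeasure (Config d q),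
        ∫ η, f η ∂(m : Measure (Config d q)) = (m : Measure (Config d q)).real (cyl ω) := by
      intro m
      refine ((integral_localFun _ (fun ω' : V → Fin q => if ω' = ω then 1 else 0)).trans ?_)
      simp
    have h1 : Tendsto (fun p : (ℕ × ℝ≥0) × ℝ≥0 =>
        (P.evolve (t p.1.1 + p.2) ν : Measure (Config d q)).real (cyl ω))
        ((atTop ×ˢ 𝓝 0) ×ˢ 𝓝 0) (𝓝 ((ρ : Measure (Config d q)).real (cyl ω))) := by
      have h2 : Tendsto (fun p : (ℕ × ℝ≥0) × ℝ≥0 =>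
          (P.evolve (t p.1.1) ν : Measure (Config d q)).real (cyl ω))
          ((atTop ×ˢ 𝓝 0) ×ˢ 𝓝 0) (𝓝 ((ρ : Measure (Config d q)).real (cyl ω))) :=
        (tendsto_measureReal_cyl hconv ω).comp (tendsto_fst.comp tendsto_fst)
      have h3 : Tendsto (fun p : (ℕ × ℝ≥0) × ℝ≥0 => ‖P.act p.2 f - f‖)
          ((atTop ×ˢ 𝓝 0) ×ˢ 𝓝 0) (𝓝 0) :=
        (tendsto_iff_norm_sub_tendsto_zero.1 (P.tendsto_act_zero f)).comp tendsto_snd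
      refine h2.congr_dist (squeeze_zero (fun _ => dist_nonneg) (fun p => ?_) h3)
      rw [dist_comm, Real.dist_eq, ← hf, ← hf, P.evolve_add, P.integral_evolve,
        ← integralCLM_apply, ← integralCLM_apply, ← map_sub, integralCLM_apply]
      refine (norm_integral_le_of_norm_le_const (C := ‖P.act p.2 f - f‖)
        (Eventually.of_forall fun σ => (P.act p.2 f - f).norm_coe_le_norm σ)).trans ?_
      simp
    have hθ : Tendsto (fun p : (ℕ × ℝ≥0) × ℝ≥0 => (p.1.2 : ℝ)) ((atTop ×ˢ 𝓝 0) ×ˢ 𝓝 0)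
        (𝓝 0) := by
      have : Tendsto (fun θ : ℝ≥0 => (θ : ℝ)) (𝓝 0) (𝓝 0) :=
        NNReal.continuous_coe.tendsto' 0 0 rfl
      exact this.comp (tendsto_snd.comp tendsto_fst)
    simp only [mixture_real]
    have h4 := ((hθ.const_add 1).inv₀ (by norm_num)).mul
      (h1.add (hθ.mul_const ((μ : Measure (Config d q)).real (cyl ω))))
    simpa using h4
  have h1 := (tendsto_dissipation (ζ := ζ) h V hρ hcyl).eventually_const_lt hη
  obtain ⟨pa, ha, pb, hb, hab⟩ := eventually_prod_iff.1 h1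
  obtain ⟨s₀, hs₀, hball⟩ := NNReal.nhds_zero_basis.mem_iff.1 hb
  refine ⟨s₀ / 2, by positivity, ?_⟩
  filter_upwards [ha.curry] with k hk
  filter_upwards [hk.filter_mono nhdsWithin_le_nhds] with θ hθ r hr
  exact hab hθ (hball (Set.mem_Iio.2 (hr.trans_lt (NNReal.half_lt_self hs₀.ne'))))

end SpinSystem

open SpinSystem
theorem mainTheorem2 {d q : ℕ} (hd : 0 < d)
    (L : IPS d q) (hL : L.WellDefined)
    (hL_ti : L.TranslationInvariant) (hL_fin : L.FinitelyManyTypes)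
    (hL_cont : L.UniformlyContinuousRates) (hL_min : L.MinimalTransitionRate)
    (hL_trap : L.NoTrapStates)
    (γ : Specification d q) (μ : ProbabilityMeasure (Config d q))
    (hcond : L.ZeroEntropyLossCondition hL γ μ)
    (ν : ProbabilityMeasure (Config d q)) (hν : SpinSystem.TranslationInvariant ν)
    (t : ℕ → ℝ≥0) (ht : Tendsto t atTop atTop)
    (hnonnull : ∀ n, NonNull ((L.semigroup hL).evolve (t n) ν))
    (νstar : ProbabilityMeasure (Config d q)) (hstar : NonNull νstar)
    (hconv : Tendsto (fun n => (L.semigroup hL).evolve (t n) ν) atTop (𝓝 νstar)) :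
    γ.IsGibbs νstar := by
  obtain ⟨Γ, -, hΓ⟩ := id hL_fin
  have hP := L.semigroup_spec hL
  have hstat : ∀ t, (L.semigroup hL).evolve t μ = μ := hcond.stationary
  have hμTI := hcond.translationInvariant
  have hμG := hcond.gibbs
  generalize hPdef : L.semigroup hL = P at hP hstat hconv
  obtain ⟨ζ⟩ : Nonempty (Config d q) := nonempty_of_isProbabilityMeasure (μ : Measure (Config d q))
  obtain ⟨δ, hδ0, hδ1, hδ⟩ :=
    hcond.spec_nonNull.prob_singleton hcond.spec_translationInvariant
  have hnn : ∀ A, UniformlyNonNull δ (μ : Measure (Config d q)) A := fun A =>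
    Specification.uniformlyNonNull hδ fun x _ => hμG {x}
  have hμ0 := FullSupport.of_uniformlyNonNull hδ0 hnn
  obtain ⟨K, hK0, hK⟩ := L.exists_rate_le Γ
  obtain ⟨g, hg⟩ := exists_subset_box Γ
  have hS : ∀ n, ∀ x, ∀ y ∈ box d n, y - x ∈ Γ → x ∈ box d (n + g) := fun n x y hy hyx =>
    mem_box_of_sub_mem hy (hg hyx)
  have hνt : ∀ s, SpinSystem.TranslationInvariant (P.evolve s ν) := fun s =>
    hν.evolve hP hL_ti hL_fin s
  have hρTI : SpinSystem.TranslationInvariant νstar :=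
    SpinSystem.TranslationInvariant.of_tendsto (fun n => hνt (t n)) hconv
  obtain ⟨δ', hδ0', hδ1', hρ⟩ := hstar.uniformlyNonNull hρTI
  have hρ0 := FullSupport.of_uniformlyNonNull hδ0' hρ
  have hvol : ∀ n, (0 : ℝ) < (box d n).card := fun n => by rw [card_box]; positivity
  -- local approximations whose errors are below a given `η`
  have happrox : ∀ η : ℝ, 0 < η → ∃ (ε : ℝ) (W : Finset (Site d))
      (c κ : (Δ : Finset (Site d)) → (Δ → Fin q) → Config d q → ℝ), 0 ≤ ε ∧
      ε * ((K + 1) * (δ ^ Γ.card)⁻¹) * jumpWeight q Γ ≤ η ∧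
      ε * ((K + 3) * ((δ ^ Γ.card)⁻¹ * (δ' ^ Γ.card)⁻¹)) * jumpWeight q Γ ≤ η ∧ Γ ⊆ W ∧
      ∀ Δ ∈ originSets Γ, ∀ ξ, JumpApprox L μ W ε (δ ^ Γ.card)⁻¹ Δ ξ (c Δ ξ) (κ Δ ξ) := by
    intro η hη
    have hM1 : 0 ≤ (K + 1) * (δ ^ Γ.card)⁻¹ * jumpWeight q Γ :=
      mul_nonneg (by positivity) (jumpWeight_nonneg q Γ)
    have hM2 : 0 ≤ (K + 3) * ((δ ^ Γ.card)⁻¹ * (δ' ^ Γ.card)⁻¹) * jumpWeight q Γ :=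
      mul_nonneg (by positivity) (jumpWeight_nonneg q Γ)
    set M₁ := (K + 1) * (δ ^ Γ.card)⁻¹ * jumpWeight q Γ with hM₁
    set M₂ := (K + 3) * ((δ ^ Γ.card)⁻¹ * (δ' ^ Γ.card)⁻¹) * jumpWeight q Γ with hM₂
    have hε : 0 < η / (M₁ + M₂ + 1) := by positivity
    obtain ⟨W, c, κ, hW, h⟩ := exists_jumpApprox hL_cont hcond.spec_quasilocal hδ0 hδ1 hδ hμG Γ hε
    refine ⟨_, W, c, κ, hε.le, ?_, ?_, hW, h⟩
    · rw [mul_assoc, ← hM₁, div_mul_eq_mul_div, div_le_iff₀ (by positivity)]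
      nlinarith
    · rw [mul_assoc, ← hM₂, div_mul_eq_mul_div, div_le_iff₀ (by positivity)]
      nlinarith
  -- no cube gains more than a negligible amount of entropy per site
  have hupper : ∀ η : ℝ, 0 < η → ∀ᶠ n in atTop, ∀ m : ProbabilityMeasure (Config d q),
      FullSupport m → ∑ x ∈ box d (n + g), L.entropyBalance Γ μ m (shiftSet (-x) (box d n)) ≤
        η * (box d n).card := by
    intro η hη
    obtain ⟨ε, W, c, κ, hε, hε1, -, hΓW, h⟩ := happrox (η / 2) (half_pos hη)
    filter_upwards [eventually_sum_entropyBalance_le (ζ := ζ) hδ0 hδ1 hnn hK hK0 hε h hΓW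
      (Finset.Subset.refl W) g 0 (half_pos hη)] with n hn m hm
    refine (hn m hm (dissipation_nonneg h W hm)).trans
      (mul_le_mul_of_nonneg_right ?_ (hvol n).le)
    linarith
  -- large cubes do not lose entropy either, or the trajectory would lose too much of it
  have hlower : ∀ η : ℝ, 0 < η → ∀ᶠ n in atTop, -η * (box d n).card ≤
      ∑ x ∈ box d (n + g), L.entropyBalance Γ μ νstar (shiftSet (-x) (box d n)) := by
    intro η hη
    obtain ⟨ε, W, c, κ, hε, hε1, hε2, hΓW, h⟩ := happrox (η / 8) (by positivity)
    by_cases hdiss : ∀ V, W ⊆ V → dissipation Γ ζ c κ V νstar ≤ η / 2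
    · filter_upwards [eventually_le_sum_entropyBalance hδ0 hδ1 hnn hK hK0 hε h hδ0' hδ1' hρ g hdiss
        (ε' := η / 8) (by positivity)] with n hn
      refine le_trans (mul_le_mul_of_nonneg_right ?_ (hvol n).le) hn
      linarith
    exfalso
    push Not at hdiss
    obtain ⟨V, hWV, hV⟩ := hdiss
    obtain ⟨s₀, hs₀, hpersist⟩ := eventually_lt_dissipation (ν := ν) P h hρ0 hconv hV
    have hs₀' : (0 : ℝ) < s₀ := hs₀
    refine false_of_repeated_drop (H := fun n s => relEntropy (box d n) (P.evolve s ν) μ)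
      (vol := fun n => ((box d n).card : ℝ)) (C := -Real.log δ) (η := η / 4 * s₀) (s₀ := s₀) ht hvol
      (fun n s => hμ0.relEntropy_nonneg _ _) (fun n s => relEntropy_le hδ0 hnn _ _) ?_
      (by positivity) ?_
    · intro η' hη'
      filter_upwards [hupper η' hη'] with n hn r s
      simp only [P.evolve_add]
      refine hP.relEntropy_evolve_le hL_ti hΓ (hS n) hμTI hμ0 hstat
        (fun s => by rw [← P.evolve_add]; exact hνt _) ?_
      filter_upwards [self_mem_nhdsWithin] with θ hθ r _
      exact hn _ (hμ0.mixture hθ _)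
    · filter_upwards [hpersist] with k hk
      filter_upwards [eventually_sum_entropyBalance_le (ζ := ζ) hδ0 hδ1 hnn hK hK0 hε h hΓW hWV g
        (η / 2) (ε' := η / 8) (by positivity)] with n hn
      simp only [P.evolve_add]
      have h1 := hP.relEntropy_evolve_le (ν := P.evolve (t k) ν) (s := s₀)
        (B := -(η / 4) * (box d n).card) hL_ti hΓ (hS n) hμTI hμ0 hstat
        (fun s => by rw [← P.evolve_add]; exact hνt _) ?_
      · linarith
      filter_upwards [hk, self_mem_nhdsWithin] with θ hθ hθ0 r hr
      rw [← P.evolve_add]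
      refine (hn _ (hμ0.mixture hθ0 _) (hθ r hr).le).trans
        (mul_le_mul_of_nonneg_right ?_ (hvol n).le)
      linarith
  refine hcond.gibbs_of_zero_loss νstar hρTI ⟨fun n =>
    ∑ x ∈ box d (n + g), L.entropyBalance Γ μ νstar (shiftSet (-x) (box d n)), fun n => ?_, ?_⟩
  · rw [hPdef]
    simp only [hμ0.localRelEntropy_eq, EReal.toReal_coe]
    refine ⟨Eventually.of_forall fun s => EReal.coe_ne_top _, ?_⟩
    have h0 : P.evolve (0 : ℝ).toNNReal νstar = νstar := by simp [P.evolve_zero]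
    have h1 := hP.hasDerivWithinAt_relEntropy hL_ti hΓ (hS n) hμ0 νstar le_rfl (by rwa [h0])
    rw [h0, hP.integral_localGen_eq hL_ti hΓ (hS n) hμTI hstat hρTI] at h1
    exact h1
  · rw [Metric.tendsto_nhds]
    intro η hη
    filter_upwards [hupper (η / 2) (half_pos hη), hlower (η / 2) (half_pos hη)] with n h1 h2
    rw [Real.dist_eq, sub_zero, abs_div, abs_of_pos (hvol n), div_lt_iff₀ (hvol n)]
    have h3 := h1 νstar hρ0
    have h4 := mul_pos (half_pos hη) (hvol n)
    exact (abs_le.2 ⟨by linarith, h3⟩).trans_lt (by linarith)
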